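/- There are absolute constants $c,\epsilon>0$ such that the following holds. For $N=2^n$ and $x\in\mathbb R^N$, with coordinates indexed by $\mathbb F_2^n$, let $\hat x=\mathsf{DHT}(x)$ be the Hadamard transform $\hat x(i)=N^{-1/2}\sum_{j\in\mathbb F_2^n}(-1)^{\langle i,j\rangle}x(j)$, and let $H_k(x)$ be the vector that agrees with $x$ on $k$ coordinates of largest absolute value (ties broken arbitrarily) and is zero elsewhere. A function $h\colon\mathbb F_2^n\times[D]\to\mathbb F_2^r$ with $D\ge 1$ is a $(\kappa,\epsilon)$-lossless condenser if for every nonempty $S\subseteq\mathbb F_2^n$ with $|S|\le 2^\kappa$ the following holds: when $X$ is uniform on $S$ and $Z$ is uniform on $[D]$ and independent of $X$, the distribution of $(Z,h(X,Z))$ is within statistical distance $\epsilon$ of some distribution on $[D]\times\mathbb F_2^r$ with min-entropy at least $\log_2(D|S|)$. It is linear if $h(\cdot,t)$ is $\mathbb F_2$-linear for every $t\in[D]$. Let $P$ be a set of pairs of integers $(n,k)$ with $2\le k\le 2^n$, and for every $(n,k)\in P$ let $h_{n,k}\colon\mathbb F_2^n\times[D]\to\mathbb F_2^r$ (with $D=D(n,k)\ge1$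 and $r=r(n,k)$) be a linear $(\log_2 k,\epsilon)$-lossless condenser. Suppose that the family is explicit: one Turing machine computes $h_{n,k}(u,t)$ from $(k,u,t)$, where $u\in\mathbb F_2^n$ and $t\in[D]$, in time polynomial in $n$. Then there is a deterministic algorithm (one program for a real RAM, which performs $+,-,\times,/,\sqrt{\cdot}$ and comparisons on real numbers, and addition, subtraction, halving and comparisons on integers, at unit cost) such that for every $(n,k)\in P$, with $N=2^n$, the following holds. Given the integers $n,k,D,r$ and query access to $\hat x=\mathsf{DHT}(x)$ for an arbitrary $x\in\mathbb R^N$, the algorithm runs in time $N^{O(1)}$, where the implied constants do not depend on $n$, $k$ or $x$; it queries $\hat x$ non-adaptively (the list of queried positions does not depend on $x$) at no more than $D\cdot 2^r$ positions; and it outputs $\tilde x\in\mathbb R^N$ such that $$\|\tilde x-x\|_1\le c\cdot\|x-H_k(x)\|_1 .$$ -/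

import Mathlib

namespace SparseHadamard

/-! ### Vectors indexed by `𝔽₂ⁿ`, the Hadamard transform, best sparse approximations -/

/-- The vector space `𝔽₂ⁿ`. -/
abbrev F2 (n : ℕ) : Type := Fin n → ZMod 2

/-- The discrete Walsh-Hadamard transform
`x̂(i) = N^{-1/2} ∑_j (-1)^{⟨i,j⟩} x(j)`, `N = 2^n`. -/
noncomputable def DHT {n : ℕ} (x : F2 n → ℝ) : F2 n → ℝ := fun i =>
  1 / Real.sqrt ((2 : ℝ) ^ n) * ∑ j : F2 n, (-1 : ℝ) ^ (i ⬝ᵥ j).val * x j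

/-- The `ℓ₁` norm on `ℝ^N`. -/
def l1norm {n : ℕ} (x : F2 n → ℝ) : ℝ := ∑ i, |x i|

/-- `y` is a version of `H_k(x)`: it agrees with `x` on a set of `k` coordinates (all of them if
`k > N`) that are largest in absolute value, and vanishes elsewhere. Ties may be broken in any
way. -/
def IsTopK {n : ℕ} (k : ℕ) (x y : F2 n → ℝ) : Prop :=
  ∃ S : Finset (F2 n), S.card = min k (2 ^ n) ∧ (∀ i ∈ S, ∀ j ∉ S, |x j| ≤ |x i|) ∧
    (∀ i ∈ S, y i = x i) ∧ ∀ i ∉ S, y i = 0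

/-! ### Lossless condensers -/

/-- Statistical distance of two distributions on a finite set. -/
noncomputable def statDist {Ω : Type*} [Fintype Ω] (μ ν : PMF Ω) : ℝ :=
  1 / 2 * ∑ s, |(μ s).toReal - (ν s).toReal|

/-- Min-entropy (base `2`): the minimum of `-log μ(s)` over the support of `μ`. -/
noncomputable def minEntropy {Ω : Type*} [Fintype Ω] (μ : PMF Ω) : ℝ :=
  sInf ((fun s => -Real.logb 2 (μ s).toReal) '' μ.support)

/-- The law of `(Z, h(X, Z))`, where `X` is uniform on the nonempty set `S` and `Z` is uniform on
`[D]` and independent of `X`. -/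
noncomputable def seededOutput {n D r : ℕ} [NeZero D] (h : F2 n → Fin D → F2 r)
    (S : Finset (F2 n)) (hS : S.Nonempty) : PMF (Fin D × F2 r) :=
  (PMF.uniformOfFinset S hS).bind fun x =>
    (PMF.uniformOfFintype (Fin D)).map fun z => (z, h x z)

/-- `h : 𝔽₂ⁿ × [D] → 𝔽₂ʳ` is a `(κ, ε)`-lossless condenser. -/
def IsLosslessCondenser {n D r : ℕ} [NeZero D] (κ ε : ℝ) (h : F2 n → Fin D → F2 r) : Prop :=
  ∀ (S : Finset (F2 n)) (hS : S.Nonempty), (S.card : ℝ) ≤ (2 : ℝ) ^ κ →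
    ∃ μ : PMF (Fin D × F2 r), Real.logb 2 ((D : ℝ) * S.card) ≤ minEntropy μ ∧
      statDist (seededOutput h S hS) μ ≤ ε

/-- `h` is linear (over `𝔽₂`) in the first argument. -/
def IsLinearCondenser {n D r : ℕ} (h : F2 n → Fin D → F2 r) : Prop :=
  ∀ t, IsLinearMap (ZMod 2) fun x => h x t

/-- The bits of a vector, as a list. -/
def bitList {n : ℕ} (x : F2 n) : List Bool := List.ofFn fun i => decide (x i = 1)

/-- The input `(k, x, t)` of a machine that evaluates a condenser: the binary digits of `k`, the
bits of `x`, and the binary digits of `t` (numbers with the least significant digit first),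
with the separator `none` between them. -/
def condenserInput {n D : ℕ} (k : ℕ) (x : F2 n) (t : Fin D) : List (Option Bool) :=
  k.bits.map some ++ none :: ((bitList x).map some ++ none :: (t : ℕ).bits.map some)

/-- The family `h n k : 𝔽₂ⁿ × [D n k] → 𝔽₂^(r n k)`, with `(n, k)` ranging over `P`, is explicit:
one (multi-stack) Turing machine, on input `k, x, t`, outputs `h n k x t` within `p(n)` steps,
for some polynomial `p`. -/
def IsExplicit (P : Set (ℕ × ℕ)) (D r : ℕ → ℕ → ℕ)
    (h : ∀ n k : ℕ, F2 n → Fin (D n k) → F2 (r n k)) : Prop :=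
  ∃ (M : Turing.TM2ComputableAux (Option Bool) Bool) (p : Polynomial ℕ),
    ∀ n k : ℕ, (n, k) ∈ P → ∀ (x : F2 n) (t : Fin (D n k)),
      Nonempty (Turing.TM2OutputsInTime M.tm
        ((condenserInput k x t).map M.inputAlphabet.symm)
        (some ((bitList (h n k x t)).map M.outputAlphabet.symm)) (p.eval n))

/-! ### The machine model: a real RAM with query access to a real vector

A program is a finite text in a small imperative language. It works on integer registers, real
registers, integer arrays and real arrays (array names are fixed in the text, array positions are
computed), and may query an oracle for a real vector. Every executed instruction and every
evaluated test costs one time unit. Integers can be added, subtracted (truncated at `0`) and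
halved, but not multiplied, at unit cost, so that integers remain of length polynomial in the
input length and the running time; reals admit the operations `+`, `-`, `*`, `/`, `√` and
comparisons. There is no conversion of reals to integers, and the only literals are natural
numbers. -/

/-- Memory, together with the list of oracle positions queried so far. -/
structure State where
  nreg : ℕ → ℕ
  rreg : ℕ → ℝ
  narr : ℕ → ℕ → ℕ
  rarr : ℕ → ℕ → ℝ
  queries : List ℕ

/-- Instructions. The first argument is the name of the target register or array. -/
inductive Instr : Type
  | nconst (d c : ℕ)
  | nadd (d a b : ℕ)
  | nsub (d a b : ℕ)
  | nhalf (d a : ℕ)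
  | nload (d arr pos : ℕ)
  | nstore (arr pos a : ℕ)
  | rconst (d c : ℕ)
  | radd (d a b : ℕ)
  | rsub (d a b : ℕ)
  | rmul (d a b : ℕ)
  | rdiv (d a b : ℕ)
  | rsqrt (d a : ℕ)
  | rload (d arr pos : ℕ)
  | rstore (arr pos a : ℕ)
  | query (d pos : ℕ)

namespace State

/-- Write an integer register. -/
def setN (s : State) (d v : ℕ) : State := { s with nreg := Function.update s.nreg d v }

/-- Write a real register. -/
def setR (s : State) (d : ℕ) (v : ℝ) : State := { s with rreg := Function.update s.rreg d v }

/-- Write a cell of an integer array. -/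
def storeN (s : State) (arr i v : ℕ) : State :=
  { s with narr := Function.update s.narr arr (Function.update (s.narr arr) i v) }

/-- Write a cell of a real array. -/
def storeR (s : State) (arr i : ℕ) (v : ℝ) : State :=
  { s with rarr := Function.update s.rarr arr (Function.update (s.rarr arr) i v) }

end State

/-- The effect of an instruction, with oracle `O`. Division by zero and the square root of a
negative number yield `0`. -/
noncomputable def Instr.apply (O : ℕ → ℝ) : Instr → State → State
  | .nconst d c, s => s.setN d c
  | .nadd d a b, s => s.setN d (s.nreg a + s.nreg b)
  | .nsub d a b, s => s.setN d (s.nreg a - s.nreg b)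
  | .nhalf d a, s => s.setN d (s.nreg a / 2)
  | .nload d arr pos, s => s.setN d (s.narr arr (s.nreg pos))
  | .nstore arr pos a, s => s.storeN arr (s.nreg pos) (s.nreg a)
  | .rconst d c, s => s.setR d (c : ℝ)
  | .radd d a b, s => s.setR d (s.rreg a + s.rreg b)
  | .rsub d a b, s => s.setR d (s.rreg a - s.rreg b)
  | .rmul d a b, s => s.setR d (s.rreg a * s.rreg b)
  | .rdiv d a b, s => s.setR d (s.rreg a / s.rreg b)
  | .rsqrt d a, s => s.setR d (Real.sqrt (s.rreg a))
  | .rload d arr pos, s => s.setR d (s.rarr arr (s.nreg pos))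
  | .rstore arr pos a, s => s.storeR arr (s.nreg pos) (s.rreg a)
  | .query d pos, s =>
      { s.setR d (O (s.nreg pos)) with queries := s.queries ++ [s.nreg pos] }

/-- Tests: comparison of two integer registers or of two real registers. -/
inductive Test : Type
  | nlt (a b : ℕ)
  | rlt (a b : ℕ)

/-- The truth value of a test. -/
def Test.Holds : Test → State → Prop
  | .nlt a b, s => s.nreg a < s.nreg b
  | .rlt a b, s => s.rreg a < s.rreg b

/-- Programs. -/
inductive Prog : Type
  | skip
  | instr (i : Instr)
  | seq (p q : Prog)
  | ite (b : Test) (p q : Prog)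
  | while (b : Test) (p : Prog)

/-- `Exec O p s s' T`: with oracle `O`, program `p` started in state `s` halts in state `s'` after
exactly `T` time units. -/
inductive Exec (O : ℕ → ℝ) : Prog → State → State → ℕ → Prop
  | skip (s : State) : Exec O .skip s s 1
  | instr (i : Instr) (s : State) : Exec O (.instr i) s (i.apply O s) 1
  | seq {p q : Prog} {s s₁ s₂ : State} {T₁ T₂ : ℕ} :
      Exec O p s s₁ T₁ → Exec O q s₁ s₂ T₂ → Exec O (.seq p q) s s₂ (T₁ + T₂)
  | iteTrue {b : Test} {p q : Prog} {s s₁ : State} {T : ℕ} :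
      b.Holds s → Exec O p s s₁ T → Exec O (.ite b p q) s s₁ (T + 1)
  | iteFalse {b : Test} {p q : Prog} {s s₁ : State} {T : ℕ} :
      ¬ b.Holds s → Exec O q s s₁ T → Exec O (.ite b p q) s s₁ (T + 1)
  | whileTrue {b : Test} {p : Prog} {s s₁ s₂ : State} {T₁ T₂ : ℕ} :
      b.Holds s → Exec O p s s₁ T₁ → Exec O (.while b p) s₁ s₂ T₂ →
        Exec O (.while b p) s s₂ (T₁ + T₂ + 1)
  | whileFalse {b : Test} {p : Prog} {s : State} :
      ¬ b.Holds s → Exec O (.while b p) s s 1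

/-- Programs are deterministic: the final state and the running time are determined by the program,
the oracle and the initial state. -/
theorem Exec.deterministic {O : ℕ → ℝ} {p : Prog} {s s₁ s₂ : State} {T₁ T₂ : ℕ}
    (h₁ : Exec O p s s₁ T₁) (h₂ : Exec O p s s₂ T₂) : s₁ = s₂ ∧ T₁ = T₂ := by
  induction h₁ generalizing s₂ T₂ with
  | skip s => cases h₂; exact ⟨rfl, rfl⟩
  | instr i s => cases h₂; exact ⟨rfl, rfl⟩
  | seq _ _ ih₁ ih₂ =>
    cases h₂ with
    | seq a b =>
      obtain ⟨rfl, rfl⟩ := ih₁ a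
      obtain ⟨rfl, rfl⟩ := ih₂ b
      exact ⟨rfl, rfl⟩
  | iteTrue hb _ ih =>
    cases h₂ with
    | iteTrue _ a => obtain ⟨rfl, rfl⟩ := ih a; exact ⟨rfl, rfl⟩
    | iteFalse hb' _ => exact absurd hb hb'
  | iteFalse hb _ ih =>
    cases h₂ with
    | iteTrue hb' _ => exact absurd hb' hb
    | iteFalse _ a => obtain ⟨rfl, rfl⟩ := ih a; exact ⟨rfl, rfl⟩
  | whileTrue hb _ _ ih₁ ih₂ =>
    cases h₂ with
    | whileTrue _ a b =>
      obtain ⟨rfl, rfl⟩ := ih₁ a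
      obtain ⟨rfl, rfl⟩ := ih₂ b
      exact ⟨rfl, rfl⟩
    | whileFalse hb' => exact absurd hb hb'
  | whileFalse hb =>
    cases h₂ with
    | whileTrue hb' _ _ => exact absurd hb' hb
    | whileFalse _ => exact ⟨rfl, rfl⟩

/-- The initial state: the parameters `n, k, D, r` are in the integer registers `0, 1, 2, 3`, all
other memory is zero, and nothing has been queried. -/
def initState (n k D r : ℕ) : State where
  nreg i := if i = 0 then n else if i = 1 then k else if i = 2 then D else if i = 3 then r else 0
  rreg _ := 0
  narr _ _ := 0
  rarr _ _ := 0
  queries := []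

/-- The position in `𝔽₂ⁿ` that the integer `q` names through its `n` lowest binary digits (a
bijection between `{0, …, 2^n - 1}` and `𝔽₂ⁿ`). -/
def position (n q : ℕ) : F2 n := fun i => if q.testBit i then 1 else 0

/-- Query access to a vector of `ℝ^N`, `N = 2^n`. -/
def oracle {n : ℕ} (y : F2 n → ℝ) : ℕ → ℝ := fun q => y (position n q)

/-- The vector `z ∈ ℝ^N` is stored in the first `N = 2^n` cells of real array `0`. -/
def Outputs {n : ℕ} (s : State) (z : F2 n → ℝ) : Prop :=
  ∀ q < 2 ^ n, s.rarr 0 q = z (position n q)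

end SparseHadamard

/-! Put a coordinate `j` into bucket `(t, b)` when `h(j, t) = b`. Since `h(·, t)` is linear, the
indicator of a fibre is a combination of `2^r` characters of `𝔽₂ⁿ`. So the bucket sums for the seed
`t` can be computed from `2^r` values of `x̂`, at positions that depend on `h` alone
(`sum_fiber_eq_sum_DHT`). Hence `D·2^r` non-adaptive queries yield `y = Mx`, where `M` is the
adjacency matrix of the bipartite graph of the condenser. Losslessness says that a set of at most
`k` coordinates sends almost all its edges to distinct buckets. Collisions concern pairs, so a very
small `ε` still gives expansion by `19/20·D` for sets of size up to `130k`
(`IsLosslessCondenser.expand`).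

It remains to recover `x` approximately from `Mx`. Expansion makes `‖Mv‖₁` comparable to `D‖v‖₁` for
sparse `v` (`Graph.le_sum_abs_bucketSum`), so the computable number `‖y - Mz‖₁` measures the error
of a sparse `z`. It is decreased greedily, one coordinate at a time. The best shift of a coordinate
is a median of the residuals in its buckets, so only polynomially many trials are needed. If the
error is not already of the order of the tail, the best trial gains a fraction of order `1/K`, where
`K` bounds the sparsity of the difference (`Graph.greedy_step`). After `128k` such steps, truncation
to the `k` largest coordinates leaves at most half of the previous error plus a multiple of the tail
(`Graph.contraction`).

The number of halvings needed depends on the ratio of `‖x‖₁` to the tail, which is unbounded,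
whereas the running time must not depend on `x`. The remedy is to jump over gaps in the sizes of the
coordinates. After `16N` halvings, if the coordinates of `x` have a large gap below the next one to
be located, the approximation shows the same gap, and one of its superlevel sets is exactly the set
`A` above the gap. Peeling buckets with a unique neighbour in `A` then determines these coordinates
with error at most `2^|A|` times what lies outside `A`, however large the coordinates are. Peeling
all superlevel sets and keeping the candidate with the smallest residual therefore locates one more
coordinate per round (`Located.round`), and `N` rounds suffice.

On the machine side, the real RAM simulates the Turing machine to tabulate the condenser. If the
condenser has `N` buckets or more, the identity replaces it, and `N` queries are within the
allowance. All loops are bounded by a polynomial in `N`, which bounds the time (`Prog.cost_poly`).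
-/

namespace SparseHadamard

open Finset

/-! ### Expanding bipartite graphs -/

/-- Among finitely many reals, one of them minimises the sum of distances. -/
theorem exists_median {α : Type*} [DecidableEq α] (f : α → ℝ) (s : Finset α) (hs : s.Nonempty) :
    ∃ t ∈ s, ∀ v, ∑ b ∈ s, |f b - f t| ≤ ∑ b ∈ s, |f b - v| := by
  induction s using Finset.strongInduction with
  | H s ih =>
    -- Remove a smallest and a largest value. Their joint contribution is least for every `v`
    -- between them, so a median of the rest is also a median of all.
    obtain ⟨a, ha, hamin⟩ := s.exists_min_image f hs
    rcases (s.erase a).eq_empty_or_nonempty with h1 | h1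
    · refine ⟨a, ha, fun v => ?_⟩
      have : s = {a} := by
        rw [← insert_erase ha, h1]; rfl
      rw [this]; simp
    obtain ⟨c, hc, hcmax⟩ := (s.erase a).exists_max_image f h1
    have hac : f a ≤ f c := hamin c (mem_of_mem_erase hc)
    have key : ∀ g : α → ℝ, ∑ b ∈ s, g b = g a + (g c + ∑ b ∈ (s.erase a).erase c, g b) := by
      intro g
      rw [add_sum_erase _ _ hc, add_sum_erase _ _ ha]
    rcases ((s.erase a).erase c).eq_empty_or_nonempty with h2 | h2
    · refine ⟨a, ha, fun v => ?_⟩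
      rw [key, key, h2]
      simp only [sub_self, abs_zero, sum_empty, add_zero, zero_add]
      calc |f c - f a| = |(f c - v) - (f a - v)| := by ring_nf
        _ ≤ |f c - v| + |f a - v| := abs_sub _ _
        _ = _ := add_comm _ _
    · obtain ⟨t, ht, hmed⟩ := ih _
        (lt_of_le_of_lt (erase_subset _ _) (erase_ssubset ha)) h2
      have ht1 : t ∈ s.erase a := mem_of_mem_erase ht
      refine ⟨t, mem_of_mem_erase ht1, fun v => ?_⟩
      rw [key, key]
      have h3 := hmed v
      have h4 : f a ≤ f t := hamin t (mem_of_mem_erase ht1)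
      have h5 : f t ≤ f c := hcmax t ht1
      have h6 : |f a - f t| = f t - f a := by rw [abs_sub_comm]; exact abs_of_nonneg (by linarith)
      have h7 : |f c - f t| = f c - f t := abs_of_nonneg (by linarith)
      have h8 := neg_abs_le (f a - v)
      have h9 := le_abs_self (f c - v)
      linarith

/-- A bipartite graph with left vertices `0, …, N-1`, right vertices `0, …, B-1` and edges
`0, …, E-1`, without repeated edges, in which every left vertex has degree `d`. -/
structure Graph (N E B d : ℕ) (src bkt : ℕ → ℕ) : Prop where
  src_lt : ∀ e < E, src e < N
  bkt_lt : ∀ e < E, bkt e < B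
  deg : ∀ i < N, #{e ∈ range E | src e = i} = d
  inj : ∀ e < E, ∀ e' < E, src e = src e' → bkt e = bkt e' → e = e'

/-- Left vertex sets of size at most `K` expand by a factor at least `(1 - 1/20) d`. -/
def Expands (N E d : ℕ) (src bkt : ℕ → ℕ) (K : ℕ) : Prop :=
  ∀ A ⊆ range N, #A ≤ K →
    (19 / 20 : ℝ) * d * #A ≤ #(({e ∈ range E | src e ∈ A} : Finset ℕ).image bkt)

/-- The sums of `v` over the neighbourhoods of the right vertices. -/
def bucketSum (E : ℕ) (src bkt : ℕ → ℕ) (v : ℕ → ℝ) (b : ℕ) : ℝ :=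
  ∑ e ∈ range E with bkt e = b, v (src e)

/-- The difference between the bucket values `y` and the bucket sums of `z`. -/
def resid (E : ℕ) (src bkt : ℕ → ℕ) (y z : ℕ → ℝ) (b : ℕ) : ℝ :=
  y b - bucketSum E src bkt z b

/-- The `ℓ₁` norm of the residual. -/
def rho (E B : ℕ) (src bkt : ℕ → ℕ) (y z : ℕ → ℝ) : ℝ :=
  ∑ b ∈ range B, |resid E src bkt y z b|

/-- The `ℓ₁` norm of an array of length `N`. -/
def nrm (N : ℕ) (v : ℕ → ℝ) : ℝ := ∑ i ∈ range N, |v i|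

theorem nrm_nonneg (N : ℕ) (v : ℕ → ℝ) : 0 ≤ nrm N v := sum_nonneg fun _ _ => abs_nonneg _

theorem nrm_add_le (N : ℕ) (v w : ℕ → ℝ) : nrm N (v + w) ≤ nrm N v + nrm N w := by
  rw [nrm, nrm, nrm, ← sum_add_distrib]
  exact sum_le_sum fun _ _ => abs_add_le _ _

theorem nrm_sub_comm (N : ℕ) (v w : ℕ → ℝ) : nrm N (v - w) = nrm N (w - v) :=
  sum_congr rfl fun _ _ => abs_sub_comm _ _

theorem nrm_sub_le (N : ℕ) (u v w : ℕ → ℝ) : nrm N (u - w) ≤ nrm N (u - v) + nrm N (v - w) := by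
  rw [← sub_add_sub_cancel u v w]; exact nrm_add_le _ _ _

/-- The nonzero positions of an array of length `N`. -/
noncomputable def supp (N : ℕ) (v : ℕ → ℝ) : Finset ℕ := {i ∈ range N | v i ≠ 0}

theorem mem_supp {N : ℕ} {v : ℕ → ℝ} {i : ℕ} : i ∈ supp N v ↔ i < N ∧ v i ≠ 0 := by simp [supp]

theorem supp_sub_card (N : ℕ) (u z : ℕ → ℝ) : #(supp N (u - z)) ≤ #(supp N u) + #(supp N z) := by
  classical
  refine (card_le_card fun i hi => ?_).trans (card_union_le _ _)
  rw [mem_union, mem_supp, mem_supp]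
  rw [mem_supp] at hi
  by_contra h
  push Not at h
  exact hi.2 (by simp [h.1 hi.1, h.2 hi.1])

section

variable {N E B d : ℕ} {src bkt : ℕ → ℕ}

theorem Graph.sum_edges (G : Graph N E B d src bkt) (f : ℕ → ℝ) :
    ∑ e ∈ range E, f (src e) = d * ∑ i ∈ range N, f i := by
  rw [← sum_fiberwise_of_maps_to (s := range E) (t := range N) (g := src)
    (fun e he => mem_range.2 (G.src_lt e (mem_range.1 he))), mul_sum]
  refine sum_congr rfl fun i hi => ?_
  rw [sum_congr rfl (g := fun _ => f i) fun e he => by rw [(mem_filter.1 he).2], sum_const,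
    G.deg i (mem_range.1 hi), nsmul_eq_mul]

theorem Graph.sum_buckets (G : Graph N E B d src bkt) (f : ℕ → ℝ) :
    ∑ b ∈ range B, ∑ e ∈ range E with bkt e = b, f e = ∑ e ∈ range E, f e :=
  sum_fiberwise_of_maps_to (fun e he => mem_range.2 (G.bkt_lt e (mem_range.1 he))) _

theorem Graph.sum_bucket_nrm (G : Graph N E B d src bkt) (v : ℕ → ℝ) :
    ∑ b ∈ range B, ∑ e ∈ range E with bkt e = b, |v (src e)| = d * nrm N v := by
  rw [G.sum_buckets fun e => |v (src e)|, G.sum_edges fun i => |v i|, nrm]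

/-- Measuring is linear: the residual of `z` is the measurement of the error `x - z`. It is what
makes the unknown error accessible. -/
theorem resid_eq_bucketSum {y x : ℕ → ℝ} (hy : ∀ b < B, y b = bucketSum E src bkt x b)
    (z : ℕ → ℝ) {b : ℕ} (hb : b < B) :
    resid E src bkt y z b = bucketSum E src bkt (x - z) b := by
  rw [resid, hy b hb, bucketSum, bucketSum, bucketSum, ← sum_sub_distrib]; rfl

theorem Graph.sum_abs_bucketSum_le (G : Graph N E B d src bkt) (v : ℕ → ℝ) :
    ∑ b ∈ range B, |bucketSum E src bkt v b| ≤ d * nrm N v := by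
  rw [← G.sum_bucket_nrm]
  exact sum_le_sum fun b _ => abs_sum_le_sum_abs _ _

theorem Graph.rho_le (G : Graph N E B d src bkt) {y x : ℕ → ℝ}
    (hy : ∀ b < B, y b = bucketSum E src bkt x b) (z : ℕ → ℝ) :
    rho E B src bkt y z ≤ d * nrm N (x - z) := by
  refine le_trans (le_of_eq ?_) (G.sum_abs_bucketSum_le (x - z))
  exact sum_congr rfl fun b hb => by rw [resid_eq_bucketSum hy z (mem_range.1 hb)]

/-- The largest weight of a neighbour of the right vertex `b`. -/
noncomputable def bucketMax (E : ℕ) (src bkt : ℕ → ℕ) (w : ℕ → NNReal) (b : ℕ) : NNReal :=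
  ({e ∈ range E | bkt e = b} : Finset ℕ).sup fun e => w (src e)

/-- A layer-cake argument extends expansion from sets to weights. The smallest weight on `A` is
subtracted from all of `A`; this layer is a multiple of the indicator of `A`, to which expansion
applies, and the rest lives on a smaller set. -/
theorem Graph.expand_max (G : Graph N E B d src bkt) {K : ℕ} (hG : Expands N E d src bkt K)
    (A : Finset ℕ) : ∀ (w : ℕ → NNReal), A ⊆ range N → #A ≤ K → (∀ i ∉ A, w i = 0) →
    (19 / 20 : ℝ) * d * ∑ i ∈ A, (w i : ℝ) ≤ ∑ b ∈ range B, (bucketMax E src bkt w b : ℝ) := by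
  classical
  induction A using Finset.strongInduction with
  | H A ih =>
    intro w hA hK hw
    rcases A.eq_empty_or_nonempty with rfl | hne
    · simp only [sum_empty, mul_zero]; exact sum_nonneg fun _ _ => NNReal.coe_nonneg _
    obtain ⟨i₀, hi₀, hmin⟩ := A.exists_min_image w hne
    let w' : ℕ → NNReal := fun i => if i ∈ A then w i - w i₀ else 0
    have hw'A : ∀ i ∈ A, w i = w' i + w i₀ := fun i hi => by
      simp only [w', hi, if_true]; exact (tsub_add_cancel_of_le (hmin i hi)).symm
    have hw'0 : ∀ i ∉ A.erase i₀, w' i = 0 := fun i hi => by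
      by_cases h : i ∈ A
      · have : i = i₀ := by by_contra hne'; exact hi (mem_erase.2 ⟨hne', h⟩)
        simp [w', this]
      · simp [w', h]
    have h1 := ih (A.erase i₀) (erase_ssubset hi₀) w' ((erase_subset _ _).trans hA)
      ((card_le_card (erase_subset _ _)).trans hK) hw'0
    have h2 := hG A hA hK
    set NA := ({e ∈ range E | src e ∈ A} : Finset ℕ).image bkt with hNA
    have hNAB : NA ⊆ range B := by
      intro b hb
      obtain ⟨e, he, rfl⟩ := mem_image.1 hb
      exact mem_range.2 (G.bkt_lt e (mem_range.1 (mem_filter.1 he).1))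
    have h3 : ∑ i ∈ A.erase i₀, (w' i : ℝ) = ∑ i ∈ A, (w' i : ℝ) := by
      rw [← add_sum_erase _ _ hi₀]; simp [hw'0 i₀ (by simp)]
    have h4 : ∑ i ∈ A, (w i : ℝ) = ∑ i ∈ A, (w' i : ℝ) + #A * (w i₀ : ℝ) := by
      rw [sum_congr rfl fun i hi => by rw [hw'A i hi, NNReal.coe_add], sum_add_distrib]; simp
    -- Lowering the weights on `A` by `w i₀` lowers the maximum of every bucket that meets `A` by at
    -- least `w i₀`.
    have h5 : ∀ b ∈ range B, (bucketMax E src bkt w' b : ℝ) + (if b ∈ NA then (w i₀ : ℝ) else 0) ≤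
        bucketMax E src bkt w b := by
      intro b hb
      by_cases hbN : b ∈ NA
      · simp only [hbN, if_true]
        rw [← NNReal.coe_add, NNReal.coe_le_coe]
        obtain ⟨e, he, heb⟩ := mem_image.1 hbN
        have he' := mem_filter.1 he
        have hmem : ∀ e', e' ∈ ({e ∈ range E | bkt e = b} : Finset ℕ) →
            w (src e') ≤ bucketMax E src bkt w b := fun e' he' => by
          unfold bucketMax; exact Finset.le_sup (f := fun e => w (src e)) he'
        have hb0 : w i₀ ≤ bucketMax E src bkt w b :=
          (hmin _ he'.2).trans (hmem e (mem_filter.2 ⟨he'.1, heb⟩))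
        suffices h : bucketMax E src bkt w' b ≤ bucketMax E src bkt w b - w i₀ by
          calc _ ≤ (bucketMax E src bkt w b - w i₀) + w i₀ := by gcongr
            _ = _ := tsub_add_cancel_of_le hb0
        refine Finset.sup_le fun e' he'' => ?_
        by_cases hA' : src e' ∈ A
        · simp only [w', hA', if_true]
          exact tsub_le_tsub_right (hmem e' he'') _
        · simp [w', hA']
      · simp only [hbN, if_false, add_zero]
        rw [NNReal.coe_le_coe]
        refine Finset.sup_le fun e' he' => ?_
        have : src e' ∉ A := fun h => hbN (mem_image.2 ⟨e', mem_filter.2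
          ⟨(mem_filter.1 he').1, h⟩, (mem_filter.1 he').2⟩)
        simp [w', this]
    have h6 := sum_le_sum h5
    rw [sum_add_distrib, ← sum_filter, sum_const, nsmul_eq_mul] at h6
    have h7 : ({b ∈ range B | b ∈ NA} : Finset ℕ) = NA := by
      ext b; simp only [mem_filter]; exact ⟨fun h => h.2, fun h => ⟨hNAB h, h⟩⟩
    rw [h7] at h6
    rw [h3] at h1
    have h8 := mul_le_mul_of_nonneg_right h2 (NNReal.coe_nonneg (w i₀))
    rw [h4, mul_add]
    linarith

/-- Every bucket has a heaviest edge, and the other edges carry little weight. -/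
theorem Graph.exists_lead (G : Graph N E B d src bkt) {K : ℕ} (hG : Expands N E d src bkt K)
    (v : ℕ → ℝ) (hK : #(supp N v) ≤ K) :
    ∃ m : ℕ → ℝ, (∀ b, (m b = 0 ∧ ∀ e ∈ range E, bkt e = b → v (src e) = 0) ∨
        ∃ e ∈ range E, bkt e = b ∧ |v (src e)| = m b) ∧
      (19 / 20 : ℝ) * d * nrm N v ≤ ∑ b ∈ range B, m b := by
  classical
  let w : ℕ → NNReal := fun i => if i ∈ supp N v then ‖v i‖₊ else 0
  have hw : ∀ i < N, (w i : ℝ) = |v i| := fun i hi => by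
    by_cases h : v i = 0
    · simp [w, mem_supp, h]
    · simp [w, mem_supp, h, hi]
  have h1 := G.expand_max hG (supp N v) w (filter_subset _ _) hK
    (fun i hi => by simp [w, hi])
  have h2 : ∑ i ∈ supp N v, (w i : ℝ) = nrm N v := by
    rw [nrm, sum_congr rfl fun i hi => hw i (mem_supp.1 hi).1]
    refine sum_subset (filter_subset _ _) fun i hi hi' => ?_
    simp only [mem_supp, not_and, not_not] at hi'
    simp [hi' (mem_range.1 hi)]
  rw [h2] at h1
  refine ⟨fun b => bucketMax E src bkt w b, fun b => ?_, h1⟩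
  rcases ({e ∈ range E | bkt e = b} : Finset ℕ).eq_empty_or_nonempty with h | h
  · left
    refine ⟨by simp [bucketMax, h], fun e he hb => ?_⟩
    have hmem : e ∈ ({e ∈ range E | bkt e = b} : Finset ℕ) := mem_filter.2 ⟨he, hb⟩
    simp [h] at hmem
  · right
    obtain ⟨e, he, heq⟩ := exists_mem_eq_sup _ h fun e => w (src e)
    obtain ⟨he1, he2⟩ := mem_filter.1 he
    refine ⟨e, he1, he2, ?_⟩
    rw [← hw _ (G.src_lt e (mem_range.1 he1))]
    simp only [bucketMax]; rw [heq]

/-- Expansion implies that sparse vectors have large bucket sums. -/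
theorem Graph.le_sum_abs_bucketSum (G : Graph N E B d src bkt) {K : ℕ}
    (hG : Expands N E d src bkt K) (v : ℕ → ℝ) (hK : #(supp N v) ≤ K) :
    (9 / 10 : ℝ) * d * nrm N v ≤ ∑ b ∈ range B, |bucketSum E src bkt v b| := by
  classical
  obtain ⟨m, hm, hsum⟩ := G.exists_lead hG v hK
  -- In a bucket the heaviest entry `m b` can be cancelled at most by all the others, which leaves
  -- `2 m b` minus the total weight. Summed over the buckets this gives the factor `2 · 19/20 - 1 =
  -- 9/10`.
  have h1 : ∀ b ∈ range B, 2 * m b - ∑ e ∈ range E with bkt e = b, |v (src e)| ≤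
      |bucketSum E src bkt v b| := by
    intro b _
    rcases hm b with ⟨h0, h⟩ | ⟨e, he, heb, hem⟩
    · have : ∑ e ∈ range E with bkt e = b, |v (src e)| = 0 :=
        sum_eq_zero fun e he => by simp [h e (mem_filter.1 he).1 (mem_filter.1 he).2]
      rw [this, h0]; simp
    · have hmem : e ∈ ({e ∈ range E | bkt e = b} : Finset ℕ) := mem_filter.2 ⟨he, heb⟩
      rw [bucketSum, ← add_sum_erase _ _ hmem, ← add_sum_erase _ _ hmem, hem]
      have h3 := abs_sum_le_sum_abs (fun e => v (src e))
        (({e ∈ range E | bkt e = b} : Finset ℕ).erase e)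
      have h4 := abs_sub_abs_le_abs_sub (v (src e))
        (-∑ e ∈ ({e ∈ range E | bkt e = b} : Finset ℕ).erase e, v (src e))
      rw [abs_neg, sub_neg_eq_add] at h4
      linarith
  have h2 := sum_le_sum h1
  rw [sum_sub_distrib, ← mul_sum, G.sum_bucket_nrm] at h2
  linarith

/-- Adding `c` to one coordinate changes the residual in `d` buckets. -/
theorem Graph.rho_update (G : Graph N E B d src bkt) (y z : ℕ → ℝ) (i : ℕ) (c : ℝ) :
    rho E B src bkt y (Function.update z i (z i + c)) = rho E B src bkt y z +
      ∑ e ∈ range E with src e = i,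
        (|resid E src bkt y z (bkt e) - c| - |resid E src bkt y z (bkt e)|) := by
  classical
  have h1 : ∀ b, resid E src bkt y (Function.update z i (z i + c)) b =
      resid E src bkt y z b - #{e ∈ range E | bkt e = b ∧ src e = i} * c := by
    intro b
    have : bucketSum E src bkt (Function.update z i (z i + c)) b = bucketSum E src bkt z b +
        #{e ∈ range E | bkt e = b ∧ src e = i} * c := by
      rw [← nsmul_eq_mul, ← sum_const, ← filter_filter, bucketSum, bucketSum, sum_filter (fun e => src e = i),
        ← sum_add_distrib]
      refine sum_congr rfl fun e _ => ?_
      by_cases h : src e = i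
      · simp [h]
      · simp [h]
    rw [resid, this, resid]; ring
  have h2 : ∀ b, ∑ e ∈ range E with bkt e = b ∧ src e = i,
        (|resid E src bkt y z (bkt e) - c| - |resid E src bkt y z (bkt e)|) =
      |resid E src bkt y (Function.update z i (z i + c)) b| - |resid E src bkt y z b| := by
    intro b
    rw [h1]
    -- There are no repeated edges, so at most one edge joins `i` to `b`.
    rcases ({e ∈ range E | bkt e = b ∧ src e = i} : Finset ℕ).eq_empty_or_nonempty with h | ⟨e, he⟩
    · simp [h]
    · have hs : ({e ∈ range E | bkt e = b ∧ src e = i} : Finset ℕ) = {e} := by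
        refine eq_singleton_iff_unique_mem.2 ⟨he, fun e' he' => ?_⟩
        simp only [mem_filter, mem_range] at he he'
        exact G.inj e' he'.1 e he.1 (by rw [he'.2.2, he.2.2]) (by rw [he'.2.1, he.2.1])
      rw [hs]
      simp only [mem_filter] at he
      simp [he.2.1]
  rw [← sum_fiberwise_of_maps_to (s := ({e ∈ range E | src e = i} : Finset ℕ)) (t := range B)
    (g := bkt) (fun e he => mem_range.2 (G.bkt_lt e (mem_range.1 (mem_filter.1 he).1)))]
  simp only [filter_filter]
  rw [sum_congr rfl fun b _ => by rw [filter_congr (fun e _ => and_comm), h2 b], sum_sub_distrib]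
  simp [rho]

end

/-! ### Greedy descent on the residual -/

section

variable {N E B d : ℕ} {src bkt : ℕ → ℕ}

/-- If no update of one coordinate by the residual of an adjacent bucket makes the residual smaller
than `ρ'`, then `ρ'` is smaller than the present residual by a fixed fraction. -/
theorem Graph.greedy_step (G : Graph N E B d src bkt) {K : ℕ} (hG : Expands N E d src bkt K)
    {x y u z : ℕ → ℝ} (hy : ∀ b < B, y b = bucketSum E src bkt x b)
    (hK : #(supp N (u - z)) ≤ K) {ρ' : ℝ} (h0 : ρ' ≤ rho E B src bkt y z)
    (h1 : ∀ e < E, ρ' ≤ rho E B src bkt y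
      (Function.update z (src e) (z (src e) + resid E src bkt y z (bkt e)))) :
    (4 / 5 : ℝ) * rho E B src bkt y z - (14 / 5) * (d * nrm N (x - u)) ≤
      K * (rho E B src bkt y z - ρ') := by
  classical
  set Δ := u - z with hΔ
  set r := resid E src bkt y z with hr
  set ρ := rho E B src bkt y z with hρ
  obtain ⟨m, hm, hsum⟩ := G.exists_lead hG Δ hK
  let φ : ℕ → ℝ := fun e => |r (bkt e) - Δ (src e)| - |r (bkt e)|
  -- The sum `∑ φ` over the edges at `i` is the change of the residual norm if coordinate `i` is
  -- shifted by the ideal amount `Δ i`. A median of the adjacent residuals is an admissible shift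
  -- and does at least as well.
  have h2 : ∀ i, ρ' ≤ ρ + ∑ e ∈ range E with src e = i, φ e := by
    intro i
    rcases ({e ∈ range E | src e = i} : Finset ℕ).eq_empty_or_nonempty with h | h
    · rw [h]; simpa using h0
    · obtain ⟨e, he, hmin⟩ := exists_median (fun e => r (bkt e)) _ h
      obtain ⟨he1, he2⟩ := mem_filter.1 he
      have h3 := h1 e (mem_range.1 he1)
      rw [G.rho_update, he2] at h3
      have h4 := hmin (Δ i)
      have h5 : ∑ e ∈ range E with src e = i, φ e =
          ∑ e ∈ range E with src e = i, |r (bkt e) - Δ i| -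
            ∑ e ∈ range E with src e = i, |r (bkt e)| := by
        rw [← sum_sub_distrib]
        exact sum_congr rfl fun e he => by simp only [φ, (mem_filter.1 he).2]
      rw [sum_sub_distrib] at h3
      rw [h5]
      linarith
  have h3 : ∑ i ∈ supp N Δ, ∑ e ∈ range E with src e = i, φ e = ∑ e ∈ range E, φ e := by
    rw [← sum_fiberwise_of_maps_to (s := range E) (t := range N) (g := src)
      (fun e he => mem_range.2 (G.src_lt e (mem_range.1 he)))]
    refine sum_subset (filter_subset _ _) fun i hi hi' => sum_eq_zero fun e he => ?_
    have : Δ i = 0 := by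
      by_contra h; exact hi' (mem_supp.2 ⟨mem_range.1 hi, h⟩)
    simp [φ, (mem_filter.1 he).2, this]
  -- Coordinates where `Δ` vanishes have `φ = 0`, so the ideal shifts gain together at most `K (ρ -
  -- ρ')`.
  have h4 : ∑ i ∈ supp N Δ, (ρ' - ρ) ≤ ∑ e ∈ range E, φ e := by
    rw [← h3]; exact sum_le_sum fun i _ => by linarith [h2 i]
  rw [sum_const, nsmul_eq_mul] at h4
  -- Correcting the heaviest entry leaves a residual of at most `|s| + |ν|`, where `s` is the sum of
  -- the other entries and `ν` the noise; it was at least `m b - |s| - |ν|` before. Any other entry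
  -- raises the residual by at most its own weight. With `|s|` at most the total weight minus `m b`,
  -- the coefficients `3`, `-4` and `2` result.
  have h5 : ∀ b ∈ range B, ∑ e ∈ range E with bkt e = b, φ e ≤
      3 * ∑ e ∈ range E with bkt e = b, |Δ (src e)| - 4 * m b +
        2 * |bucketSum E src bkt (x - u) b| := by
    intro b hb
    have hrb : r b = bucketSum E src bkt Δ b + bucketSum E src bkt (x - u) b := by
      rw [hr, resid_eq_bucketSum hy z (mem_range.1 hb)]
      rw [bucketSum, bucketSum, bucketSum, ← sum_add_distrib]
      exact sum_congr rfl fun e _ => by simp [hΔ]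
    have hν := abs_nonneg (bucketSum E src bkt (x - u) b)
    have hφ : ∀ e, φ e ≤ |Δ (src e)| := fun e => by
      have := abs_sub (r (bkt e)) (Δ (src e))
      simp only [φ]; linarith
    rcases hm b with ⟨hm0, hz⟩ | ⟨e, he, heb, hem⟩
    · have h6 : ∀ e ∈ ({e ∈ range E | bkt e = b} : Finset ℕ), Δ (src e) = 0 := fun e he =>
        hz e (mem_filter.1 he).1 (mem_filter.1 he).2
      rw [sum_eq_zero fun e he => by simp [φ, h6 e he], sum_eq_zero fun e he => by rw [h6 e he, abs_zero],
        hm0]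
      linarith
    · have hmem : e ∈ ({e ∈ range E | bkt e = b} : Finset ℕ) := mem_filter.2 ⟨he, heb⟩
      have h6 : ∑ e' ∈ ({e ∈ range E | bkt e = b} : Finset ℕ).erase e, φ e' ≤
          ∑ e' ∈ ({e ∈ range E | bkt e = b} : Finset ℕ).erase e, |Δ (src e')| :=
        sum_le_sum fun e' _ => hφ e'
      have h7 := abs_sum_le_sum_abs (fun e => Δ (src e))
        (({e ∈ range E | bkt e = b} : Finset ℕ).erase e)
      rw [bucketSum, ← add_sum_erase _ _ hmem] at hrb
      rw [← add_sum_erase _ _ hmem, ← add_sum_erase _ _ hmem, hem]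
      set s := ∑ e' ∈ ({e ∈ range E | bkt e = b} : Finset ℕ).erase e, Δ (src e')
      set ν := bucketSum E src bkt (x - u) b
      have h8 : φ e ≤ 2 * (|s| + |ν|) - m b := by
        simp only [φ, heb]
        have h9 : |r b - Δ (src e)| ≤ |s| + |ν| := by
          rw [hrb, show Δ (src e) + s + ν - Δ (src e) = s + ν by ring]; exact abs_add_le _ _
        have h10 := abs_sub_abs_le_abs_sub (Δ (src e)) (r b)
        rw [abs_sub_comm, hem] at h10
        linarith
      linarith
  have h6 := sum_le_sum h5
  rw [G.sum_buckets φ, sum_add_distrib] at h6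
  rw [sum_sub_distrib (f := fun b => 3 * ∑ e ∈ range E with bkt e = b, |Δ (src e)|), ← mul_sum,
    ← mul_sum, ← mul_sum, G.sum_bucket_nrm] at h6
  -- Summation gives `(3 - 4 · 19/20) d‖Δ‖ = -(4/5) d‖Δ‖`, and `d‖Δ‖` is bounded below by `ρ - d‖x -
  -- u‖`.
  have h7 := G.sum_abs_bucketSum_le (x - u)
  have h8 : ρ ≤ d * nrm N Δ + d * nrm N (x - u) := by
    refine (G.rho_le hy z).trans ?_
    rw [← mul_add]
    refine mul_le_mul_of_nonneg_left ?_ (Nat.cast_nonneg _)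
    rw [add_comm]; exact nrm_sub_le _ _ _ _
  have h9 : (#(supp N Δ) : ℝ) * (ρ - ρ') ≤ K * (ρ - ρ') :=
    mul_le_mul_of_nonneg_right (by exact_mod_cast hK) (by linarith)
  nlinarith [h4, h6, h7, h8, h9, hsum]

/-- The measure of progress of the greedy steps. -/
noncomputable def excessRho (ρ η : ℝ) : ℝ := max (ρ - 4 * η) 0

/-- For `ρ > 4η` the hypothesis makes the gain at least `(ρ - 4η)/(2K)`, so the excess shrinks by `1
- 1/(2K)`, and the square of this factor is at most `K/(K+1)`. This form telescopes when `K` grows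
by one in each step. -/
theorem excessRho_step {ρ ρ' η : ℝ} {K : ℕ} (hK : 1 ≤ K) (h0 : ρ' ≤ ρ)
    (h : (4 / 5 : ℝ) * ρ - (14 / 5) * η ≤ K * (ρ - ρ')) (hη : 0 ≤ η) :
    excessRho ρ' η ^ 2 * (K + 1) ≤ excessRho ρ η ^ 2 * K := by
  have hK' : (1 : ℝ) ≤ K := by exact_mod_cast hK
  rcases le_or_gt ρ (4 * η) with h1 | h1
  · have : excessRho ρ' η = 0 := max_eq_right (by linarith)
    rw [this]
    simp only [ne_eq, OfNat.ofNat_ne_zero, not_false_eq_true, zero_pow, zero_mul]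
    positivity
  · have h2 : excessRho ρ η = ρ - 4 * η := max_eq_left (by linarith)
    set σ := excessRho ρ η
    have hσ : 0 < σ := by rw [h2]; linarith
    have h3 : excessRho ρ' η * K ≤ (K - 1 / 2) * σ := by
      rw [excessRho, max_mul_of_nonneg _ _ (by linarith)]
      refine max_le ?_ ?_
      · rw [h2]; nlinarith
      · rw [zero_mul]; exact mul_nonneg (by linarith) hσ.le
    have h4 : 0 ≤ excessRho ρ' η := le_max_right _ _
    have h5 : (excessRho ρ' η * K) ^ 2 ≤ ((K - 1 / 2) * σ) ^ 2 :=
      pow_le_pow_left₀ (by positivity) h3 2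
    have h6 : (K : ℝ) ^ 2 * (excessRho ρ' η ^ 2 * (K + 1)) ≤ (K : ℝ) ^ 2 * (σ ^ 2 * K) := by
      calc (K : ℝ) ^ 2 * (excessRho ρ' η ^ 2 * (K + 1)) = (excessRho ρ' η * K) ^ 2 * (K + 1) := by
            ring
        _ ≤ ((K - 1 / 2) * σ) ^ 2 * (K + 1) := by gcongr
        _ = σ ^ 2 * ((K : ℝ) ^ 3 - 3 / 4 * K + 1 / 4) := by ring
        _ ≤ σ ^ 2 * (K : ℝ) ^ 3 := by gcongr; linarith
        _ = _ := by ring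
    exact le_of_mul_le_mul_left h6 (by positivity)

/-- The telescoped product from `2k` to `130k` is `1/65 < 1/64`, so the excess itself has fallen by
the factor `8`. -/
theorem excessRho_final {ρ₀ ρ η : ℝ} {k : ℕ} (hk : 1 ≤ k) (hρ₀ : 0 ≤ ρ₀) (hη : 0 ≤ η)
    (h : excessRho ρ η ^ 2 * (2 * k + 128 * k) ≤ excessRho ρ₀ η ^ 2 * (2 * k)) :
    ρ ≤ ρ₀ / 8 + 4 * η := by
  have hk' : (1 : ℝ) ≤ k := by exact_mod_cast hk
  have h1 : 0 ≤ excessRho ρ₀ η := le_max_right _ _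
  have h2 : excessRho ρ₀ η ≤ ρ₀ := max_le (by linarith) hρ₀
  have h3 : ρ - 4 * η ≤ excessRho ρ η := le_max_left _ _
  have h4 : (8 * excessRho ρ η) ^ 2 ≤ excessRho ρ₀ η ^ 2 := by
    have h5 : (k : ℝ) * (8 * excessRho ρ η) ^ 2 ≤ k * excessRho ρ₀ η ^ 2 := by
      nlinarith [sq_nonneg (excessRho ρ η)]
    exact le_of_mul_le_mul_left h5 (by linarith)
  have h5 := abs_le_of_sq_le_sq h4 h1
  linarith [le_abs_self (8 * excessRho ρ η)]

/-! ### Keeping the `k` largest coordinates -/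

/-- Position `m` precedes `l` in the order by decreasing absolute value, then by index. -/
def Precedes (z : ℕ → ℝ) (m l : ℕ) : Prop := |z l| < |z m| ∨ (|z l| = |z m| ∧ m < l)

/-- The number of positions that precede `l`. -/
noncomputable def magRank (N : ℕ) (z : ℕ → ℝ) (l : ℕ) : ℕ := by
  classical exact #{m ∈ range N | Precedes z m l}

/-- The array that agrees with `z` in the first `k` positions in the order by decreasing absolute
value. -/
noncomputable def topK (N k : ℕ) (z : ℕ → ℝ) (l : ℕ) : ℝ := if magRank N z l < k then z l else 0

theorem not_precedes_self (z : ℕ → ℝ) (l : ℕ) : ¬ Precedes z l l := by simp [Precedes]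

theorem magRank_lt {z : ℕ → ℝ} {m l : ℕ} (hm : m < N) (h : Precedes z m l) :
    magRank N z m < magRank N z l := by
  classical
  refine card_lt_card ⟨fun j hj => ?_, fun hsub => ?_⟩
  · rw [mem_filter] at hj ⊢
    simp only [Precedes] at hj h ⊢
    refine ⟨hj.1, ?_⟩
    rcases hj.2 with h1 | h1 <;> rcases h with h2 | h2
    · left; linarith
    · left; linarith [h2.1]
    · left; linarith [h1.1]
    · right; exact ⟨h2.1.trans h1.1, h1.2.trans h2.2⟩
  · have := hsub (mem_filter.2 ⟨mem_range.2 hm, h⟩)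
    exact not_precedes_self z m (mem_filter.1 this).2

theorem precedes_trichotomy (z : ℕ → ℝ) {m l : ℕ} (h : m ≠ l) : Precedes z m l ∨ Precedes z l m := by
  simp only [Precedes]
  rcases lt_trichotomy |z l| |z m| with h1 | h1 | h1
  · simp [h1]
  · rcases lt_or_gt_of_ne h with h2 | h2 <;> simp [h1, h2]
  · simp [h1]

theorem magRank_injOn (N : ℕ) (z : ℕ → ℝ) : Set.InjOn (magRank N z) (range N) := by
  intro m hm l hl h
  by_contra hne
  rcases precedes_trichotomy z hne with h1 | h1
  · exact (magRank_lt (mem_range.1 hm) h1).ne h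
  · exact (magRank_lt (mem_range.1 hl) h1).ne h.symm

/-- Ties are broken by the index, so the `N` ranks are distinct and below `N`; hence every rank
below `N` occurs exactly once. -/
theorem card_magRank_lt (N k : ℕ) (z : ℕ → ℝ) : #{l ∈ range N | magRank N z l < k} = min k N := by
  classical
  have h1 : ∀ l ∈ range N, magRank N z l ∈ range N := fun l hl => by
    rw [mem_range]
    calc magRank N z l < #(range N) := by
          refine card_lt_card ⟨filter_subset _ _, fun hsub => ?_⟩
          have := hsub hl
          exact not_precedes_self z l (mem_filter.1 this).2
      _ = N := card_range N
  have h2 : (range N).image (magRank N z) = range N :=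
    eq_of_subset_of_card_le (image_subset_iff.2 h1)
      (by rw [card_image_of_injOn (magRank_injOn N z)])
  rw [← card_image_of_injOn ((magRank_injOn N z).mono
    (by exact_mod_cast filter_subset _ _))]
  have h3 : ({l ∈ range N | magRank N z l < k} : Finset ℕ).image (magRank N z) =
      range (min k N) := by
    ext j
    simp only [mem_image, mem_filter, mem_range, lt_min_iff]
    constructor
    · rintro ⟨l, ⟨hl, hk⟩, rfl⟩; exact ⟨hk, mem_range.1 (h1 l (mem_range.2 hl))⟩
    · rintro ⟨hk, hj⟩
      obtain ⟨l, hl, rfl⟩ := mem_image.1 (h2.symm ▸ mem_range.2 hj : j ∈ (range N).image _)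
      exact ⟨l, ⟨mem_range.1 hl, hk⟩, rfl⟩
  rw [h3, card_range]

theorem card_supp_topK (N k : ℕ) (z : ℕ → ℝ) : #(supp N (topK N k z)) ≤ k := by
  classical
  refine (card_le_card fun l hl => ?_).trans
    ((card_magRank_lt N k z).le.trans (min_le_left _ _))
  rw [mem_supp] at hl
  refine mem_filter.2 ⟨mem_range.2 hl.1, ?_⟩
  by_contra h
  exact hl.2 (by simp [topK, h])

/-- No array with at most `k` nonzero entries is closer to `z` than `topK N k z`, so truncation
moves `z` by at most `‖u - z‖`, and the triangle inequality gives the factor `2`. -/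
theorem nrm_topK_sub_le {k : ℕ} (z u : ℕ → ℝ) (hu : #(supp N u) ≤ k) :
    nrm N (u - topK N k z) ≤ 2 * nrm N (u - z) := by
  classical
  set Q : Finset ℕ := {l ∈ range N | magRank N z l < k} with hQ
  set U := supp N u with hU
  have hQN : Q ⊆ range N := filter_subset _ _
  have hUN : U ⊆ range N := filter_subset _ _
  have hcard : #U ≤ #Q := by
    rw [hQ, card_magRank_lt]
    exact le_min hu ((card_le_card hUN).trans (card_range N).le)
  have hcard' : #(U \ Q) ≤ #(Q \ U) := by
    have h1 := card_sdiff_add_card_inter U Q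
    have h2 := card_sdiff_add_card_inter Q U
    rw [inter_comm] at h2; omega
  -- Exchange: `U \ Q` has at most as many elements as `Q \ U`, and every entry of `z` on `Q \ U`
  -- dominates every entry on `U \ Q`.
  have h1 : ∑ l ∈ U \ Q, |z l| ≤ ∑ l ∈ Q \ U, |z l| := by
    rcases (U \ Q).eq_empty_or_nonempty with h | h
    · rw [h]; simpa using sum_nonneg fun i _ => abs_nonneg (z i)
    obtain ⟨j, hj, hmax⟩ := (U \ Q).exists_max_image (fun l => |z l|) h
    have hj' := mem_sdiff.1 hj
    have hle : ∀ l ∈ Q \ U, |z j| ≤ |z l| := by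
      intro l hl
      have hl' := mem_filter.1 (mem_sdiff.1 hl).1
      have hjk : ¬ magRank N z j < k := fun h => hj'.2 (mem_filter.2 ⟨hUN hj'.1, h⟩)
      have hne : l ≠ j := by rintro rfl; exact hjk hl'.2
      rcases precedes_trichotomy z hne with h | h
      · rcases h with h | h
        · exact h.le
        · exact h.1.le
      · have := magRank_lt (mem_range.1 (hUN hj'.1)) h
        omega
    calc ∑ l ∈ U \ Q, |z l| ≤ #(U \ Q) * |z j| := by
          rw [← nsmul_eq_mul]; exact sum_le_card_nsmul _ _ _ hmax
      _ ≤ #(Q \ U) * |z j| :=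
          mul_le_mul_of_nonneg_right (by exact_mod_cast hcard') (abs_nonneg _)
      _ ≤ _ := by rw [← nsmul_eq_mul]; exact card_nsmul_le_sum _ _ _ hle
  have h2 : ∑ l ∈ range N \ Q, |z l| ≤ ∑ l ∈ range N \ U, |z l| := by
    have e1 : range N \ Q = (U \ Q) ∪ (range N \ (Q ∪ U)) := by
      ext l; simp only [mem_sdiff, mem_union]
      constructor
      · rintro ⟨h, h'⟩; by_cases hl : l ∈ U
        · exact Or.inl ⟨hl, h'⟩
        · exact Or.inr ⟨h, by simp [h', hl]⟩
      · rintro (⟨h, h'⟩ | ⟨h, h'⟩)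
        · exact ⟨hUN h, h'⟩
        · exact ⟨h, fun hq => h' (Or.inl hq)⟩
    have e2 : range N \ U = (Q \ U) ∪ (range N \ (Q ∪ U)) := by
      ext l; simp only [mem_sdiff, mem_union]
      constructor
      · rintro ⟨h, h'⟩; by_cases hl : l ∈ Q
        · exact Or.inl ⟨hl, h'⟩
        · exact Or.inr ⟨h, by simp [h', hl]⟩
      · rintro (⟨h, h'⟩ | ⟨h, h'⟩)
        · exact ⟨hQN h, h'⟩
        · exact ⟨h, fun hq => h' (Or.inr hq)⟩
    rw [e1, e2, sum_union, sum_union]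
    · linarith
    · exact disjoint_left.2 fun l hl hl' => (mem_sdiff.1 hl').2 (mem_union_left _ (mem_sdiff.1 hl).1)
    · exact disjoint_left.2 fun l hl hl' => (mem_sdiff.1 hl').2 (mem_union_right _ (mem_sdiff.1 hl).1)
  have h3 : nrm N (z - topK N k z) = ∑ l ∈ range N \ Q, |z l| := by
    rw [nrm, ← sum_sdiff hQN, sum_eq_zero (s := Q), add_zero]
    · refine sum_congr rfl fun l hl => ?_
      have hl' := mem_sdiff.1 hl
      have : ¬ magRank N z l < k := fun h => hl'.2 (mem_filter.2 ⟨hl'.1, h⟩)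
      simp [topK, this]
    · intro l hl
      simp [topK, (mem_filter.1 hl).2]
  have h4 : ∑ l ∈ range N \ U, |z l| ≤ nrm N (u - z) := by
    rw [nrm, ← sum_sdiff hUN]
    refine le_add_of_le_of_nonneg (sum_le_sum fun l hl => ?_)
      (sum_nonneg fun _ _ => abs_nonneg _)
    have hl' := mem_sdiff.1 hl
    have : u l = 0 := by
      by_contra h; exact hl'.2 (mem_supp.2 ⟨mem_range.1 hl'.1, h⟩)
    simp [this]
  have h5 := nrm_sub_le N u z (topK N k z)
  linarith

end

/-! ### One iteration: descent and truncation -/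

section

variable {N E B d : ℕ} {src bkt : ℕ → ℕ}

/-- The restriction of an array to a set of positions. -/
noncomputable def restr (S : Finset ℕ) (x : ℕ → ℝ) (i : ℕ) : ℝ := if i ∈ S then x i else 0

/-- The `ℓ₁` norm of an array outside a set of positions. -/
def tail (N : ℕ) (x : ℕ → ℝ) (S : Finset ℕ) : ℝ := ∑ i ∈ range N \ S, |x i|

theorem tail_nonneg (N : ℕ) (x : ℕ → ℝ) (S : Finset ℕ) : 0 ≤ tail N x S :=
  sum_nonneg fun _ _ => abs_nonneg _

theorem nrm_sub_restr {S : Finset ℕ} (hS : S ⊆ range N) (x : ℕ → ℝ) :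
    nrm N (x - restr S x) = tail N x S := by
  rw [nrm, ← sum_sdiff hS, sum_eq_zero (s := S), add_zero, tail]
  · exact sum_congr rfl fun i hi => by simp [restr, (mem_sdiff.1 hi).2]
  · intro i hi; simp [restr, hi]

theorem card_supp_restr (S : Finset ℕ) (x : ℕ → ℝ) : #(supp N (restr S x)) ≤ #S :=
  card_le_card fun i hi => by
    by_contra h
    exact (mem_supp.1 hi).2 (by simp [restr, h])

/-- The measurement of `u - z` is the residual of `z` minus the measurement of the noise `x - u`.
Since `u - z` is sparse, its norm can be read off from its measurement up to the factor `9/10`. This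
is what allows candidates to be ranked by their residuals. -/
theorem Graph.dist_le (G : Graph N E B d src bkt) {K : ℕ} (hG : Expands N E d src bkt K)
    {x y u z : ℕ → ℝ} (hy : ∀ b < B, y b = bucketSum E src bkt x b)
    (hK : #(supp N u) + #(supp N z) ≤ K) :
    (9 / 10 : ℝ) * (d * nrm N (u - z)) ≤ rho E B src bkt y z + d * nrm N (x - u) := by
  have h1 := G.le_sum_abs_bucketSum hG (u - z) ((supp_sub_card N u z).trans hK)
  have h2 := G.sum_abs_bucketSum_le (x - u)
  have h3 : ∑ b ∈ range B, |bucketSum E src bkt (u - z) b| ≤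
      rho E B src bkt y z + ∑ b ∈ range B, |bucketSum E src bkt (x - u) b| := by
    rw [rho, ← sum_add_distrib]
    refine sum_le_sum fun b hb => ?_
    rw [resid_eq_bucketSum hy z (mem_range.1 hb)]
    have : bucketSum E src bkt (u - z) b =
        bucketSum E src bkt (x - z) b - bucketSum E src bkt (x - u) b := by
      rw [bucketSum, bucketSum, bucketSum, ← sum_sub_distrib]
      exact sum_congr rfl fun e _ => by simp
    rw [this]; exact abs_sub _ _
  linarith

/-- `128 k` greedy steps, followed by restriction to the `k` largest coordinates, halve the error up
to a multiple of the tail. -/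
theorem Graph.contraction (G : Graph N E B d src bkt) (hd : 1 ≤ d) {k : ℕ} (hk : 1 ≤ k)
    (hG : Expands N E d src bkt (130 * k)) {x y z z' : ℕ → ℝ} {S : Finset ℕ} (hS : S ⊆ range N)
    (hSk : #S ≤ k) (hy : ∀ b < B, y b = bucketSum E src bkt x b)
    (hz' : #(supp N z') ≤ k + 128 * k)
    (h : excessRho (rho E B src bkt y z') (d * tail N x S) ^ 2 * (2 * k + 128 * k) ≤
      excessRho (rho E B src bkt y z) (d * tail N x S) ^ 2 * (2 * k)) :
    nrm N (restr S x - topK N k z') ≤ nrm N (restr S x - z) / 2 + 12 * tail N x S := by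
  have hd' : (1 : ℝ) ≤ d := by exact_mod_cast hd
  have hη := tail_nonneg N x S
  have hu := (card_supp_restr (N := N) S x).trans hSk
  have h1 := excessRho_final hk (sum_nonneg fun _ _ => abs_nonneg _)
    (mul_nonneg (by linarith) hη) h
  have h2 := G.dist_le hG hy (u := restr S x) (z := z') (by omega)
  have h3 := nrm_topK_sub_le (N := N) z' _ hu
  have h4 := G.rho_le hy z
  have h5 := nrm_sub_le N x (restr S x) z
  rw [nrm_sub_restr hS] at h2 h5
  have h6 : (d : ℝ) * nrm N (x - z) ≤ d * (tail N x S + nrm N (restr S x - z)) := by gcongr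
  change rho E B src bkt y z' ≤ rho E B src bkt y z / 8 + 4 * _ at h1
  -- Writing `e = ‖u - z‖` and `η` for the tail, the distance of `u` from `z'` is at most
  -- `(10/9)(e/8 + 41η/8)`. Truncation doubles it, and `20/72 ≤ 1/2` and `820/72 ≤ 12`.
  have h7 : (d : ℝ) * ((9 / 10) * nrm N (restr S x - z')) ≤
      d * ((tail N x S + nrm N (restr S x - z)) / 8 + 5 * tail N x S) := by linarith
  have h8 := le_of_mul_le_mul_left h7 (by linarith)
  linarith [nrm_nonneg N (restr S x - z)]

/-! ### Peeling -/

/-- During peeling of `A`: `act` holds the coordinates not yet determined, `w` the values found. -/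
structure Peeling (N : ℕ) (x : ℕ → ℝ) (A act : Finset ℕ) (w : ℕ → ℝ) : Prop where
  sub : act ⊆ A
  off : ∀ i < N, i ∉ A → w i = 0
  zero : ∀ i ∈ act, w i = 0
  err : (∑ i ∈ range N \ act, |x i - w i|) * 2 ^ #act ≤ 2 ^ #A * tail N x A

theorem Peeling.init (N : ℕ) (x : ℕ → ℝ) (A : Finset ℕ) : Peeling N x A A 0 where
  sub := Subset.rfl
  off _ _ _ := rfl
  zero _ _ := rfl
  err := by simp [tail, mul_comm]

/-- The bucket of `e` contains only one undetermined coordinate. Its residual is that coordinate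
plus errors of coordinates outside `act`, each occurring at most once. So the new error is at most
the sum of the existing ones, and the total error at most doubles; this is the factor `2` lost in `2
^ #act`. -/
theorem Peeling.step (G : Graph N E B d src bkt) {x y w : ℕ → ℝ} {A act : Finset ℕ}
    (hA : A ⊆ range N)
    (hy : ∀ b < B, y b = bucketSum E src bkt x b) (h : Peeling N x A act w) {e : ℕ} (he : e < E)
    (hact : src e ∈ act) (huniq : ∀ e' < E, bkt e' = bkt e → src e' ≠ src e → src e' ∉ act) :
    Peeling N x A (act.erase (src e))
      (Function.update w (src e) (resid E src bkt y w (bkt e))) where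
  sub := (erase_subset _ _).trans h.sub
  off i hi hiA := by
    rw [Function.update_of_ne (by rintro rfl; exact hiA (h.sub hact))]; exact h.off i hi hiA
  zero i hi := by
    rw [Function.update_of_ne (mem_erase.1 hi).1]; exact h.zero i (mem_erase.1 hi).2
  err := by
    classical
    set i₀ := src e
    set v := resid E src bkt y w (bkt e)
    have hi₀ : i₀ ∈ range N := hA (h.sub hact)
    have h1 : |x i₀ - v| ≤ ∑ i ∈ range N \ act, |x i - w i| := by
      have hmem : e ∈ ({e' ∈ range E | bkt e' = bkt e} : Finset ℕ) := by simp [he]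
      have hv : v = x i₀ + ∑ e' ∈ ({e' ∈ range E | bkt e' = bkt e} : Finset ℕ).erase e,
          (x - w) (src e') := by
        simp only [v]
        rw [resid_eq_bucketSum hy w (G.bkt_lt e he), bucketSum, ← add_sum_erase _ _ hmem]
        simp only [Pi.sub_apply]
        rw [h.zero i₀ hact, sub_zero]
      rw [hv, sub_add_cancel_left, abs_neg]
      refine (abs_sum_le_sum_abs _ _).trans ?_
      have hinj : Set.InjOn src (({e' ∈ range E | bkt e' = bkt e} : Finset ℕ).erase e) := by
        intro a ha b hb hab
        simp only [coe_erase, Set.mem_sdiff, mem_coe, mem_filter, mem_range] at ha hb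
        exact G.inj a ha.1.1 b hb.1.1 hab (ha.1.2.trans hb.1.2.symm)
      rw [← sum_image (f := fun i => |(x - w) i|) hinj]
      refine sum_le_sum_of_subset_of_nonneg (fun i hi => ?_) fun _ _ _ => abs_nonneg _
      obtain ⟨e', he', rfl⟩ := mem_image.1 hi
      obtain ⟨hne, he'⟩ := mem_erase.1 he'
      obtain ⟨he1, he2⟩ := mem_filter.1 he'
      have he1' := mem_range.1 he1
      exact mem_sdiff.2 ⟨mem_range.2 (G.src_lt _ he1'),
        huniq e' he1' he2 fun hs => hne (G.inj e' he1' e he hs he2)⟩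
    have h2 : range N \ act.erase i₀ = insert i₀ (range N \ act) := by
      ext i; simp only [mem_sdiff, mem_erase, mem_insert]
      by_cases hi : i = i₀
      · subst hi; simp [mem_range.1 hi₀]
      · simp [hi]
    rw [h2, sum_insert (by simp [hact]), Function.update_self,
      sum_congr rfl (g := fun i => |x i - w i|) fun i hi => by
        rw [Function.update_of_ne (by rintro rfl; exact (mem_sdiff.1 hi).2 hact)]]
    have h3 : #act = #(act.erase i₀) + 1 := by
      rw [card_erase_of_mem hact]; have := card_pos.2 ⟨_, hact⟩; omega
    have h4 := h.err
    rw [h3, pow_succ] at h4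
    refine le_trans ?_ h4
    have h5 : (0 : ℝ) ≤ 2 ^ #(act.erase i₀) := by positivity
    nlinarith

theorem Graph.card_edges (G : Graph N E B d src bkt) {A : Finset ℕ} (hA : A ⊆ range N) :
    #{e ∈ range E | src e ∈ A} = d * #A := by
  classical
  rw [card_eq_sum_card_fiberwise (f := src) (t := A) fun e he => by
    simpa using (mem_filter.1 he).2]
  rw [sum_congr rfl (g := fun _ => d), sum_const, smul_eq_mul, mul_comm]
  intro i hi
  rw [← G.deg i (mem_range.1 (hA hi)), filter_filter]
  congr 1
  ext e; simp only [mem_filter]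
  exact ⟨fun h => ⟨h.1, h.2.2⟩, fun h => ⟨h.1, h.2 ▸ hi, h.2⟩⟩

/-- Expansion implies that some right vertex has a unique neighbour in a small set. -/
theorem Graph.exists_unique_edge (G : Graph N E B d src bkt) (hd : 1 ≤ d) {K : ℕ}
    (hG : Expands N E d src bkt K) {A : Finset ℕ} (hA : A ⊆ range N) (hK : #A ≤ K)
    (hne : A.Nonempty) :
    ∃ e < E, src e ∈ A ∧ ∀ e' < E, bkt e' = bkt e → src e' ≠ src e → src e' ∉ A := by
  classical
  by_contra hcon
  push Not at hcon
  have h1 := hG A hA hK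
  -- Without a unique neighbour every bucket met by `A` receives two edges of `A`. Then `A` has at
  -- most `d·#A/2` neighbours, against the `19/20` of expansion.
  set s : Finset ℕ := {e ∈ range E | src e ∈ A} with hs
  have h2 : #(s.image bkt) * 2 ≤ #s := by
    rw [card_eq_sum_card_image bkt s, ← smul_eq_mul]
    refine card_nsmul_le_sum _ _ _ fun b hb => ?_
    obtain ⟨e, he, rfl⟩ := mem_image.1 hb
    obtain ⟨he1, he2⟩ := mem_filter.1 he
    obtain ⟨e', h3, h4, h5, h6⟩ := hcon e (mem_range.1 he1) he2
    refine one_lt_card.2 ⟨e, by simp [he], e', ?_, fun h => h5 (by rw [h])⟩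
    exact mem_filter.2 ⟨mem_filter.2 ⟨mem_range.2 h3, h6⟩, h4⟩
  rw [G.card_edges hA] at h2
  have h3 : ((#(s.image bkt) * 2 : ℕ) : ℝ) ≤ ((d * #A : ℕ) : ℝ) := by exact_mod_cast h2
  push_cast at h3
  have h4 : (0 : ℝ) < d * #A := by
    have := card_pos.2 hne
    have hd' : (1 : ℝ) ≤ d := by exact_mod_cast hd
    have : (1 : ℝ) ≤ #A := by exact_mod_cast this
    positivity
  nlinarith

theorem Peeling.final {x w : ℕ → ℝ} {A : Finset ℕ} (h : Peeling N x A ∅ w) :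
    nrm N (x - w) ≤ 2 ^ #A * tail N x A := by
  have := h.err
  simpa [nrm] using this

/-! ### Rounds -/

/-- The coordinates of `x` in `A` are the largest ones in `S`, and the error of `z` is comparable to
the remaining ones or to the tail. -/
structure Located (N : ℕ) (x : ℕ → ℝ) (S : Finset ℕ) (z : ℕ → ℝ) (A : Finset ℕ) : Prop where
  sub : A ⊆ S
  le : ∀ l ∈ A, ∀ l' ∈ S \ A, |x l'| ≤ |x l|
  err : ∀ b, tail N x S ≤ b → (∀ l ∈ S \ A, |x l| ≤ b) →
    nrm N (restr S x - z) ≤ 2 ^ (2 * N + 2) * b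

/-- The bound `b` dominates every coordinate of `x` in `S`, so the zero array has error at most `N
b`. -/
theorem Located.init (N : ℕ) (x : ℕ → ℝ) (S : Finset ℕ) : Located N x S 0 ∅ where
  sub := empty_subset _
  le _ h := absurd h (notMem_empty _)
  err b hb h := by
    have hb0 := (tail_nonneg N x S).trans hb
    rw [sub_zero, nrm]
    calc ∑ i ∈ range N, |restr S x i| ≤ ∑ i ∈ range N, b := by
          refine sum_le_sum fun i _ => ?_
          by_cases hi : i ∈ S
          · simpa [restr, hi] using h i (by simp [hi])
          · simpa [restr, hi] using hb0
      _ = N * b := by simp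
      _ ≤ 2 ^ (2 * N + 2) * b := by
          gcongr
          have : N ≤ 2 ^ (2 * N + 2) := (Nat.lt_two_pow_self (n := N)).le.trans
            (Nat.pow_le_pow_right (by norm_num) (by omega))
          exact_mod_cast this

/-- One round (iterating, then comparing with the peeled candidates) locates one more
coordinate. -/
theorem Located.round (G : Graph N E B d src bkt) (hd : 1 ≤ d) {k : ℕ} (hN : 2 ≤ N)
    (hG : Expands N E d src bkt (130 * k)) {x y z₀ z₁ z₂ : ℕ → ℝ} {S A : Finset ℕ}
    (hS : S ⊆ range N) (hSk : #S ≤ k) (hy : ∀ b < B, y b = bucketSum E src bkt x b)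
    (h : Located N x S z₀ A)
    (h₁ : nrm N (restr S x - z₁) ≤ nrm N (restr S x - z₀) / 2 ^ (16 * N) + 24 * tail N x S)
    (hz₂ : #(supp N z₂) ≤ k) (h₂ : rho E B src bkt y z₂ ≤ rho E B src bkt y z₁)
    (hcand : ∀ q < N, 0 < |z₁ q| → ∃ w,
      nrm N (x - w) ≤ 2 ^ #{l ∈ range N | |z₁ q| ≤ |z₁ l|} *
        tail N x {l ∈ range N | |z₁ q| ≤ |z₁ l|} ∧
      rho E B src bkt y z₂ ≤ rho E B src bkt y w) :
    ∃ A', min (#A + 1) #S ≤ #A' ∧ Located N x S z₂ A' := by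
  classical
  have hd' : (1 : ℝ) ≤ d := by exact_mod_cast hd
  set η := tail N x S with hη
  have hη0 : 0 ≤ η := tail_nonneg N x S
  set u := restr S x with hu
  have hsu := (card_supp_restr (N := N) S x).trans hSk
  set Q : ℝ := 2 ^ (2 * N + 2) with hQ
  have hQ64 : 64 ≤ Q := by
    calc (64 : ℝ) = 2 ^ 6 := by norm_num
      _ ≤ Q := pow_le_pow_right₀ (by norm_num) (by omega)
  -- The `16N` halvings more than undo the factor `2^(2N+2)` allowed by the invariant.
  have hQδ : Q / 2 ^ (16 * N) ≤ 1 / 1000 := by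
    rw [div_le_div_iff₀ (by positivity) (by norm_num)]
    calc Q * 1000 ≤ 2 ^ (2 * N + 2) * 2 ^ 10 := by rw [hQ]; gcongr; norm_num
      _ = 2 ^ (2 * N + 12) := by rw [← pow_add]
      _ ≤ 2 ^ (16 * N) := pow_le_pow_right₀ (by norm_num) (by omega)
      _ = _ := by ring
  have hdist := G.dist_le hG hy (u := u) (z := z₂) (by rw [← hu] at hsu; omega)
  rw [nrm_sub_restr hS] at hdist
  -- Any upper bound on the residual norm of `z₂` becomes a bound on its distance from `u`. It will
  -- be applied with the residual of `z₁` and with that of a peeled candidate.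
  have final : ∀ t : ℝ, rho E B src bkt y z₂ ≤ d * t →
      nrm N (u - z₂) ≤ (10 / 9) * (t + η) := by
    intro t ht
    have h7 : (d : ℝ) * ((9 / 10) * nrm N (u - z₂)) ≤ d * (t + η) := by linarith
    have h8 := le_of_mul_le_mul_left h7 (by linarith)
    linarith
  have hρ₁ : rho E B src bkt y z₂ ≤ d * (η + nrm N (u - z₁)) := by
    refine h₂.trans ((G.rho_le hy z₁).trans ?_)
    have := nrm_sub_le N x u z₁
    rw [nrm_sub_restr hS] at this
    gcongr
  have hsmall := final _ hρ₁
  have he1 : ∀ b, η ≤ b → (∀ l ∈ S \ A, |x l| ≤ b) → nrm N (u - z₁) ≤ b / 1000 + 24 * η := by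
    intro b hb hb'
    have h3 := h.err b hb hb'
    have h4 : nrm N (u - z₀) / 2 ^ (16 * N) ≤ Q / 2 ^ (16 * N) * b := by
      rw [div_mul_eq_mul_div]; gcongr
    have h5 : Q / 2 ^ (16 * N) * b ≤ 1 / 1000 * b :=
      mul_le_mul_of_nonneg_right hQδ (hη0.trans hb)
    linarith
  rcases (S \ A).eq_empty_or_nonempty with hSA | hSA
  · refine ⟨A, ?_, h.sub, h.le, fun b hb hb' => ?_⟩
    · exact (min_le_right _ _).trans (card_le_card (sdiff_eq_empty_iff_subset.1 hSA))
    · have := he1 b hb hb'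
      have : 64 * b ≤ Q * b := mul_le_mul_of_nonneg_right hQ64 (hη0.trans hb)
      linarith
  -- The coordinate to be located next is a largest one of `x` on `S \ A`.
  obtain ⟨l₀, hl₀, hmax⟩ := (S \ A).exists_max_image (fun l => |x l|) hSA
  set a := |x l₀| with ha
  have ha0 : 0 ≤ a := abs_nonneg _
  have hl₀' := mem_sdiff.1 hl₀
  refine ⟨insert l₀ A, ?_, insert_subset hl₀'.1 h.sub, ?_, ?_⟩
  · rw [card_insert_of_notMem hl₀'.2]; exact min_le_left _ _
  · intro l hl l' hl'
    have hl'1 : l' ∈ S \ A := by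
      simp only [mem_sdiff, mem_insert, not_or] at hl' ⊢; exact ⟨hl'.1, hl'.2.2⟩
    rcases mem_insert.1 hl with rfl | hl
    · exact hmax l' hl'1
    · exact h.le l hl l' hl'1
  intro b hb hb'
  have hb0 : 0 ≤ b := hη0.trans hb
  have hQb : 64 * b ≤ Q * b := mul_le_mul_of_nonneg_right hQ64 hb0
  -- No gap: if `a` is at most `400 b`, the old bound holds with `400 b`, and the iteration alone
  -- gives an error of at most `(10/9)(0.4 + 24 + 2) b < 64 b`. Otherwise `a` stands out above all
  -- coordinates that follow, and the candidates are needed.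
  rcases le_or_gt a (400 * b) with hab | hab
  · have := he1 (400 * b) (by linarith) fun l hl => (hmax l hl).trans hab
    linarith
  have he2 := he1 a (by linarith) hmax
  -- The error `a/1000 + 24η` is below `a/10`, since the tail `η` is at most `b < a/400`.
  have hpt : ∀ l < N, |u l - z₁ l| ≤ a / 10 := fun l hl => by
    have : |(u - z₁) l| ≤ nrm N (u - z₁) :=
      single_le_sum (f := fun i => |(u - z₁) i|) (fun _ _ => abs_nonneg _) (mem_range.2 hl)
    simp only [Pi.sub_apply] at this
    linarith
  set A' := insert l₀ A with hA'
  have hA'N : A' ⊆ range N := (insert_subset hl₀'.1 h.sub).trans hS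
  have hbig : ∀ l ∈ A', (9 / 10) * a ≤ |z₁ l| := fun l hl => by
    have hxl : a ≤ |x l| := by
      rcases mem_insert.1 hl with rfl | hl
      · exact le_rfl
      · exact h.le l hl l₀ hl₀
    have hlS : l ∈ S := insert_subset hl₀'.1 h.sub hl
    have h3 := hpt l (mem_range.1 (hS hlS))
    rw [show u l = x l by simp [hu, restr, hlS]] at h3
    have := abs_sub_abs_le_abs_sub (x l) (z₁ l)
    linarith
  have hlow : ∀ l < N, l ∉ A' → |z₁ l| ≤ a / 5 := fun l hl hlA => by
    have hul : |u l| ≤ b := by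
      by_cases hlS : l ∈ S
      · rw [show u l = x l by simp [hu, restr, hlS]]
        exact hb' l (mem_sdiff.2 ⟨hlS, hlA⟩)
      · simp [hu, restr, hlS, hb0]
    have h3 := hpt l hl
    have := abs_sub_abs_le_abs_sub (z₁ l) (u l)
    rw [abs_sub_comm] at this
    linarith
  -- On `A'` the entries of `z₁` are at least `9a/10`, elsewhere at most `a/5`. So the superlevel
  -- set at the smallest entry on `A'` is `A'` itself, and it is among the sets that have been
  -- peeled.
  obtain ⟨q, hq, hqmin⟩ := A'.exists_min_image (fun l => |z₁ l|) ⟨l₀, mem_insert_self _ _⟩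
  have hq9 := hbig q hq
  have ha' : 0 < a := by linarith
  have hset : ({l ∈ range N | |z₁ q| ≤ |z₁ l|} : Finset ℕ) = A' := by
    ext l
    rw [mem_filter]
    constructor
    · rintro ⟨hl, hle⟩
      by_contra hlA
      have := hlow l (mem_range.1 hl) hlA
      linarith
    · intro hl; exact ⟨hA'N hl, hqmin l hl⟩
  obtain ⟨w, hw, hρw⟩ := hcand q (mem_range.1 (hA'N hq)) (by linarith)
  rw [hset] at hw
  have hcardA : #A' ≤ N := (card_le_card hA'N).trans (card_range N).le
  have htail : tail N x A' ≤ (N + 1) * b := by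
    have h1 : range N \ A' ⊆ (range N \ S) ∪ (S \ A') := by
      intro l hl
      simp only [mem_sdiff, mem_union] at hl ⊢
      by_cases hlS : l ∈ S
      · exact Or.inr ⟨hlS, hl.2⟩
      · exact Or.inl ⟨hl.1, hlS⟩
    calc tail N x A' ≤ ∑ l ∈ (range N \ S) ∪ (S \ A'), |x l| :=
          sum_le_sum_of_subset_of_nonneg h1 fun _ _ _ => abs_nonneg _
      _ = η + ∑ l ∈ S \ A', |x l| := by
          rw [sum_union, hη, tail]
          exact disjoint_left.2 fun l hl hl' => (mem_sdiff.1 hl).2 (mem_sdiff.1 hl').1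
      _ ≤ b + #(S \ A') * b := by
          gcongr
          rw [← nsmul_eq_mul]; exact sum_le_card_nsmul _ _ _ hb'
      _ ≤ b + N * b := by
          gcongr
          exact_mod_cast (card_le_card (sdiff_subset.trans hS)).trans (card_range N).le
      _ = _ := by ring
  have hwN : nrm N (x - w) ≤ 2 ^ N * ((N + 1) * b) := by
    refine hw.trans ?_
    gcongr
    · exact tail_nonneg _ _ _
    · norm_num
  have h3 := final _ (hρw.trans ((G.rho_le hy w).trans
    (mul_le_mul_of_nonneg_left hwN (by linarith))))
  refine h3.trans ?_
  have h4 : (1 : ℝ) ≤ 2 ^ N := one_le_pow₀ (by norm_num)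
  have h5 : ((N : ℝ) + 2) ≤ 2 * 2 ^ N := by
    have := Nat.lt_two_pow_self (n := N)
    have h6 : ((N + 1 : ℕ) : ℝ) ≤ ((2 ^ N : ℕ) : ℝ) := by exact_mod_cast this
    push_cast at h6; linarith
  have h6 : Q = 2 ^ N * (2 * 2 ^ N) * 2 := by rw [hQ]; ring
  calc 10 / 9 * (2 ^ N * ((N + 1) * b) + η) ≤ 10 / 9 * (2 ^ N * ((N + 1) * b) + 2 ^ N * b) := by
        gcongr; nlinarith
    _ = 10 / 9 * (2 ^ N * (N + 2) * b) := by ring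
    _ ≤ 10 / 9 * (2 ^ N * (2 * 2 ^ N) * b) := by gcongr
    _ ≤ Q * b := by
        rw [h6]
        nlinarith [mul_nonneg (by positivity : (0 : ℝ) ≤ 2 ^ N * (2 * 2 ^ N)) hb0]

/-- Once everything in `S` is located, the invariant holds with `b` equal to the tail. The halvings
bring `2^(2N+2)` times the tail below the tail, and `1 + 24 + 1 = 26`, the last `1` being the
distance of `x` from its restriction to `S`. -/
theorem Located.final {x z₀ z₁ : ℕ → ℝ} {S A : Finset ℕ} (hN : 1 ≤ N)
    (hS : S ⊆ range N) (h : Located N x S z₀ A) (hA : #S ≤ #A)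
    (h₁ : nrm N (restr S x - z₁) ≤ nrm N (restr S x - z₀) / 2 ^ (16 * N) + 24 * tail N x S) :
    nrm N (z₁ - x) ≤ 26 * tail N x S := by
  have hAS : A = S := eq_of_subset_of_card_le h.sub hA
  have h2 := h.err _ le_rfl (by simp [hAS])
  have hη0 : 0 ≤ tail N x S := tail_nonneg N x S
  have h3 : nrm N (restr S x - z₀) / 2 ^ (16 * N) ≤ tail N x S := by
    rw [div_le_iff₀ (by positivity), mul_comm]
    refine h2.trans ?_
    gcongr
    · norm_num
    · omega
  have h4 := nrm_sub_le N x (restr S x) z₁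
  rw [nrm_sub_restr hS] at h4
  rw [nrm_sub_comm]
  linarith

end

/-! ### Lossless condensers are expanders -/

theorem sum_toReal_pmf {Ω : Type*} [Fintype Ω] (μ : PMF Ω) : ∑ s, (μ s).toReal = 1 := by
  rw [← ENNReal.toReal_sum fun s _ => μ.apply_ne_top s, ← tsum_fintype (L := .unconditional _),
    μ.tsum_coe, ENNReal.toReal_one]

/-- The differences sum to zero, so the sum over `T` equals minus the sum over the complement, and
both are bounded by half of the total variation. -/
theorem sum_sub_le_statDist {Ω : Type*} [Fintype Ω] (μ ν : PMF Ω) (T : Finset Ω) :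
    ∑ s ∈ T, ((μ s).toReal - (ν s).toReal) ≤ statDist μ ν := by
  classical
  have h1 : ∑ s, ((μ s).toReal - (ν s).toReal) = 0 := by
    rw [sum_sub_distrib, sum_toReal_pmf, sum_toReal_pmf, sub_self]
  rw [← sum_add_sum_compl T] at h1
  rw [statDist, ← sum_add_sum_compl T]
  have h2 := sum_le_sum fun s (_ : s ∈ T) => le_abs_self ((μ s).toReal - (ν s).toReal)
  have h3 := sum_le_sum fun s (_ : s ∈ Tᶜ) => neg_abs_le ((μ s).toReal - (ν s).toReal)
  rw [sum_neg_distrib] at h3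
  linarith

theorem toReal_le_of_minEntropy {Ω : Type*} [Fintype Ω] (μ : PMF Ω) {M : ℝ} (hM : 0 < M)
    (h : Real.logb 2 M ≤ minEntropy μ) (s : Ω) : (μ s).toReal ≤ M⁻¹ := by
  by_cases hs : s ∈ μ.support
  · have h1 : minEntropy μ ≤ -Real.logb 2 (μ s).toReal :=
      csInf_le (Set.Finite.bddBelow (Set.toFinite _)) ⟨s, hs, rfl⟩
    have hpos : 0 < (μ s).toReal :=
      ENNReal.toReal_pos ((μ.mem_support_iff s).1 hs) (μ.apply_ne_top s)
    rw [← Real.logb_le_logb (b := 2) (by norm_num) hpos (by positivity), Real.logb_inv]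
    linarith
  · rw [PMF.mem_support_iff, not_not] at hs
    rw [hs, ENNReal.toReal_zero]; positivity

/-- The outputs of a condenser on a set of inputs. -/
def seededImage {n D r : ℕ} (h : F2 n → Fin D → F2 r) (A : Finset (F2 n)) :
    Finset (Fin D × F2 r) :=
  (univ ×ˢ A).image fun p => (p.1, h p.2 p.1)

/-- The output law lives on the image, while the nearby law of high min-entropy gives each point at
most `1/(D·#S)`. If the image were much smaller than `D·#S`, the two laws would differ by more than
`ε` on it. -/
theorem IsLosslessCondenser.card_image {n D r k : ℕ} [NeZero D] {ε : ℝ}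
    {h : F2 n → Fin D → F2 r} (hh : IsLosslessCondenser (Real.logb 2 k) ε h) (hk : 0 < k)
    (S : Finset (F2 n)) (hSk : #S ≤ k) :
    (1 - ε) * (D * #S) ≤ #(seededImage h S) := by
  classical
  rcases S.eq_empty_or_nonempty with rfl | hS
  · simp
  obtain ⟨μ, hμ, hdist⟩ := hh S hS (by
    rw [Real.rpow_logb (by norm_num) (by norm_num) (by exact_mod_cast hk)]; exact_mod_cast hSk)
  have hD : (0 : ℝ) < D := by exact_mod_cast Nat.pos_of_ne_zero (NeZero.ne D)
  have hS0 : (0 : ℝ) < #S := by exact_mod_cast card_pos.2 hS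
  have hM : (0 : ℝ) < D * #S := by positivity
  set T := seededImage h S with hT
  have h1 : ∑ s ∈ T, (seededOutput h S hS s).toReal = 1 := by
    rw [← sum_toReal_pmf (seededOutput h S hS)]
    refine sum_subset (subset_univ _) fun s _ hs => ?_
    by_contra hne
    have hsupp : s ∈ (seededOutput h S hS).support := by
      rw [PMF.mem_support_iff]; intro h0; exact hne (by rw [h0]; rfl)
    rw [seededOutput, PMF.mem_support_bind_iff] at hsupp
    obtain ⟨x, hx, hsx⟩ := hsupp
    rw [PMF.mem_support_map_iff] at hsx
    obtain ⟨z, -, rfl⟩ := hsx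
    rw [PMF.mem_support_uniformOfFinset_iff] at hx
    exact hs (mem_image.2 ⟨(z, x), by simp [hx], rfl⟩)
  have h2 := sum_sub_le_statDist (seededOutput h S hS) μ T
  rw [sum_sub_distrib, h1] at h2
  have h3 : ∑ s ∈ T, (μ s).toReal ≤ #T * ((D : ℝ) * #S)⁻¹ := by
    rw [← nsmul_eq_mul]
    exact sum_le_card_nsmul _ _ _ fun s _ => toReal_le_of_minEntropy μ hM hμ s
  have h4 : 1 - ε ≤ #T * ((D : ℝ) * #S)⁻¹ := by linarith
  rwa [← div_eq_mul_inv, le_div_iff₀ hM] at h4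

/-- The members of `s` that collide with another member under `f`. -/
noncomputable def colliding {α β : Type*} (f : α → β) (s : Finset α) : Finset α := by
  classical exact {a ∈ s | ∃ a' ∈ s, a' ≠ a ∧ f a' = f a}

theorem mem_colliding {α β : Type*} {f : α → β} {s : Finset α} {a : α} :
    a ∈ colliding f s ↔ a ∈ s ∧ ∃ a' ∈ s, a' ≠ a ∧ f a' = f a := by
  unfold colliding; exact @mem_filter _ _ (_) _ _

theorem card_le_image_add_colliding {α β : Type*} [DecidableEq β] (f : α → β) (s : Finset α) :
    #s ≤ #(s.image f) + #(colliding f s) := by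
  classical
  have h1 : #(s \ colliding f s) ≤ #(s.image f) := by
    refine card_le_card_of_injOn f (fun a ha => ?_) fun a ha b hb hab => ?_
    · exact mem_coe.2 (mem_image_of_mem f (mem_sdiff.1 ha).1)
    · have ha' := mem_sdiff.1 ha
      have hb' := mem_sdiff.1 hb
      by_contra hne
      exact ha'.2 (by
        rw [mem_colliding]
        exact ⟨ha'.1, b, hb'.1, fun h => hne h.symm, hab.symm⟩)
  have h2 := card_sdiff_add_card_inter s (colliding f s)
  have h3 := card_le_card (inter_subset_right (s₁ := s) (s₂ := colliding f s))
  omega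

/-- A fibre with `m ≥ 2` elements contributes `m ≤ 2(m - 1)` colliding elements, a singleton
contributes none. -/
theorem card_colliding_le {α β : Type*} [DecidableEq β] (f : α → β) (s : Finset α) :
    #(colliding f s) + 2 * #(s.image f) ≤ 2 * #s := by
  classical
  have h1 : #(colliding f s) = ∑ b ∈ s.image f, #{a ∈ colliding f s | f a = b} :=
    card_eq_sum_card_fiberwise fun a ha => by
      rw [mem_coe, mem_colliding] at ha
      exact mem_coe.2 (mem_image_of_mem f ha.1)
  have h2 : #s = ∑ b ∈ s.image f, #{a ∈ s | f a = b} := card_eq_sum_card_image f s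
  rw [h1, h2, card_eq_sum_ones (s.image f), mul_sum, mul_sum, ← sum_add_distrib]
  refine sum_le_sum fun b hb => ?_
  obtain ⟨a, ha, rfl⟩ := mem_image.1 hb
  have hsub : ({a' ∈ colliding f s | f a' = f a} : Finset α) ⊆ {a' ∈ s | f a' = f a} := by
    intro a' ha'
    rw [mem_filter, mem_colliding] at ha'
    exact mem_filter.2 ⟨ha'.1.1, ha'.2⟩
  have hle := card_le_card hsub
  have hpos : 1 ≤ #{a' ∈ s | f a' = f a} := card_pos.2 ⟨a, by simp [ha]⟩
  rcases ({a' ∈ colliding f s | f a' = f a} : Finset α).eq_empty_or_nonempty with h | ⟨c, hc⟩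
  · rw [h, card_empty]; omega
  · rw [mem_filter, mem_colliding] at hc
    obtain ⟨⟨hc1, c', hc2, hne, hcc⟩, hca⟩ := hc
    have : 1 < #{a' ∈ s | f a' = f a} :=
      one_lt_card.2 ⟨c, by simp [hc1, hca], c', by simp [hc2, hcc, hca], fun h => hne h.symm⟩
    omega

/-- A finite set can be cut into `m` pieces of size at most `p` if it has at most `m p` elements. -/
theorem exists_pieces {α : Type*} (S : Finset α) {m p : ℕ} (hp : 0 < p) (h : #S ≤ m * p) :
    ∃ c : α → ℕ, (∀ x ∈ S, c x < m) ∧ ∀ i, #{x ∈ S | c x = i} ≤ p := by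
  classical
  let idx : α → ℕ := fun x => if hx : x ∈ S then (S.equivFin ⟨x, hx⟩ : ℕ) else 0
  have hidx : ∀ x ∈ S, idx x < #S := fun x hx => by simp [idx, hx]
  have hinj : Set.InjOn idx S := by
    intro x hx y hy hxy
    simp only [mem_coe] at hx hy
    simp only [idx, hx, hy, dif_pos, Fin.val_inj, EmbeddingLike.apply_eq_iff_eq] at hxy
    exact congrArg Subtype.val hxy
  refine ⟨fun x => idx x / p, fun x hx => ?_, fun i => ?_⟩
  · exact Nat.div_lt_of_lt_mul (by have := hidx x hx; rw [mul_comm]; omega)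
  · calc #{x ∈ S | idx x / p = i} ≤ #(Ico (i * p) (i * p + p)) := by
          refine card_le_card_of_injOn idx (fun x hx => ?_)
            (hinj.mono (by exact_mod_cast filter_subset _ _))
          have := (mem_filter.1 hx).2
          rw [Nat.div_eq_iff hp] at this
          simp only [coe_Ico, Set.mem_Ico]
          omega
      _ = p := by simp

/-- A lossless condenser with small error for sets of size `k` also expands sets that are larger by
a constant factor. -/
theorem IsLosslessCondenser.expand {n D r k : ℕ} [NeZero D] {h : F2 n → Fin D → F2 r}
    (hh : IsLosslessCondenser (Real.logb 2 k) (1 / 10000000) h) (hk : 2 ≤ k) (A : Finset (F2 n))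
    (hA : #A ≤ 130 * k) : (19 / 20 : ℝ) * (D * #A) ≤ #(seededImage h A) := by
  classical
  have hDA : (0 : ℝ) ≤ D * #A := by positivity
  rcases le_or_gt (#A) k with hAk | hAk
  · have := hh.card_image (by omega) A hAk
    nlinarith
  let f : Fin D × F2 n → Fin D × F2 r := fun p => (p.1, h p.2 p.1)
  let s : Finset (F2 n) → Finset (Fin D × F2 n) := fun A => univ ×ˢ A
  have hs : ∀ A, #(s A) = D * #A := fun A => by simp [s]
  have hsmall : ∀ A, #A ≤ k → (#(colliding f (s A)) : ℝ) ≤ 2 / 10000000 * (D * k) := by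
    intro A hA
    have h1 := hh.card_image (by omega) A hA
    have h2 := card_colliding_le f (s A)
    rw [hs] at h2
    have h3 : ((#(colliding f (s A)) + 2 * #(seededImage h A) : ℕ) : ℝ) ≤ ((2 * (D * #A) : ℕ) : ℝ) := by
      exact_mod_cast h2
    push_cast at h3
    have h4 : (D : ℝ) * #A ≤ D * k := by gcongr
    nlinarith
  -- Pieces of size `k/2`, rounded down, have unions of size at most `k`. The worst rounding is at
  -- `k = 3`, where `390` elements are to be cut into singletons, so `400` pieces suffice.
  obtain ⟨m, hm⟩ : ∃ m : ℕ, m = 400 := ⟨_, rfl⟩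
  obtain ⟨c, hc1, hc2⟩ := exists_pieces A (m := m) (p := k / 2) (by omega)
    (by rw [hm]; omega)
  let piece : ℕ → Finset (F2 n) := fun i => {x ∈ A | c x = i}
  -- A collision involves only two elements of `A`, so it already occurs in the union of the two
  -- pieces that contain them.
  have hcov : colliding f (s A) ⊆
      (range m ×ˢ range m).biUnion fun q => colliding f (s (piece q.1 ∪ piece q.2)) := by
    rintro ⟨t, x⟩ hx
    rw [mem_colliding] at hx
    obtain ⟨hx1, ⟨t', x'⟩, hx2, hne, heq⟩ := hx
    have hxA : x ∈ A := by simpa [s] using hx1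
    have hxA' : x' ∈ A := by simpa [s] using hx2
    refine mem_biUnion.2 ⟨(c x, c x'),
      mem_product.2 ⟨mem_range.2 (hc1 x hxA), mem_range.2 (hc1 x' hxA')⟩, ?_⟩
    rw [mem_colliding]
    exact ⟨by simp [s, piece, hxA], (t', x'), by simp [s, piece, hxA'], hne, heq⟩
  -- There are `400² = 160000` pairs of pieces, and `160000 · 2/10⁷ = 0.032 < 1/20`.
  have h1 : (#(colliding f (s A)) : ℝ) ≤ 160000 * (2 / 10000000 * (D * k)) := by
    calc (#(colliding f (s A)) : ℝ) ≤
        ((∑ q ∈ range m ×ˢ range m, #(colliding f (s (piece q.1 ∪ piece q.2))) : ℕ) : ℝ) := by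
          exact_mod_cast (card_le_card hcov).trans card_biUnion_le
      _ = ∑ q ∈ range m ×ˢ range m, (#(colliding f (s (piece q.1 ∪ piece q.2))) : ℝ) := by
          push_cast; rfl
      _ ≤ #(range m ×ˢ range m) • (2 / 10000000 * ((D : ℝ) * k)) := by
          refine sum_le_card_nsmul _ _ _ fun q _ => hsmall _ ?_
          have := card_union_le (piece q.1) (piece q.2)
          have h2 := hc2 q.1
          have h3 := hc2 q.2
          simp only [piece] at this ⊢
          omega
      _ = _ := by rw [card_product, card_range, nsmul_eq_mul, hm]; norm_num
  have h2 := card_le_image_add_colliding f (s A)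
  rw [hs] at h2
  have h3 : ((D * #A : ℕ) : ℝ) ≤ ((#(seededImage h A) + #(colliding f (s A)) : ℕ) : ℝ) := by
    exact_mod_cast h2
  push_cast at h3
  have h4 : (D : ℝ) * k ≤ D * #A := by gcongr
  nlinarith

end SparseHadamard

namespace SparseHadamard

/-! ### Programs built from bounded loops, and their running time -/

/-- A bound for the running time of a program whose loops are run through at most `V` times. -/
def Prog.cost (V : ℕ) : Prog → ℕ
  | .skip => 1
  | .instr _ => 1
  | .seq p q => p.cost V + q.cost V
  | .ite _ p q => p.cost V + q.cost V + 1
  | .while _ p => V * (p.cost V + 1) + 1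

/-- The exponent comes from the text of the program alone, since each enclosing loop multiplies the
cost by about `V`. So a bound on all loop counts that is polynomial in `N` makes the running time
polynomial in `N`. -/
theorem Prog.cost_poly (p : Prog) : ∃ C a : ℕ, ∀ V, 1 ≤ V → p.cost V ≤ C * V ^ a := by
  have le1 : ∀ {V a : ℕ}, 1 ≤ V → 1 ≤ V ^ a := fun h => Nat.one_le_pow _ _ h
  induction p with
  | skip => exact ⟨1, 0, fun V _ => by simp [cost]⟩
  | instr i => exact ⟨1, 0, fun V _ => by simp [cost]⟩
  | seq p q ihp ihq =>
    obtain ⟨C, a, hp⟩ := ihp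
    obtain ⟨C', a', hq⟩ := ihq
    refine ⟨C + C', a + a', fun V hV => ?_⟩
    have h1 : V ^ a ≤ V ^ (a + a') := Nat.pow_le_pow_right hV (by omega)
    have h2 : V ^ a' ≤ V ^ (a + a') := Nat.pow_le_pow_right hV (by omega)
    rw [cost, add_mul]
    exact add_le_add ((hp V hV).trans (Nat.mul_le_mul_left _ h1))
      ((hq V hV).trans (Nat.mul_le_mul_left _ h2))
  | ite b p q ihp ihq =>
    obtain ⟨C, a, hp⟩ := ihp
    obtain ⟨C', a', hq⟩ := ihq
    refine ⟨C + C' + 1, a + a', fun V hV => ?_⟩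
    have h1 : V ^ a ≤ V ^ (a + a') := Nat.pow_le_pow_right hV (by omega)
    have h2 : V ^ a' ≤ V ^ (a + a') := Nat.pow_le_pow_right hV (by omega)
    rw [cost, add_mul, add_mul, one_mul]
    exact add_le_add (add_le_add ((hp V hV).trans (Nat.mul_le_mul_left _ h1))
      ((hq V hV).trans (Nat.mul_le_mul_left _ h2))) (le1 hV)
  | _ b p ih =>
    obtain ⟨C, a, hp⟩ := ih
    refine ⟨C + 2, a + 1, fun V hV => ?_⟩
    have h1 : V ≤ V ^ (a + 1) := by
      rw [pow_succ]; exact Nat.le_mul_of_pos_left _ (le1 hV)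
    calc V * (p.cost V + 1) + 1 ≤ V * (C * V ^ a + 1) + 1 := by
          gcongr; exact hp V hV
      _ = C * V ^ (a + 1) + V + 1 := by ring
      _ ≤ C * V ^ (a + 1) + V ^ (a + 1) + V ^ (a + 1) := by
          gcongr; exact le1 hV
      _ = (C + 2) * V ^ (a + 1) := by ring

/-- Does the instruction write the integer register `r`? -/
def Instr.wN : Instr → ℕ → Bool
  | .nconst d _, r | .nadd d _ _, r | .nsub d _ _, r | .nhalf d _, r | .nload d _ _, r => d == r
  | _, _ => false

/-- Does the instruction write the real register `r`? -/
def Instr.wR : Instr → ℕ → Bool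
  | .rconst d _, r | .radd d _ _, r | .rsub d _ _, r | .rmul d _ _, r | .rdiv d _ _, r
  | .rsqrt d _, r | .rload d _ _, r | .query d _, r => d == r
  | _, _ => false

/-- Does the instruction write the integer array `a`? -/
def Instr.wNA : Instr → ℕ → Bool
  | .nstore arr _ _, a => arr == a
  | _, _ => false

/-- Does the instruction write the real array `a`? -/
def Instr.wRA : Instr → ℕ → Bool
  | .rstore arr _ _, a => arr == a
  | _, _ => false

/-- Is the instruction a query? -/
def Instr.asks : Instr → Bool
  | .query _ _ => true
  | _ => false

/-- Does some instruction of the program satisfy `f`? -/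
def Prog.any (f : Instr → Bool) : Prog → Bool
  | .skip => false
  | .instr i => f i
  | .seq p q | .ite _ p q => p.any f || q.any f
  | .while _ p => p.any f

/-- The parts of the memory that the program does not write are the same in both states. -/
structure Frame (p : Prog) (s s' : State) : Prop where
  n : ∀ r, p.any (·.wN r) = false → s'.nreg r = s.nreg r
  r : ∀ r, p.any (·.wR r) = false → s'.rreg r = s.rreg r
  na : ∀ a, p.any (·.wNA a) = false → s'.narr a = s.narr a
  ra : ∀ a, p.any (·.wRA a) = false → s'.rarr a = s.rarr a
  q : p.any (·.asks) = false → s'.queries = s.queries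

namespace State

variable (s : State) (d v r i : ℕ) (x : ℝ)

@[simp] theorem setN_nreg : (s.setN d v).nreg r = if r = d then v else s.nreg r := by
  simp [setN, Function.update_apply]
@[simp] theorem setN_rreg : (s.setN d v).rreg = s.rreg := rfl
@[simp] theorem setN_narr : (s.setN d v).narr = s.narr := rfl
@[simp] theorem setN_rarr : (s.setN d v).rarr = s.rarr := rfl
@[simp] theorem setN_queries : (s.setN d v).queries = s.queries := rfl
@[simp] theorem setR_rreg : (s.setR d x).rreg r = if r = d then x else s.rreg r := by
  simp [setR, Function.update_apply]
@[simp] theorem setR_nreg : (s.setR d x).nreg = s.nreg := rfl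
@[simp] theorem setR_narr : (s.setR d x).narr = s.narr := rfl
@[simp] theorem setR_rarr : (s.setR d x).rarr = s.rarr := rfl
@[simp] theorem setR_queries : (s.setR d x).queries = s.queries := rfl
@[simp] theorem storeN_narr : (s.storeN d i v).narr r =
    if r = d then Function.update (s.narr d) i v else s.narr r := by
  simp [storeN, Function.update_apply]
@[simp] theorem storeN_nreg : (s.storeN d i v).nreg = s.nreg := rfl
@[simp] theorem storeN_rreg : (s.storeN d i v).rreg = s.rreg := rfl
@[simp] theorem storeN_rarr : (s.storeN d i v).rarr = s.rarr := rfl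
@[simp] theorem storeN_queries : (s.storeN d i v).queries = s.queries := rfl
@[simp] theorem storeR_rarr : (s.storeR d i x).rarr r =
    if r = d then Function.update (s.rarr d) i x else s.rarr r := by
  simp [storeR, Function.update_apply]
@[simp] theorem storeR_nreg : (s.storeR d i x).nreg = s.nreg := rfl
@[simp] theorem storeR_rreg : (s.storeR d i x).rreg = s.rreg := rfl
@[simp] theorem storeR_narr : (s.storeR d i x).narr = s.narr := rfl
@[simp] theorem storeR_queries : (s.storeR d i x).queries = s.queries := rfl

theorem setR_self (h : s.rreg d = x) : s.setR d x = s := by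
  rw [setR, ← h, Function.update_eq_self]

end State

theorem Frame.refl (p : Prog) (s : State) : Frame p s s :=
  ⟨fun _ _ => rfl, fun _ _ => rfl, fun _ _ => rfl, fun _ _ => rfl, fun _ => rfl⟩

theorem Frame.trans {p : Prog} {s s₁ s₂ : State} (h : Frame p s s₁) (h' : Frame p s₁ s₂) :
    Frame p s s₂ :=
  ⟨fun r hr => (h'.n r hr).trans (h.n r hr), fun r hr => (h'.r r hr).trans (h.r r hr),
    fun r hr => (h'.na r hr).trans (h.na r hr), fun r hr => (h'.ra r hr).trans (h.ra r hr),
    fun hr => (h'.q hr).trans (h.q hr)⟩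

theorem Frame.mono {p q : Prog} {s s' : State} (h : Frame p s s')
    (hpq : ∀ f, q.any f = false → p.any f = false) : Frame q s s' :=
  ⟨fun r hr => h.n r (hpq _ hr), fun r hr => h.r r (hpq _ hr), fun r hr => h.na r (hpq _ hr),
    fun r hr => h.ra r (hpq _ hr), fun hr => h.q (hpq _ hr)⟩

theorem Frame.seq_left {p q : Prog} {s s' : State} (h : Frame p s s') : Frame (.seq p q) s s' :=
  h.mono fun f hf => by simp only [Prog.any, Bool.or_eq_false_iff] at hf; exact hf.1

theorem Frame.seq_right {p q : Prog} {s s' : State} (h : Frame q s s') : Frame (.seq p q) s s' :=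
  h.mono fun f hf => by simp only [Prog.any, Bool.or_eq_false_iff] at hf; exact hf.2

theorem Frame.ite_left {b : Test} {p q : Prog} {s s' : State} (h : Frame p s s') :
    Frame (.ite b p q) s s' :=
  h.mono fun f hf => by simp only [Prog.any, Bool.or_eq_false_iff] at hf; exact hf.1

theorem Frame.ite_right {b : Test} {p q : Prog} {s s' : State} (h : Frame q s s') :
    Frame (.ite b p q) s s' :=
  h.mono fun f hf => by simp only [Prog.any, Bool.or_eq_false_iff] at hf; exact hf.2

theorem Instr.frame (O : ℕ → ℝ) (i : Instr) (s : State) : Frame (.instr i) s (i.apply O s) := by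
  constructor
  · intro r h
    cases i <;> simp only [Prog.any, wN, beq_eq_false_iff_ne] at h <;>
      first | rfl | exact Function.update_of_ne h.symm _ _
  · intro r h
    cases i <;> simp only [Prog.any, wR, beq_eq_false_iff_ne] at h <;>
      first | rfl | exact Function.update_of_ne h.symm _ _
  · intro r h
    cases i <;> simp only [Prog.any, wNA, beq_eq_false_iff_ne] at h <;>
      first | rfl | exact Function.update_of_ne h.symm _ _
  · intro r h
    cases i <;> simp only [Prog.any, wRA, beq_eq_false_iff_ne] at h <;>
      first | rfl | exact Function.update_of_ne h.symm _ _
  · intro h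
    cases i <;> first | rfl | simp [Prog.any, asks] at h

/-- What a program can write is visible in its text. The preservation of all other memory therefore
reduces to evaluating a Boolean, and loop invariants need to mention only what changes. -/
theorem Exec.frame {O : ℕ → ℝ} {p : Prog} {s s' : State} {T : ℕ} (h : Exec O p s s' T) :
    Frame p s s' := by
  induction h with
  | skip s => exact Frame.refl _ _
  | instr i s => exact i.frame O s
  | seq _ _ ih₁ ih₂ => exact ih₁.seq_left.trans ih₂.seq_right
  | iteTrue _ _ ih => exact ih.ite_left
  | iteFalse _ _ ih => exact ih.ite_right
  | whileTrue _ _ _ ih₁ ih₂ => exact Frame.trans (Frame.mono ih₁ fun f hf => hf) ih₂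
  | whileFalse _ => exact Frame.refl _ _

/-- With oracle `O`, the program `p` started in `s` halts within time `p.cost V` in a state that
satisfies `Q`. -/
def Runs (O : ℕ → ℝ) (V : ℕ) (p : Prog) (s : State) (Q : State → Prop) : Prop :=
  ∃ s' T, Exec O p s s' T ∧ T ≤ p.cost V ∧ Q s'

namespace Runs

variable {O : ℕ → ℝ} {V : ℕ} {p q : Prog} {s : State} {Q Q' : State → Prop}

theorem mono (h : Runs O V p s Q) (h' : ∀ s', Frame p s s' → Q s' → Q' s') : Runs O V p s Q' := by
  obtain ⟨s', T, he, hT, hQ⟩ := h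
  exact ⟨s', T, he, hT, h' s' he.frame hQ⟩

theorem skip (h : Q s) : Runs O V .skip s Q := ⟨s, 1, .skip s, le_rfl, h⟩

theorem instr {i : Instr} (h : Q (i.apply O s)) : Runs O V (.instr i) s Q :=
  ⟨_, 1, .instr i s, le_rfl, h⟩

theorem seq (h : Runs O V p s Q') (h' : ∀ s₁, Frame p s s₁ → Q' s₁ → Runs O V q s₁ Q) :
    Runs O V (.seq p q) s Q := by
  obtain ⟨s₁, T₁, he₁, hT₁, hQ₁⟩ := h
  obtain ⟨s₂, T₂, he₂, hT₂, hQ₂⟩ := h' s₁ he₁.frame hQ₁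
  exact ⟨s₂, _, he₁.seq he₂, add_le_add hT₁ hT₂, hQ₂⟩

theorem ite {b : Test} (h : b.Holds s → Runs O V p s Q) (h' : ¬ b.Holds s → Runs O V q s Q) :
    Runs O V (.ite b p q) s Q := by
  by_cases hb : b.Holds s
  · obtain ⟨s₁, T, he, hT, hQ⟩ := h hb
    exact ⟨s₁, _, .iteTrue hb he, by rw [Prog.cost]; omega, hQ⟩
  · obtain ⟨s₁, T, he, hT, hQ⟩ := h' hb
    exact ⟨s₁, _, .iteFalse hb he, by rw [Prog.cost]; omega, hQ⟩

end Runs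

/-- A sequence of instructions. -/
def block : List Instr → Prog
  | [] => .skip
  | i :: l => .seq (.instr i) (block l)

/-- The effect of a sequence of instructions. -/
noncomputable def applyAll (O : ℕ → ℝ) : List Instr → State → State
  | [], s => s
  | i :: l, s => applyAll O l (i.apply O s)

theorem Runs.block {O : ℕ → ℝ} {V : ℕ} {l : List Instr} {s : State} {Q : State → Prop}
    (h : Q (applyAll O l s)) : Runs O V (block l) s Q := by
  induction l generalizing s with
  | nil => exact Runs.skip h
  | cons i l ih =>
    refine Runs.seq (Runs.instr (Q := fun s' => s' = i.apply O s) rfl) ?_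
    rintro _ - rfl
    exact ih h

/-- Count register `i` up from `0` to the content of register `b`; register `4` is scratch. -/
def forP (i b : ℕ) (p : Prog) : Prog :=
  .seq (.instr (.nconst i 0)) (.while (.nlt i b)
    (.seq p (.seq (.instr (.nconst 4 1)) (.instr (.nadd i i 4)))))

/-- The registers that control the loop are not written by its body. -/
def loopOK (i b : ℕ) (p : Prog) : Bool :=
  i != b && i != 4 && b != 4 && !p.any (·.wN i) && !p.any (·.wN b)

/-- The invariant must survive the two instructions that increment the counter, hence the form of
its conclusion in `hstep`. The body is also given the frame relative to the state before the loop,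
so facts about untouched memory are available in every pass. -/
theorem Runs.forP {O : ℕ → ℝ} {V i b : ℕ} {p : Prog} {s : State} {Q : State → Prop} (n : ℕ)
    (Inv : ℕ → State → Prop) (hb : s.nreg b = n) (hV : n ≤ V) (hok : loopOK i b p = true)
    (h0 : Inv 0 (s.setN i 0))
    (hstep : ∀ j < n, ∀ s₁, Frame (forP i b p) s s₁ → s₁.nreg i = j → Inv j s₁ →
      Runs O V p s₁ fun s₂ => Inv (j + 1) ((s₂.setN 4 1).setN i (j + 1)))
    (hQ : ∀ s₁, Frame (SparseHadamard.forP i b p) s s₁ → Inv n s₁ → Q s₁) :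
    Runs O V (SparseHadamard.forP i b p) s Q := by
  simp only [loopOK, Bool.and_eq_true, bne_iff_ne, ne_eq, Bool.not_eq_true'] at hok
  obtain ⟨⟨⟨⟨hib, hi4⟩, hb4⟩, hwi⟩, hwb⟩ := hok
  have hfb : (SparseHadamard.forP i b p).any (·.wN b) = false := by
    have h1 : (Instr.nconst i 0).wN b = false := by simp [Instr.wN, hib]
    have h2 : (Instr.nconst 4 1).wN b = false := by simp [Instr.wN, Ne.symm hb4]
    have h3 : (Instr.nadd i i 4).wN b = false := by simp [Instr.wN, hib]
    simp only [SparseHadamard.forP, Prog.any, hwb, h1, h2, h3, Bool.or_self]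
  have loop : ∀ m j s₁, j + m = n → Frame (SparseHadamard.forP i b p) s s₁ → s₁.nreg i = j → Inv j s₁ →
      ∃ s' T, Exec O (.while (.nlt i b)
          (.seq p (.seq (.instr (.nconst 4 1)) (.instr (.nadd i i 4))))) s₁ s' T ∧
        T ≤ m * (p.cost V + 3) + 1 ∧ Frame (SparseHadamard.forP i b p) s s' ∧ Inv n s' := by
    intro m
    induction m with
    | zero =>
      intro j s₁ hj hf hi hI
      have hb' : s₁.nreg b = n := (hf.n b hfb).trans hb
      refine ⟨s₁, 1, .whileFalse ?_, by omega, hf, ?_⟩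
      · simp only [Test.Holds]; omega
      · have : j = n := by omega
        exact this ▸ hI
    | succ m ih =>
      intro j s₁ hj hf hi hI
      have hb' : s₁.nreg b = n := (hf.n b hfb).trans hb
      obtain ⟨s₂, T₂, he₂, hT₂, hI₂⟩ := hstep j (by omega) s₁ hf hi hI
      have hi₂ : s₂.nreg i = j := (he₂.frame.n i hwi).trans hi
      have he₃ : Exec O (.seq p (.seq (.instr (.nconst 4 1)) (.instr (.nadd i i 4)))) s₁
          ((s₂.setN 4 1).setN i (j + 1)) (T₂ + (1 + 1)) := by
        refine he₂.seq ((Exec.instr _ _).seq ?_)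
        have h4 : (s₂.setN 4 1).setN i (j + 1) =
            Instr.apply O (.nadd i i 4) (Instr.apply O (.nconst 4 1) s₂) := by
          simp [Instr.apply, hi4, hi₂]
        rw [h4]; exact Exec.instr _ _
      have hf₃ : Frame (SparseHadamard.forP i b p) s ((s₂.setN 4 1).setN i (j + 1)) :=
        hf.trans (Frame.seq_right (he₃.frame.mono fun f hf => hf))
      obtain ⟨s', T, he, hT, hfr, hI'⟩ := ih (j + 1) _ (by omega) hf₃ (by simp) hI₂
      refine ⟨s', _, .whileTrue ?_ he₃ he, ?_, hfr, hI'⟩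
      · simp only [Test.Holds]; omega
      · rw [add_mul]; omega
  have hf0 : Frame (SparseHadamard.forP i b p) s (s.setN i 0) :=
    Frame.seq_left (Instr.frame O (.nconst i 0) s)
  obtain ⟨s', T, he, hT, hf, hI⟩ := loop n 0 (s.setN i 0) (by omega) hf0 (by simp) h0
  refine ⟨s', 1 + T, Exec.seq (Exec.instr _ _) he, ?_, hQ s' hf hI⟩
  simp only [SparseHadamard.forP, Prog.cost]
  have : n * (p.cost V + 3) ≤ V * (p.cost V + (1 + 1) + 1) := Nat.mul_le_mul hV (by omega)
  omega

/-- Replace real register `d` by its absolute value; register `t` is scratch. -/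
def absP (d t : ℕ) : Prog :=
  .seq (.instr (.rconst t 0)) (.ite (.rlt d t) (.instr (.rsub d t d)) .skip)

theorem Runs.absP {O : ℕ → ℝ} {V d t : ℕ} {s : State} {Q : State → Prop} (hdt : d ≠ t)
    (h : Q ((s.setR t 0).setR d |s.rreg d|)) : Runs O V (absP d t) s Q := by
  refine Runs.seq (Runs.instr (Q := fun s' => s' = s.setR t 0) (by simp [Instr.apply])) ?_
  rintro _ - rfl
  refine Runs.ite (fun hb => Runs.instr ?_) (fun hb => Runs.skip ?_) <;>
    simp only [Test.Holds, State.setR_rreg, hdt, if_true, if_false] at hb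
  · simp only [Instr.apply, State.setR_rreg, hdt, if_true, if_false, zero_sub]
    rwa [← abs_of_neg hb]
  · rw [abs_of_nonneg (not_lt.1 hb)] at h
    rwa [State.setR_self _ _ _ (by simp [hdt])] at h

section

variable {O : ℕ → ℝ} {V : ℕ} {q : Prog} {s : State} {Q : State → Prop}

theorem Runs.block_seq {l : List Instr} (h : ∀ s₁, Frame (SparseHadamard.block l) s s₁ →
    s₁ = applyAll O l s → Runs O V q s₁ Q) : Runs O V (.seq (SparseHadamard.block l) q) s Q :=
  Runs.seq (Runs.block (Q := fun s' => s' = applyAll O l s) rfl) h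

theorem Runs.instr_seq {i : Instr} (h : ∀ s₁, Frame (.instr i) s s₁ →
    s₁ = i.apply O s → Runs O V q s₁ Q) : Runs O V (.seq (.instr i) q) s Q :=
  Runs.seq (Runs.instr (Q := fun s' => s' = i.apply O s) rfl) h

theorem Runs.abs_seq {d t : ℕ} (hdt : d ≠ t) (h : ∀ s₁, Frame (SparseHadamard.absP d t) s s₁ →
    s₁ = (s.setR t 0).setR d |s.rreg d| → Runs O V q s₁ Q) :
    Runs O V (.seq (SparseHadamard.absP d t) q) s Q :=
  Runs.seq (Runs.absP hdt (Q := fun s' => s' = (s.setR t 0).setR d |s.rreg d|) rfl) h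

end

end SparseHadamard

namespace SparseHadamard

open Finset

/-! ### The recovery programs

Integer registers: `1` holds `k`, `6` holds `N`, `7` the number of edges, `8` the number of buckets,
`9` holds `128 k` and `10` holds `16 N`.
Integer arrays: `1` and `2` hold the left and right ends of the edges. Real arrays: `0` holds the
current approximation, `1` the bucket values, `2` a candidate, `3` its residual, `4` the best
candidate. Real registers: `0` holds the norm of the residual of the candidate, `3` that of the best
candidate. -/

/-- Compute the residual of the candidate and its norm. -/
def residP : Prog :=
  .seq (forP 20 8 (block [.rload 1 1 20, .rstore 3 20 1]))
  (.seq (forP 20 7 (block [.nload 21 1 20, .nload 22 2 20, .rload 1 2 21, .rload 2 3 22,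
    .rsub 2 2 1, .rstore 3 22 2]))
  (.seq (.instr (.rconst 0 0))
  (forP 20 8 (.seq (.instr (.rload 1 3 20)) (.seq (absP 1 2) (.instr (.radd 0 0 1)))))))

/-- The memory holds the graph and the bucket values. -/
structure Ctx (V N E B k : ℕ) (src bkt : ℕ → ℕ) (y : ℕ → ℝ) (s : State) : Prop where
  hk : s.nreg 1 = k
  hN : s.nreg 6 = N
  hE : s.nreg 7 = E
  hB : s.nreg 8 = B
  hT : s.nreg 9 = 128 * k
  hW : s.nreg 10 = 16 * N
  hsrc : s.narr 1 = src
  hbkt : s.narr 2 = bkt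
  hy : s.rarr 1 = y
  leN : N ≤ V
  leE : E ≤ V
  leB : B ≤ V
  leT : 128 * k ≤ V
  leW : 16 * N ≤ V

section

variable {O : ℕ → ℝ} {V N E B d k : ℕ} {src bkt : ℕ → ℕ} {y : ℕ → ℝ} {s : State}

/-- The program does not write the graph, the bucket values and the parameters. -/
def keepsCtx (p : Prog) : Bool :=
  !p.any (·.wN 1) && !p.any (·.wN 6) && !p.any (·.wN 7) && !p.any (·.wN 8) && !p.any (·.wN 9) && !p.any (·.wN 10) &&
    !p.any (·.wNA 1) && !p.any (·.wNA 2) && !p.any (·.wRA 1)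

theorem Ctx.frame {p : Prog} {s' : State} (h : Ctx V N E B k src bkt y s) (hf : Frame p s s')
    (hp : keepsCtx p = true) : Ctx V N E B k src bkt y s' := by
  simp only [keepsCtx, Bool.and_eq_true, Bool.not_eq_true'] at hp
  obtain ⟨⟨⟨⟨⟨⟨⟨⟨h1, h6⟩, h7⟩, h8⟩, h9⟩, h10⟩, ha1⟩, ha2⟩, hr1⟩ := hp
  exact ⟨(hf.n 1 h1).trans h.hk, (hf.n 6 h6).trans h.hN, (hf.n 7 h7).trans h.hE,
    (hf.n 8 h8).trans h.hB, (hf.n 9 h9).trans h.hT, (hf.n 10 h10).trans h.hW, (hf.na 1 ha1).trans h.hsrc, (hf.na 2 ha2).trans h.hbkt,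
    (hf.ra 1 hr1).trans h.hy, h.leN, h.leE, h.leB, h.leT, h.leW⟩

theorem residP_spec (h : Ctx V N E B k src bkt y s) :
    Runs O V residP s fun s' => (∀ b < B, s'.rarr 3 b = resid E src bkt y (s.rarr 2) b) ∧
      s'.rreg 0 = rho E B src bkt y (s.rarr 2) := by
  unfold residP
  refine Runs.seq (Runs.forP B (fun j s' => ∀ b < j, s'.rarr 3 b = y b) h.hB h.leB (by decide)
    (by simp) (fun j hj s₁ hf hi hI => Runs.block ?_) (Q := fun s' => ∀ b < B, s'.rarr 3 b = y b)
    fun _ _ h => h) fun s₁ hf₁ hs₁ => ?_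
  · intro b hb
    simp only [applyAll, Instr.apply]
    have hy1 : s₁.rarr 1 = y := (hf.ra 1 (by decide)).trans h.hy
    simp only [State.setN_rarr, State.storeR_rarr, State.setR_nreg, State.setR_rarr, State.setR_rreg,
      hi, if_true, hy1, Function.update_apply]
    split_ifs with hbj
    · rw [hbj]
    · exact hI b (by omega)
  have c₁ := h.frame hf₁ (by decide)
  have z₁ : s₁.rarr 2 = s.rarr 2 := hf₁.ra 2 (by decide)
  -- After `j` passes the array holds the residual with respect to the first `j` edges only, which
  -- is `resid` with `j` in place of `E`.
  refine Runs.seq (Runs.forP E (fun j s' => ∀ b < B, s'.rarr 3 b = resid j src bkt y (s.rarr 2) b)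
    c₁.hE h.leE (by decide) ?_ (fun j hj s₂ hf hi hI => Runs.block ?_)
    (Q := fun s' => ∀ b < B, s'.rarr 3 b = resid E src bkt y (s.rarr 2) b)
    fun _ _ h => h) fun s₂ hf₂ hs₂ => ?_
  · intro b hb; simp [resid, bucketSum, hs₁ b hb]
  · intro b hb
    simp only [applyAll, Instr.apply]
    have e1 : s₂.narr 1 = src := (hf.na 1 (by decide)).trans c₁.hsrc
    have e2 : s₂.narr 2 = bkt := (hf.na 2 (by decide)).trans c₁.hbkt
    have e3 : s₂.rarr 2 = s.rarr 2 := (hf.ra 2 (by decide)).trans z₁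
    have hres : resid (j + 1) src bkt y (s.rarr 2) b = resid j src bkt y (s.rarr 2) b -
        (if bkt j = b then s.rarr 2 (src j) else 0) := by
      rw [resid, resid, bucketSum, bucketSum, range_add_one, filter_insert]
      split_ifs
      · rw [sum_insert (by simp)]; ring
      · ring
    have hI' := hI b hb
    simp [hi, e1, e2, e3, Function.update_apply, hres]
    by_cases hbj : bkt j = b
    · subst hbj; simp [hI']
    · simp [hbj, Ne.symm hbj, hI']
  have c₂ := c₁.frame hf₂ (by decide)
  refine Runs.instr_seq ?_
  rintro _ - rfl
  refine Runs.forP B (fun j s' => s'.rreg 0 = ∑ b ∈ range j, |resid E src bkt y (s.rarr 2) b|)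
    (by simpa [Instr.apply] using c₂.hB) h.leB (by decide) (by simp [Instr.apply]) (fun j hj s₃ hf hi hI => ?_)
    fun s₃ hf hs₃ => ⟨fun b hb => ?_, hs₃⟩
  · refine Runs.instr_seq ?_
    rintro _ - rfl
    refine Runs.abs_seq (by decide) ?_
    rintro _ - rfl
    refine Runs.instr ?_
    have e3 : s₃.rarr 3 j = _ := (congrFun (hf.ra 3 (by decide)) j).trans (hs₂ j hj)
    simp [Instr.apply, hi, hI, e3, sum_range_succ]
  · rw [hf.ra 3 (by decide)]; exact hs₂ b hb

end

/-- Copying transfers only the first `N` cells, so arrays are known only there; the residual norm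
does not see the other cells. -/
theorem rho_congr {N E B : ℕ} {src bkt : ℕ → ℕ} (hsrc : ∀ e < E, src e < N) (y : ℕ → ℝ)
    {z w : ℕ → ℝ} (h : ∀ i < N, z i = w i) : rho E B src bkt y z = rho E B src bkt y w := by
  refine sum_congr rfl fun b _ => ?_
  rw [resid, resid, bucketSum, bucketSum]
  congr 2
  exact sum_congr rfl fun e he => h _ (hsrc e (mem_range.1 (mem_filter.1 he).1))

theorem supp_congr {N : ℕ} {z w : ℕ → ℝ} (h : ∀ i < N, z i = w i) : supp N z = supp N w := by
  ext i; rw [mem_supp, mem_supp]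
  exact and_congr_right fun hi => by rw [h i hi]

theorem nrm_congr {N : ℕ} {z w : ℕ → ℝ} (h : ∀ i < N, z i = w i) : nrm N z = nrm N w :=
  sum_congr rfl fun i hi => by rw [h i (mem_range.1 hi)]

theorem card_supp_le_succ {N : ℕ} {z w : ℕ → ℝ} (i : ℕ) (h : ∀ j < N, j ≠ i → w j = z j) :
    #(supp N w) ≤ #(supp N z) + 1 := by
  classical
  refine (card_le_card fun j hj => ?_).trans (card_insert_le i (supp N z))
  rw [mem_supp] at hj
  by_cases hji : j = i
  · simp [hji]
  · refine mem_insert_of_mem (mem_supp.2 ⟨hj.1, ?_⟩)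
    rw [← h j hj.1 hji]; exact hj.2

/-- Copy the first entries of real array `a` to real array `b`; register `c` holds their number. -/
def copyP (c a b : ℕ) : Prog := forP 20 c (block [.rload 1 a 20, .rstore b 20 1])

/-- Compare the candidate with the best one so far. -/
def offerP : Prog :=
  .seq residP (.ite (.rlt 0 3) (.seq (block [.rconst 1 0, .radd 3 0 1]) (copyP 6 2 4)) .skip)

/-- Compute the residual of the current approximation, and start a comparison of candidates with
it. -/
def startP : Prog :=
  .seq (copyP 6 0 2) (.seq residP (.seq (block [.rconst 1 0, .radd 3 0 1]) (copyP 6 0 4)))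

/-- One greedy step: try to update every coordinate by the residual of every adjacent bucket. -/
def greedyP : Prog :=
  .seq startP (.seq (copyP 8 3 5) (.seq
    (forP 23 7 (.seq (copyP 6 0 2) (.seq (block [.nload 24 1 23, .nload 25 2 23, .rload 4 2 24,
      .rload 5 5 25, .radd 4 4 5, .rstore 2 24 4]) offerP)))
    (copyP 6 4 0)))

/-- Keep the `k` largest coordinates. -/
def sparsifyP : Prog :=
  .seq (forP 23 6 (.seq (block [.nconst 24 0, .rload 4 0 23]) (.seq (absP 4 6) (.seq
    (forP 25 6 (.seq (.instr (.rload 5 0 25)) (.seq (absP 5 6) (.seq (.instr (.nconst 27 1))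
      (.ite (.rlt 4 5) (.instr (.nadd 24 24 27)) (.ite (.rlt 5 4) .skip
        (.ite (.nlt 25 23) (.instr (.nadd 24 24 27)) .skip)))))))
    (.ite (.nlt 24 1) (block [.rload 4 0 23, .rstore 2 23 4])
      (block [.rconst 4 0, .rstore 2 23 4]))))))
  (copyP 6 2 0)

/-- Repeat: greedy steps, then keep the `k` largest coordinates. -/
def iterateP : Prog := forP 13 10 (.seq (forP 11 9 greedyP) sparsifyP)

/-! ### Correctness of the greedy step and of the truncation -/

section

variable {O : ℕ → ℝ} {V N E B d k : ℕ} {src bkt : ℕ → ℕ} {y : ℕ → ℝ} {s : State}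

theorem copyP_spec {c a b n : ℕ} (hc : s.nreg c = n) (hn : n ≤ V) (hab : a ≠ b)
    (hok : loopOK 20 c (block [.rload 1 a 20, .rstore b 20 1]) = true) :
    Runs O V (copyP c a b) s fun s' => ∀ i < n, s'.rarr b i = s.rarr a i := by
  have hba : (forP 20 c (block [.rload 1 a 20, .rstore b 20 1])).any (·.wRA a) = false := by
    simp [forP, block, Prog.any, Instr.wRA, hab.symm]
  refine Runs.forP n (fun j s' => ∀ i < j, s'.rarr b i = s.rarr a i) hc hn hok (by simp)
    (fun j hj s₁ hf hi hI => Runs.block ?_) fun _ _ h => h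
  intro i hij
  have := hf.ra a hba
  simp only [applyAll, Instr.apply, State.setN_rarr, State.storeR_rarr, State.setR_nreg,
    State.setR_rarr, State.setR_rreg, hi, if_true, this, Function.update_apply]
  split_ifs with h1
  · rw [h1]
  · exact hI i (by omega)

theorem offerP_spec (hsrc : ∀ e < E, src e < N) (h : Ctx V N E B k src bkt y s)
    (hbest : s.rreg 3 = rho E B src bkt y (s.rarr 4)) :
    Runs O V offerP s fun s' => s'.rreg 3 = rho E B src bkt y (s'.rarr 4) ∧
      s'.rreg 3 ≤ s.rreg 3 ∧ s'.rreg 3 ≤ rho E B src bkt y (s.rarr 2) ∧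
      ((∀ i < N, s'.rarr 4 i = s.rarr 4 i) ∨ ∀ i < N, s'.rarr 4 i = s.rarr 2 i) := by
  refine Runs.seq (residP_spec h) fun s₁ hf₁ hs₁ => ?_
  have e3 : s₁.rreg 3 = s.rreg 3 := hf₁.r 3 (by decide)
  have e4 : s₁.rarr 4 = s.rarr 4 := hf₁.ra 4 (by decide)
  refine Runs.ite (fun hb => ?_) fun hb => Runs.skip ?_
  · simp only [Test.Holds, hs₁.2, e3] at hb
    refine Runs.block_seq ?_
    rintro _ - rfl
    refine Runs.mono (copyP_spec (n := N) (V := V) ?_ h.leN (by decide) (by decide)) fun s₂ hf₂ hs₂ => ?_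
    · simpa [applyAll, Instr.apply] using (h.frame hf₁ (by decide)).hN
    have e5 : s₂.rreg 3 = rho E B src bkt y (s.rarr 2) := by
      rw [hf₂.r 3 (by decide)]; simp [applyAll, Instr.apply, hs₁.2]
    have e6 : ∀ i < N, s₂.rarr 4 i = s.rarr 2 i := fun i hi => by
      rw [hs₂ i hi]; simp [applyAll, Instr.apply, hf₁.ra 2 (by decide)]
    exact ⟨by rw [e5, rho_congr hsrc y e6], by rw [e5]; exact hb.le, e5.le, Or.inr e6⟩
  · simp only [Test.Holds, hs₁.2, e3, not_lt] at hb
    exact ⟨by rw [e3, e4, hbest], e3.le, by rw [e3]; exact hb, Or.inl fun i _ => by rw [e4]⟩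

theorem startP_spec (hsrc : ∀ e < E, src e < N) (h : Ctx V N E B k src bkt y s) :
    Runs O V startP s fun s' => s'.rreg 3 = rho E B src bkt y (s.rarr 0) ∧
      (∀ i < N, s'.rarr 4 i = s.rarr 0 i) ∧
      ∀ b < B, s'.rarr 3 b = resid E src bkt y (s.rarr 0) b := by
  refine Runs.seq (copyP_spec h.hN h.leN (by decide) (by decide)) fun s₁ hf₁ hs₁ => ?_
  have c₁ := h.frame hf₁ (by decide)
  refine Runs.seq (residP_spec c₁) fun s₂ hf₂ hs₂ => ?_
  have c₂ := c₁.frame hf₂ (by decide)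
  refine Runs.block_seq ?_
  rintro _ - rfl
  refine Runs.mono (copyP_spec (n := N) (V := V) ?_ h.leN (by decide) (by decide))
    fun s₃ hf₃ hs₃ => ⟨?_, fun i hi => ?_, fun b hb => ?_⟩
  · simpa [applyAll, Instr.apply] using c₂.hN
  · rw [hf₃.r 3 (by decide)]
    simp [applyAll, Instr.apply, hs₂.2, rho_congr hsrc y hs₁]
  · rw [hs₃ i hi]
    simp [applyAll, Instr.apply, hf₂.ra 0 (by decide), hf₁.ra 0 (by decide)]
  · rw [hf₃.ra 3 (by decide)]
    simp only [applyAll, Instr.apply, State.setR_rarr, hs₂.1 b hb]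
    rw [resid, resid, bucketSum, bucketSum]
    congr 1
    exact sum_congr rfl fun e he => hs₁ _ (hsrc e (mem_range.1 (mem_filter.1 he).1))

theorem greedyP_spec (hsrc : ∀ e < E, src e < N) (hbkt : ∀ e < E, bkt e < B)
    (h : Ctx V N E B k src bkt y s) :
    Runs O V greedyP s fun s' =>
      rho E B src bkt y (s'.rarr 0) ≤ rho E B src bkt y (s.rarr 0) ∧
      (∀ e < E, rho E B src bkt y (s'.rarr 0) ≤ rho E B src bkt y (Function.update (s.rarr 0) (src e)
        (s.rarr 0 (src e) + resid E src bkt y (s.rarr 0) (bkt e)))) ∧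
      ∃ i, ∀ j < N, j ≠ i → s'.rarr 0 j = s.rarr 0 j := by
  set z := s.rarr 0 with hz
  refine Runs.seq (startP_spec hsrc h) fun s₁ hf₁ hs₁ => ?_
  have c₁ := h.frame hf₁ (by decide)
  -- Every offered candidate overwrites array `3`. The trial updates need the residual of the
  -- unchanged `z`, so it is saved in array `5`.
  refine Runs.seq (copyP_spec (n := B) c₁.hB h.leB (by decide) (by decide)) fun s₂ hf₂ hs₂ => ?_
  have c₂ := c₁.frame hf₂ (by decide)
  have z₂ : s₂.rarr 0 = z := (hf₂.ra 0 (by decide)).trans (hf₁.ra 0 (by decide))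
  have r₂ : ∀ b < B, s₂.rarr 5 b = resid E src bkt y z b := fun b hb => by
    rw [hs₂ b hb, hs₁.2.2 b hb]
  refine Runs.seq (Runs.forP E (fun j s' => s'.rreg 3 = rho E B src bkt y (s'.rarr 4) ∧
      s'.rreg 3 ≤ rho E B src bkt y z ∧
      (∀ e < j, s'.rreg 3 ≤ rho E B src bkt y (Function.update z (src e)
        (z (src e) + resid E src bkt y z (bkt e)))) ∧
      ∃ i, ∀ j < N, j ≠ i → s'.rarr 4 j = z j) c₂.hE h.leE (by decide) ?_
      (fun j hj s₃ hf₃ hi hI => ?_) (fun _ _ h => h)) fun s₃ hf₃ hs₃ => ?_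
  · have e3 : s₂.rreg 3 = rho E B src bkt y z := (hf₂.r 3 (by decide)).trans hs₁.1
    have e4 : ∀ i < N, s₂.rarr 4 i = z i := fun i hi => by
      rw [hf₂.ra 4 (by decide), hs₁.2.1 i hi]
    exact ⟨by simp [e3, rho_congr hsrc y e4], by simp [e3], by simp, 0, fun j hj _ => by
      simp [e4 j hj]⟩
  · have c₃ := c₂.frame hf₃ (by decide)
    have z₃ : s₃.rarr 0 = z := (hf₃.ra 0 (by decide)).trans z₂
    have r₃ : s₃.rarr 5 = s₂.rarr 5 := hf₃.ra 5 (by decide)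
    refine Runs.seq (copyP_spec c₃.hN h.leN (by decide) (by decide)) fun s₄ hf₄ hs₄ => ?_
    have c₄ := c₃.frame hf₄ (by decide)
    refine Runs.block_seq fun s₅ hf₅ hs₅ => ?_
    have c₅ := c₄.frame hf₅ (by decide)
    have hcand : ∀ i < N, s₅.rarr 2 i = Function.update z (src j)
        (z (src j) + resid E src bkt y z (bkt j)) i := by
      intro i hiN
      have e23 : s₄.nreg 23 = j := (hf₄.n 23 (by decide)).trans hi
      have e5 : s₄.rarr 5 = s₂.rarr 5 := (hf₄.ra 5 (by decide)).trans r₃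
      rw [hs₅]
      simp only [Nat.reduceEqDiff, if_false, applyAll, Instr.apply, State.storeR_rarr, State.setR_nreg, State.setR_rarr,
        State.setR_rreg, State.setN_nreg, State.setN_rarr, State.setN_narr, if_true,
        e23, c₄.hsrc, c₄.hbkt, e5, Function.update_apply]
      split_ifs
      · rw [hs₄ _ (hsrc j hj), z₃, r₂ _ (hbkt j hj)]
      · rw [hs₄ i hiN, z₃]
    have e3 : s₅.rreg 3 = s₃.rreg 3 := (hf₅.r 3 (by decide)).trans (hf₄.r 3 (by decide))
    have e4 : s₅.rarr 4 = s₃.rarr 4 := (hf₅.ra 4 (by decide)).trans (hf₄.ra 4 (by decide))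
    refine Runs.mono (offerP_spec hsrc c₅ (by rw [e3, e4]; exact hI.1)) fun s₆ hf₆ hs₆ => ?_
    obtain ⟨h1, h2, h3, h4⟩ := hs₆
    rw [rho_congr hsrc y hcand] at h3
    refine ⟨by simpa using h1, ?_, fun e he => ?_, ?_⟩
    · simp only [State.setN_rreg]; rw [e3] at h2; exact h2.trans hI.2.1
    · simp only [State.setN_rreg]
      rcases Nat.lt_succ_iff_lt_or_eq.1 he with he | rfl
      · rw [e3] at h2; exact h2.trans (hI.2.2.1 e he)
      · exact h3
    · simp only [State.setN_rarr]
      rcases h4 with h4 | h4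
      · obtain ⟨i, hi'⟩ := hI.2.2.2
        exact ⟨i, fun m hm hmi => by rw [h4 m hm, e4, hi' m hm hmi]⟩
      · exact ⟨src j, fun m hm hmi => by
          rw [h4 m hm, hcand m hm, Function.update_of_ne hmi]⟩
  · have c₃ := c₂.frame hf₃ (by decide)
    refine Runs.mono (copyP_spec c₃.hN h.leN (by decide) (by decide)) fun s₄ hf₄ hs₄ => ?_
    obtain ⟨h1, h2, h3, i, h4⟩ := hs₃
    have e : rho E B src bkt y (s₄.rarr 0) = s₃.rreg 3 := by rw [h1, rho_congr hsrc y hs₄]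
    exact ⟨by rw [e]; exact h2, fun e' he' => by rw [e]; exact h3 e' he', i, fun j hj hji => by
      rw [hs₄ j hj, h4 j hj hji]⟩

theorem sparsifyP_spec (h : Ctx V N E B k src bkt y s) :
    Runs O V sparsifyP s fun s' => ∀ i < N, s'.rarr 0 i = topK N k (s.rarr 0) i := by
  classical
  set z := s.rarr 0 with hz
  refine Runs.seq (Runs.forP N (fun j s' => ∀ i < j, s'.rarr 2 i = topK N k z i) h.hN h.leN
    (by decide) (by simp) (fun j hj s₁ hf₁ hi hI => ?_)
    (Q := fun s' => ∀ i < N, s'.rarr 2 i = topK N k z i) (fun _ _ h => h)) fun s₁ hf₁ hs₁ => ?_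
  · have c₁ := h.frame hf₁ (by decide)
    have z₁ : s₁.rarr 0 = z := hf₁.ra 0 (by decide)
    refine Runs.block_seq ?_
    rintro _ - rfl
    refine Runs.abs_seq (by decide) fun s₂ hf₂ hs₂ => ?_
    have e4 : s₂.rreg 4 = |z j| := by
      rw [hs₂]; simp [applyAll, Instr.apply, hi, z₁]
    have e24 : s₂.nreg 24 = 0 := by rw [hs₂]; simp [applyAll, Instr.apply]
    have e23 : s₂.nreg 23 = j := by rw [hs₂]; simpa [applyAll, Instr.apply] using hi
    have z₂ : s₂.rarr 0 = z := by rw [hs₂]; simpa [applyAll, Instr.apply] using z₁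
    have n₂ : s₂.nreg 6 = N := by rw [hs₂]; simpa [applyAll, Instr.apply] using c₁.hN
    have k₂ : s₂.nreg 1 = k := by rw [hs₂]; simpa [applyAll, Instr.apply] using c₁.hk
    have w₂ : s₂.rarr 2 = s₁.rarr 2 := by rw [hs₂]; simp [applyAll, Instr.apply]
    refine Runs.seq (Runs.forP N (fun m s' => s'.nreg 24 = #{i ∈ range m | Precedes z i j}) n₂ h.leN
      (by decide) (by simpa using e24) (fun m hm s₃ hf₃ hi₃ hI₃ => ?_)
      (Q := fun s' => s'.nreg 24 = magRank N z j) (fun _ _ h => h)) fun s₃ hf₃ hs₃ => ?_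
    · have e4' : s₃.rreg 4 = |z j| := (hf₃.r 4 (by decide)).trans e4
      have e23' : s₃.nreg 23 = j := (hf₃.n 23 (by decide)).trans e23
      have z₃ : s₃.rarr 0 = z := (hf₃.ra 0 (by decide)).trans z₂
      refine Runs.instr_seq ?_
      rintro _ - rfl
      refine Runs.abs_seq (by decide) ?_
      rintro _ - rfl
      refine Runs.instr_seq ?_
      rintro _ - rfl
      -- Register `24` counts the positions that precede `j`. The nested tests decide `Precedes z m
      -- j`: larger value, smaller value, or a tie decided by the index.
      have hyes : Precedes z m j → s₃.nreg 24 + 1 = #{i ∈ range (m + 1) | Precedes z i j} := by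
        intro hp; rw [range_add_one, filter_insert, if_pos hp, card_insert_of_notMem (by simp), hI₃]
      have hno : ¬ Precedes z m j → s₃.nreg 24 = #{i ∈ range (m + 1) | Precedes z i j} := by
        intro hp; rw [range_add_one, filter_insert, if_neg hp, hI₃]
      refine Runs.ite (fun hb => Runs.instr ?_) fun hb => Runs.ite (fun hb' => Runs.skip ?_)
        fun hb' => Runs.ite (fun hb'' => Runs.instr ?_) fun hb'' => Runs.skip ?_
      · simp [Test.Holds, Instr.apply, e4', hi₃, z₃] at hb
        simpa [Instr.apply] using hyes (Or.inl hb)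
      · simp [Test.Holds, Instr.apply, e4', hi₃, z₃] at hb hb'
        simpa [Instr.apply] using hno (by rintro (h | h); exacts [by linarith, by linarith [h.1]])
      · simp [Test.Holds, Instr.apply, e4', hi₃, z₃, e23'] at hb hb' hb''
        simpa [Instr.apply] using hyes (Or.inr ⟨le_antisymm hb' hb, hb''⟩)
      · simp [Test.Holds, Instr.apply, e4', hi₃, z₃, e23'] at hb hb' hb''
        simpa [Instr.apply] using hno (by rintro (h | h); exacts [by linarith, by omega])
    · have z₃ : s₃.rarr 0 = z := (hf₃.ra 0 (by decide)).trans z₂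
      have k₃ : s₃.nreg 1 = k := (hf₃.n 1 (by decide)).trans k₂
      have e23' : s₃.nreg 23 = j := (hf₃.n 23 (by decide)).trans e23
      have w₃ : s₃.rarr 2 = s₁.rarr 2 := (hf₃.ra 2 (by decide)).trans w₂
      refine Runs.ite (fun hb => Runs.block ?_) fun hb => Runs.block ?_ <;>
        simp only [Test.Holds, hs₃, k₃] at hb <;> intro i hij <;>
        simp [applyAll, Instr.apply, Function.update_apply, e23', z₃, w₃] <;> split_ifs with h1
      · simp [h1, topK, hb]
      · exact hI i (by omega)
      · simp [h1, topK, hb]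
      · exact hI i (by omega)
  · have c₁ := h.frame hf₁ (by decide)
    refine Runs.mono (copyP_spec c₁.hN h.leN (by decide) (by decide)) fun s₂ hf₂ hs₂ i hi => ?_
    rw [hs₂ i hi, hs₁ i hi]

end

/-- The graph expands, the bucket values are those of `x`, and `S` is a set of at most `k`
positions. -/
structure Setting (N E B d k : ℕ) (src bkt : ℕ → ℕ) (y x : ℕ → ℝ) (S : Finset ℕ) : Prop where
  graph : Graph N E B d src bkt
  hd : 1 ≤ d
  hk : 1 ≤ k
  hN : 2 ≤ N
  expands : Expands N E d src bkt (130 * k)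
  hy : ∀ b < B, y b = bucketSum E src bkt x b
  sub : S ⊆ range N
  card : #S ≤ k

/-! ### Correctness of the iteration -/

section

variable {O : ℕ → ℝ} {V N E B d k : ℕ} {src bkt : ℕ → ℕ} {y x : ℕ → ℝ} {S : Finset ℕ} {s : State}

/-- A greedy step creates at most one new nonzero entry, so before step `j` the difference from the
target has at most `2k + j` of them. This stays below `130k`, where expansion is available, and the
factors `K/(K+1)` with `K = 2k + j` telescope. -/
theorem greedy_loop_spec (G : Setting N E B d k src bkt y x S) (h : Ctx V N E B k src bkt y s)
    (hs : #(supp N (s.rarr 0)) ≤ k) :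
    Runs O V (forP 11 9 greedyP) s fun s' => #(supp N (s'.rarr 0)) ≤ k + 128 * k ∧
      excessRho (rho E B src bkt y (s'.rarr 0)) (d * tail N x S) ^ 2 * (2 * k + 128 * k) ≤
        excessRho (rho E B src bkt y (s.rarr 0)) (d * tail N x S) ^ 2 * (2 * k) := by
  refine Runs.forP (128 * k) (fun j s' => #(supp N (s'.rarr 0)) ≤ k + j ∧
      excessRho (rho E B src bkt y (s'.rarr 0)) (d * tail N x S) ^ 2 * (2 * k + j) ≤
        excessRho (rho E B src bkt y (s.rarr 0)) (d * tail N x S) ^ 2 * (2 * k))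
    h.hT h.leT (by decide) ?_ (fun j hj s₁ hf hi hI => ?_) fun s₁ hf hs₁ => ?_
  · simpa using hs
  · refine Runs.mono (greedyP_spec G.graph.src_lt G.graph.bkt_lt (h.frame hf (by decide)))
      fun s₂ hf₂ hs₂ => ?_
    obtain ⟨h1, h2, i, h3⟩ := hs₂
    simp only [State.setN_rarr]
    refine ⟨(card_supp_le_succ i h3).trans (by omega), ?_⟩
    have hu := (card_supp_restr (N := N) S x).trans G.card
    have hcard : #(supp N (restr S x - s₁.rarr 0)) ≤ 2 * k + j :=
      (supp_sub_card N _ _).trans (by omega)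
    have hexp : Expands N E d src bkt (2 * k + j) := fun A hA hA' =>
      G.expands A hA (hA'.trans (by omega))
    have h4 := G.graph.greedy_step hexp G.hy hcard h1 h2
    rw [nrm_sub_restr G.sub] at h4
    have h5 := excessRho_step (by have := G.hk; omega) h1 h4
      (mul_nonneg (Nat.cast_nonneg _) (tail_nonneg N x S))
    have h6 := hI.2
    push_cast at h5 ⊢
    linarith
  · simpa using hs₁

/-- The recursion is `e ↦ e/2 + 12η` with fixed point `24η`, so the additive term never exceeds
`24η`. -/
theorem iterateP_spec (G : Setting N E B d k src bkt y x S) (h : Ctx V N E B k src bkt y s)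
    (hs : #(supp N (s.rarr 0)) ≤ k) :
    Runs O V iterateP s fun s' => #(supp N (s'.rarr 0)) ≤ k ∧
      nrm N (restr S x - s'.rarr 0) ≤
        nrm N (restr S x - s.rarr 0) / 2 ^ (16 * N) + 24 * tail N x S := by
  refine Runs.forP (16 * N) (fun j s' => #(supp N (s'.rarr 0)) ≤ k ∧
      nrm N (restr S x - s'.rarr 0) ≤
        nrm N (restr S x - s.rarr 0) / 2 ^ j + 24 * tail N x S)
    h.hW h.leW (by decide) ?_ (fun j hj s₁ hf hi hI => ?_) fun s₁ hf hs₁ => hs₁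
  · simpa using ⟨hs, tail_nonneg N x S⟩
  · have c₁ := h.frame hf (by decide)
    refine Runs.seq (greedy_loop_spec G c₁ hI.1) fun s₂ hf₂ hs₂ => ?_
    have c₂ := c₁.frame hf₂ (by decide)
    refine Runs.mono (sparsifyP_spec c₂) fun s₃ hf₃ hs₃ => ?_
    simp only [State.setN_rarr]
    refine ⟨by rw [supp_congr hs₃]; exact card_supp_topK _ _ _, ?_⟩
    have h1 := G.graph.contraction G.hd G.hk G.expands G.sub G.card G.hy hs₂.1 hs₂.2
    rw [nrm_congr (w := restr S x - topK N k (s₂.rarr 0)) fun i hi => by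
      simp [hs₃ i hi]]
    have h2 := hI.2
    rw [pow_succ, ← div_div]
    linarith

end

/-- Does the edge in register `30` (left end `31`, right end `32`) meet another edge with an active
left end in its bucket? The answer is left in register `35`. -/
def conflictP : Prog :=
  .seq (block [.nconst 34 0, .nconst 35 0, .nconst 40 1])
  (forP 36 7 (.seq (block [.nload 37 1 36, .nload 38 2 36, .nload 39 3 37])
    (.ite (.nlt 34 39) (.ite (.nlt 38 32) .skip (.ite (.nlt 32 38) .skip
      (.ite (.nlt 37 31) (.instr (.nadd 35 34 40))
        (.ite (.nlt 31 37) (.instr (.nadd 35 34 40)) .skip)))) .skip)))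

/-- Determine the left end of the edge in register `30`, if that is active and unique in its
bucket. -/
def peelEdgeP : Prog :=
  .seq (block [.nload 31 1 30, .nload 32 2 30, .nload 33 3 31, .nconst 34 0])
  (.ite (.nlt 34 33) (.seq conflictP (.ite (.nlt 34 35) .skip
    (.seq residP (block [.rload 4 3 32, .rstore 2 31 4, .nstore 3 31 34])))) .skip)

/-- Peel the set of positions that are at least as large as position `28` and offer the result. -/
def candidateP : Prog :=
  .seq (forP 23 6 (.seq (.instr (.rload 4 0 23)) (.seq (absP 4 6)
    (.seq (.ite (.rlt 4 7) (.instr (.nconst 24 0)) (.instr (.nconst 24 1)))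
      (block [.nstore 3 23 24, .rconst 5 0, .rstore 2 23 5])))))
  (.seq (forP 29 6 (forP 30 7 peelEdgeP)) offerP)

/-- Compare the current approximation with all peeled candidates. -/
def peelP : Prog :=
  .seq startP (.seq
    (forP 28 6 (.seq (.instr (.rload 7 0 28)) (.seq (absP 7 6) (.seq (.instr (.rconst 8 0))
      (.ite (.rlt 8 7) candidateP .skip)))))
    (copyP 6 4 0))

/-- The recovery of an approximation from the bucket values. -/
def recoverP : Prog :=
  .seq (forP 20 6 (block [.rconst 1 0, .rstore 0 20 1]))
  (.seq (forP 12 6 (.seq iterateP peelP)) iterateP)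

/-- The positions whose flag is set. -/
def active (N : ℕ) (f : ℕ → ℕ) : Finset ℕ := {i ∈ range N | 0 < f i}

/-- The left end of edge `e` is in `A`, and no other left vertex in `A` is adjacent to its right
end. -/
def Unique (E : ℕ) (src bkt : ℕ → ℕ) (A : Finset ℕ) (e : ℕ) : Prop :=
  src e ∈ A ∧ ∀ e' < E, bkt e' = bkt e → src e' ≠ src e → src e' ∉ A

/-! ### Correctness of the peeling and of the recovery -/

section

variable {O : ℕ → ℝ} {V N E B d k : ℕ} {src bkt : ℕ → ℕ} {y x : ℕ → ℝ} {S : Finset ℕ} {s : State}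

theorem mem_active {f : ℕ → ℕ} {i : ℕ} : i ∈ active N f ↔ i < N ∧ 0 < f i := by simp [active]

theorem conflictP_spec (hsrc : ∀ e < E, src e < N) (h : Ctx V N E B k src bkt y s) {e : ℕ}
    (h31 : s.nreg 31 = src e) (h32 : s.nreg 32 = bkt e) :
    Runs O V conflictP s fun s' => s'.nreg 34 = 0 ∧ (0 < s'.nreg 35 ↔
      ∃ e' < E, bkt e' = bkt e ∧ src e' ≠ src e ∧ src e' ∈ active N (s.narr 3)) := by
  refine Runs.block_seq fun s₁ hf₁ hs₁ => ?_
  have c₁ := h.frame hf₁ (by decide)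
  have h34 : s₁.nreg 34 = 0 := by rw [hs₁]; simp [applyAll, Instr.apply]
  have h40 : s₁.nreg 40 = 1 := by rw [hs₁]; simp [applyAll, Instr.apply]
  have h35 : s₁.nreg 35 = 0 := by rw [hs₁]; simp [applyAll, Instr.apply]
  have h31' : s₁.nreg 31 = src e := (hf₁.n 31 (by decide)).trans h31
  have h32' : s₁.nreg 32 = bkt e := (hf₁.n 32 (by decide)).trans h32
  have h3' : s₁.narr 3 = s.narr 3 := hf₁.na 3 (by decide)
  refine Runs.forP E (fun j s' => 0 < s'.nreg 35 ↔
      ∃ e' < j, bkt e' = bkt e ∧ src e' ≠ src e ∧ src e' ∈ active N (s.narr 3))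
    c₁.hE h.leE (by decide) (by simp [h35]) (fun j hj s₂ hf₂ hi hI => ?_)
    fun s₂ hf₂ hs₂ => ⟨(hf₂.n 34 (by decide)).trans h34, hs₂⟩
  have c₂ := c₁.frame hf₂ (by decide)
  have k31 := (hf₂.n 31 (by decide)).trans h31'
  have k32 := (hf₂.n 32 (by decide)).trans h32'
  have k34 := (hf₂.n 34 (by decide)).trans h34
  have k40 := (hf₂.n 40 (by decide)).trans h40
  have k3 := (hf₂.na 3 (by decide)).trans h3'
  have step : (∃ e' < j + 1, bkt e' = bkt e ∧ src e' ≠ src e ∧ src e' ∈ active N (s.narr 3)) ↔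
      (∃ e' < j, bkt e' = bkt e ∧ src e' ≠ src e ∧ src e' ∈ active N (s.narr 3)) ∨
        (bkt j = bkt e ∧ src j ≠ src e ∧ src j ∈ active N (s.narr 3)) := by
    constructor
    · rintro ⟨e', he', h⟩
      rcases Nat.lt_succ_iff_lt_or_eq.1 he' with he' | rfl
      · exact Or.inl ⟨e', he', h⟩
      · exact Or.inr h
    · rintro (⟨e', he', h⟩ | h)
      · exact ⟨e', by omega, h⟩
      · exact ⟨j, by omega, h⟩
  have hyes : (bkt j = bkt e ∧ src j ≠ src e ∧ src j ∈ active N (s.narr 3)) →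
      (0 < 1 ↔ ∃ e' < j + 1, bkt e' = bkt e ∧ src e' ≠ src e ∧ src e' ∈ active N (s.narr 3)) := by
    intro hp; rw [step]; exact ⟨fun _ => Or.inr hp, fun _ => Nat.one_pos⟩
  have hno : ¬ (bkt j = bkt e ∧ src j ≠ src e ∧ src j ∈ active N (s.narr 3)) → (0 < s₂.nreg 35 ↔
      ∃ e' < j + 1, bkt e' = bkt e ∧ src e' ≠ src e ∧ src e' ∈ active N (s.narr 3)) := by
    intro hp; rw [step, hI]; simp only [hp, or_false]
  refine Runs.block_seq ?_
  rintro _ - rfl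
  have hjN := hsrc j hj
  refine Runs.ite (fun g1 => Runs.ite (fun g2 => Runs.skip ?_) fun g2 =>
    Runs.ite (fun g3 => Runs.skip ?_) fun g3 => Runs.ite (fun g4 => Runs.instr ?_) fun g4 =>
    Runs.ite (fun g5 => Runs.instr ?_) fun g5 => Runs.skip ?_) fun g1 => Runs.skip ?_
  all_goals
    simp only [Test.Holds, applyAll, Instr.apply, State.setN_nreg, State.setN_narr, hi, c₂.hsrc,
      c₂.hbkt, k31, k32, k34, k40, k3, Nat.reduceEqDiff, if_true, if_false] at *
  · exact hno fun hp => by omega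
  · exact hno fun hp => by omega
  · exact hyes ⟨by omega, by omega, mem_active.2 ⟨hjN, g1⟩⟩
  · exact hyes ⟨by omega, by omega, mem_active.2 ⟨hjN, g1⟩⟩
  · exact hno fun hp => by omega
  · exact hno fun hp => g1 (mem_active.1 hp.2.2).2

theorem peelEdgeP_spec (hsrc : ∀ e < E, src e < N) (hbkt : ∀ e < E, bkt e < B)
    (h : Ctx V N E B k src bkt y s) {e : ℕ} (he : e < E) (h30 : s.nreg 30 = e) :
    Runs O V peelEdgeP s fun s' =>
      (Unique E src bkt (active N (s.narr 3)) e ∧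
        s'.narr 3 = Function.update (s.narr 3) (src e) 0 ∧
        s'.rarr 2 = Function.update (s.rarr 2) (src e) (resid E src bkt y (s.rarr 2) (bkt e))) ∨
      (¬ Unique E src bkt (active N (s.narr 3)) e ∧ s'.narr 3 = s.narr 3 ∧
        s'.rarr 2 = s.rarr 2) := by
  refine Runs.block_seq fun s₁ hf₁ hs₁ => ?_
  have c₁ := h.frame hf₁ (by decide)
  have h34 : s₁.nreg 34 = 0 := by rw [hs₁]; simp [applyAll, Instr.apply]
  have h31 : s₁.nreg 31 = src e := by rw [hs₁]; simp [applyAll, Instr.apply, h30, h.hsrc]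
  have h32 : s₁.nreg 32 = bkt e := by rw [hs₁]; simp [applyAll, Instr.apply, h30, h.hbkt]
  have h33 : s₁.nreg 33 = s.narr 3 (src e) := by
    rw [hs₁]; simp [applyAll, Instr.apply, h30, h.hsrc]
  have h3 : s₁.narr 3 = s.narr 3 := hf₁.na 3 (by decide)
  have h2 : s₁.rarr 2 = s.rarr 2 := hf₁.ra 2 (by decide)
  refine Runs.ite (fun g1 => ?_) fun g1 => Runs.skip ?_
  · simp only [Test.Holds, h34, h33] at g1
    refine Runs.seq (conflictP_spec hsrc c₁ h31 h32) fun s₂ hf₂ hs₂ => ?_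
    rw [h3] at hs₂
    have c₂ := c₁.frame hf₂ (by decide)
    have h3' : s₂.narr 3 = s.narr 3 := (hf₂.na 3 (by decide)).trans h3
    have h2' : s₂.rarr 2 = s.rarr 2 := (hf₂.ra 2 (by decide)).trans h2
    refine Runs.ite (fun g2 => Runs.skip ?_) fun g2 => ?_
    · simp only [Test.Holds, hs₂.1, hs₂.2] at g2
      obtain ⟨e', he', hb, hne, hact⟩ := g2
      exact Or.inr ⟨fun hu => hu.2 e' he' hb hne hact, h3', h2'⟩
    · simp only [Test.Holds, hs₂.1, hs₂.2] at g2
      refine Runs.seq (residP_spec c₂) fun s₃ hf₃ hs₃ => Runs.block (Or.inl ⟨⟨?_, ?_⟩, ?_, ?_⟩)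
      · exact mem_active.2 ⟨hsrc e he, g1⟩
      · exact fun e' he' hb hne hact => g2 ⟨e', he', hb, hne, hact⟩
      · have k31 : s₃.nreg 31 = src e :=
          (hf₃.n 31 (by decide)).trans ((hf₂.n 31 (by decide)).trans h31)
        have k34 : s₃.nreg 34 = 0 := (hf₃.n 34 (by decide)).trans hs₂.1
        have k3 : s₃.narr 3 = s.narr 3 := (hf₃.na 3 (by decide)).trans h3'
        simp [applyAll, Instr.apply, k31, k34, k3]
      · have k31 : s₃.nreg 31 = src e :=
          (hf₃.n 31 (by decide)).trans ((hf₂.n 31 (by decide)).trans h31)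
        have k32 : s₃.nreg 32 = bkt e :=
          (hf₃.n 32 (by decide)).trans ((hf₂.n 32 (by decide)).trans h32)
        have k2 : s₃.rarr 2 = s.rarr 2 := (hf₃.ra 2 (by decide)).trans h2'
        simp [applyAll, Instr.apply, k31, k32, k2, hs₃.1 _ (hbkt e he), h2']
  · simp only [Test.Holds, h34, h33] at g1
    exact Or.inr ⟨fun hu => g1 (mem_active.1 hu.1).2, h3, h2⟩

theorem active_update (f : ℕ → ℕ) (i : ℕ) :
    active N (Function.update f i 0) = (active N f).erase i := by
  ext j
  rw [mem_active, mem_erase, mem_active, Function.update_apply]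
  split_ifs with h
  · simp [h]
  · tauto

/-- A pass over all edges that peels nothing has left the active set unchanged throughout and has
found no edge with a unique active end. By expansion the active set is then empty, so every pass
makes progress until peeling is complete. -/
theorem peelPass_spec (G : Setting N E B d k src bkt y x S) (h : Ctx V N E B k src bkt y s)
    {A : Finset ℕ} (hA : A ⊆ range N) (hAk : #A ≤ k)
    (hp : Peeling N x A (active N (s.narr 3)) (s.rarr 2)) :
    Runs O V (forP 30 7 peelEdgeP) s fun s' => Peeling N x A (active N (s'.narr 3)) (s'.rarr 2) ∧
      (active N (s'.narr 3) = ∅ ∨ #(active N (s'.narr 3)) < #(active N (s.narr 3))) := by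
  refine Runs.forP E (fun j s' => Peeling N x A (active N (s'.narr 3)) (s'.rarr 2) ∧
      (#(active N (s'.narr 3)) < #(active N (s.narr 3)) ∨
        (s'.narr 3 = s.narr 3 ∧ ∀ e < j, ¬ Unique E src bkt (active N (s.narr 3)) e)))
    h.hE h.leE (by decide) (by simpa using hp) (fun j hj s₁ hf₁ hi hI => ?_) fun s₁ hf₁ hs₁ => ?_
  · refine Runs.mono (peelEdgeP_spec G.graph.src_lt G.graph.bkt_lt (h.frame hf₁ (by decide)) hj hi)
      fun s₂ hf₂ hs₂ => ?_
    simp only [State.setN_narr, State.setN_rarr]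
    rcases hs₂ with ⟨hu, h3, h2⟩ | ⟨hu, h3, h2⟩
    · rw [h3, h2, active_update]
      refine ⟨hI.1.step G.graph hA G.hy hj hu.1 hu.2, Or.inl ?_⟩
      have h4 := card_erase_lt_of_mem hu.1
      rcases hI.2 with h5 | ⟨h5, -⟩
      · omega
      · rw [h5] at h4 ⊢; exact h4
    · rw [h3, h2]
      -- An edge that fails now refutes uniqueness for the initial active set only if nothing has
      -- been peeled before; otherwise the first alternative already holds.
      refine ⟨hI.1, hI.2.imp_right fun h5 => ⟨h5.1, fun e he => ?_⟩⟩
      rcases Nat.lt_succ_iff_lt_or_eq.1 he with he | rfl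
      · exact h5.2 e he
      · rwa [h5.1] at hu
  · refine ⟨hs₁.1, ?_⟩
    rcases hs₁.2 with h5 | ⟨h5, h6⟩
    · exact Or.inr h5
    · left
      rw [h5]
      by_contra hne
      obtain ⟨e, he, hu⟩ := G.graph.exists_unique_edge G.hd G.expands (hp.sub.trans hA)
        ((card_le_card hp.sub).trans (hAk.trans (by omega))) (nonempty_iff_ne_empty.2 hne)
      exact h6 e he hu

/-- The active set loses an element in each pass, so `N` passes finish the peeling. The candidate
vanishes off the peeled set, which has at most `k` elements, so the best candidate stays `k`-sparse.
-/
theorem candidateP_spec (G : Setting N E B d k src bkt y x S) (h : Ctx V N E B k src bkt y s)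
    (hbest : s.rreg 3 = rho E B src bkt y (s.rarr 4)) (hk4 : #(supp N (s.rarr 4)) ≤ k)
    (hA : #{l ∈ range N | s.rreg 7 ≤ |s.rarr 0 l|} ≤ k) :
    Runs O V candidateP s fun s' => s'.rreg 3 = rho E B src bkt y (s'.rarr 4) ∧
      #(supp N (s'.rarr 4)) ≤ k ∧ s'.rreg 3 ≤ s.rreg 3 ∧ ∃ w,
        nrm N (x - w) ≤ 2 ^ #{l ∈ range N | s.rreg 7 ≤ |s.rarr 0 l|} *
          tail N x {l ∈ range N | s.rreg 7 ≤ |s.rarr 0 l|} ∧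
        s'.rreg 3 ≤ rho E B src bkt y w := by
  classical
  set A : Finset ℕ := {l ∈ range N | s.rreg 7 ≤ |s.rarr 0 l|} with hAdef
  have hAN : A ⊆ range N := filter_subset _ _
  refine Runs.seq (Runs.forP N (fun j s' => ∀ l < j, (0 < s'.narr 3 l ↔ s.rreg 7 ≤ |s.rarr 0 l|) ∧
      s'.rarr 2 l = 0) h.hN h.leN (by decide) (by simp) (fun j hj s₁ hf₁ hi hI => ?_)
      (Q := fun s' => ∀ l < N, (0 < s'.narr 3 l ↔ s.rreg 7 ≤ |s.rarr 0 l|) ∧ s'.rarr 2 l = 0)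
      fun _ _ h => h) fun s₁ hf₁ hs₁ => ?_
  · have e7 : s₁.rreg 7 = s.rreg 7 := hf₁.r 7 (by decide)
    have z₁ : s₁.rarr 0 = s.rarr 0 := hf₁.ra 0 (by decide)
    refine Runs.instr_seq ?_
    rintro _ - rfl
    refine Runs.abs_seq (by decide) ?_
    rintro _ - rfl
    refine Runs.seq (Runs.ite (Q := fun s' => (0 < s'.nreg 24 ↔ s.rreg 7 ≤ |s.rarr 0 j|) ∧
      s'.nreg 23 = j ∧ s'.narr 3 = s₁.narr 3 ∧ s'.rarr 2 = s₁.rarr 2) (fun g => Runs.instr ?_)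
      fun g => Runs.instr ?_) fun s₂ hf₂ hs₂ => Runs.block ?_
    · simp [Test.Holds, Instr.apply, hi, e7, z₁] at g
      simpa [Instr.apply, hi] using g
    · simp [Test.Holds, Instr.apply, hi, e7, z₁] at g
      simpa [Instr.apply, hi] using g
    · obtain ⟨h1, h2, h3, h4⟩ := hs₂
      intro l hl
      rcases Nat.lt_succ_iff_lt_or_eq.1 hl with hl' | rfl
      · simpa [applyAll, Instr.apply, h2, h3, h4, hl'.ne] using hI l hl'
      · simpa [applyAll, Instr.apply, h2] using h1
  have c₁ := h.frame hf₁ (by decide)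
  have hact : active N (s₁.narr 3) = A := by
    ext l
    rw [mem_active, hAdef, mem_filter, mem_range]
    exact and_congr_right fun hl => (hs₁ l hl).1
  have hinit : Peeling N x A (active N (s₁.narr 3)) (s₁.rarr 2) := by
    rw [hact]
    have := Peeling.init N x A
    refine ⟨Subset.rfl, fun i hi _ => (hs₁ i hi).2, fun i hi => (hs₁ i (mem_range.1 (hAN hi))).2, ?_⟩
    refine le_trans (le_of_eq ?_) this.err
    congr 1
    exact sum_congr rfl fun i hi => by
      simp [(hs₁ i (mem_range.1 (mem_sdiff.1 hi).1)).2]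
  refine Runs.seq (Runs.forP N (fun j s' => Peeling N x A (active N (s'.narr 3)) (s'.rarr 2) ∧
      (active N (s'.narr 3) = ∅ ∨ #(active N (s'.narr 3)) + j ≤ N)) c₁.hN h.leN (by decide) ?_
      (fun j hj s₂ hf₂ hi hI => ?_) (Q := fun s' => Peeling N x A ∅ (s'.rarr 2))
      fun s₂ hf₂ hs₂ => ?_) fun s₂ hf₂ hs₂ => ?_
  · refine ⟨hinit, Or.inr ?_⟩
    simpa [hact] using card_le_card hAN
  · refine Runs.mono (peelPass_spec G (c₁.frame hf₂ (by decide)) hAN hA hI.1) fun s₃ hf₃ hs₃ => ?_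
    refine ⟨hs₃.1, hs₃.2.imp_right fun h5 => ?_⟩
    simp only [State.setN_narr]
    rcases hI.2 with h6 | h6
    · rw [h6] at h5; simp at h5
    · omega
  · have : active N (s₂.narr 3) = ∅ := by
      rcases hs₂.2 with h5 | h5
      · exact h5
      · exact card_eq_zero.1 (by omega)
    rw [← this]; exact hs₂.1
  have c₂ := c₁.frame hf₂ (by decide)
  have e3 : s₂.rreg 3 = s.rreg 3 := (hf₂.r 3 (by decide)).trans (hf₁.r 3 (by decide))
  have e4 : s₂.rarr 4 = s.rarr 4 := (hf₂.ra 4 (by decide)).trans (hf₁.ra 4 (by decide))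
  refine Runs.mono (offerP_spec G.graph.src_lt c₂ (by rw [e3, e4]; exact hbest))
    fun s₃ hf₃ hs₃ => ?_
  obtain ⟨h1, h2, h3, h4⟩ := hs₃
  refine ⟨h1, ?_, by rw [e3] at h2; exact h2, s₂.rarr 2, hs₂.final, h3⟩
  rcases h4 with h4 | h4
  · rw [supp_congr h4, e4]; exact hk4
  · rw [supp_congr h4]
    refine (card_le_card fun i hi => ?_).trans hA
    rw [mem_supp] at hi
    by_contra hiA
    exact hi.2 (hs₂.off i hi.1 hiA)

/-- Only levels `|z q| > 0` are tried: their superlevel sets lie in the support of `z`, hence have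
at most `k` elements, and the expansion needed for peeling is available. -/
theorem peelP_spec (G : Setting N E B d k src bkt y x S) (h : Ctx V N E B k src bkt y s)
    (hk0 : #(supp N (s.rarr 0)) ≤ k) :
    Runs O V peelP s fun s' => #(supp N (s'.rarr 0)) ≤ k ∧
      rho E B src bkt y (s'.rarr 0) ≤ rho E B src bkt y (s.rarr 0) ∧
      ∀ q < N, 0 < |s.rarr 0 q| → ∃ w,
        nrm N (x - w) ≤ 2 ^ #{l ∈ range N | |s.rarr 0 q| ≤ |s.rarr 0 l|} *
          tail N x {l ∈ range N | |s.rarr 0 q| ≤ |s.rarr 0 l|} ∧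
        rho E B src bkt y (s'.rarr 0) ≤ rho E B src bkt y w := by
  set z := s.rarr 0 with hz
  have hsrc := G.graph.src_lt
  refine Runs.seq (startP_spec hsrc h) fun s₁ hf₁ hs₁ => ?_
  have c₁ := h.frame hf₁ (by decide)
  have z₁ : s₁.rarr 0 = z := hf₁.ra 0 (by decide)
  refine Runs.seq (Runs.forP N (fun j s' => s'.rreg 3 = rho E B src bkt y (s'.rarr 4) ∧
      #(supp N (s'.rarr 4)) ≤ k ∧ s'.rreg 3 ≤ rho E B src bkt y z ∧ ∀ q < j, 0 < |z q| → ∃ w,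
        nrm N (x - w) ≤ 2 ^ #{l ∈ range N | |z q| ≤ |z l|} *
          tail N x {l ∈ range N | |z q| ≤ |z l|} ∧
        s'.rreg 3 ≤ rho E B src bkt y w) c₁.hN h.leN (by decide) ?_
      (fun j hj s₂ hf₂ hi hI => ?_) (fun _ _ h => h)) fun s₂ hf₂ hs₂ => ?_
  · have e := rho_congr hsrc y hs₁.2.1 (B := B) (bkt := bkt)
    refine ⟨?_, ?_, ?_, by simp⟩
    · simp [hs₁.1, e]
    · simp only [State.setN_rarr]; rw [supp_congr hs₁.2.1]; exact hk0
    · simp [hs₁.1, hz]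
  · have c₂ := c₁.frame hf₂ (by decide)
    have z₂ : s₂.rarr 0 = z := (hf₂.ra 0 (by decide)).trans z₁
    refine Runs.instr_seq fun s₃ hf₃ hs₃ => Runs.abs_seq (by decide) fun s₄ hf₄ hs₄ =>
      Runs.instr_seq fun s₅ hf₅ hs₅ => ?_
    have c₅ := ((c₂.frame hf₃ (by decide)).frame hf₄ (by decide)).frame hf₅ (by decide)
    have e7 : s₅.rreg 7 = |z j| := by
      rw [hs₅, hs₄, hs₃]; simp [Instr.apply, hi, z₂]
    have e8 : s₅.rreg 8 = 0 := by rw [hs₅]; simp [Instr.apply]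
    have e0 : s₅.rarr 0 = z := by rw [hs₅, hs₄, hs₃]; simpa [Instr.apply] using z₂
    have e4 : s₅.rarr 4 = s₂.rarr 4 := by rw [hs₅, hs₄, hs₃]; simp [Instr.apply]
    have e3 : s₅.rreg 3 = s₂.rreg 3 := by rw [hs₅, hs₄, hs₃]; simp [Instr.apply]
    refine Runs.ite (fun g => ?_) fun g => Runs.skip ?_
    · simp only [Test.Holds, e7, e8] at g
      refine Runs.mono (candidateP_spec G c₅ (by rw [e3, e4]; exact hI.1) (by rw [e4]; exact hI.2.1)
        ?_) fun s₆ hf₆ hs₆ => ?_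
      · rw [e7, e0]
        refine (card_le_card fun l hl => ?_).trans hk0
        rw [mem_filter, mem_range] at hl
        exact mem_supp.2 ⟨hl.1, abs_pos.1 (g.trans_le hl.2)⟩
      · obtain ⟨h1, h2, h3, h4⟩ := hs₆
        rw [e3] at h3
        rw [e7, e0] at h4
        simp only [State.setN_rreg, State.setN_rarr]
        refine ⟨h1, h2, h3.trans hI.2.2.1, fun q hq hq0 => ?_⟩
        rcases Nat.lt_succ_iff_lt_or_eq.1 hq with hq | rfl
        · obtain ⟨w, hw1, hw2⟩ := hI.2.2.2 q hq hq0
          exact ⟨w, hw1, h3.trans hw2⟩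
        · exact h4
    · simp only [Test.Holds, e7, e8] at g
      simp only [State.setN_rreg, State.setN_rarr, e3, e4]
      refine ⟨hI.1, hI.2.1, hI.2.2.1, fun q hq hq0 => ?_⟩
      rcases Nat.lt_succ_iff_lt_or_eq.1 hq with hq | rfl
      · exact hI.2.2.2 q hq hq0
      · exact absurd hq0 g
  · have c₂ := c₁.frame hf₂ (by decide)
    refine Runs.mono (copyP_spec c₂.hN h.leN (by decide) (by decide)) fun s₃ hf₃ hs₃ => ?_
    obtain ⟨h1, h2, h3, h4⟩ := hs₂
    rw [rho_congr hsrc y hs₃, ← h1, supp_congr hs₃]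
    exact ⟨h2, h3, h4⟩

/-- Each round locates one more element of `S`, and `S` has at most `N` elements. The concluding
iteration turns the exponential factor of the invariant into the constant `26`. -/
theorem recoverP_spec (G : Setting N E B d k src bkt y x S) (h : Ctx V N E B k src bkt y s) :
    Runs O V recoverP s fun s' => nrm N (s'.rarr 0 - x) ≤ 26 * tail N x S := by
  refine Runs.seq (Runs.forP N (fun j s' => ∀ i < j, s'.rarr 0 i = 0) h.hN h.leN (by decide)
    (by simp) (fun j hj s₁ hf₁ hi hI => Runs.block fun i hij => ?_)
    (Q := fun s' => ∀ i < N, s'.rarr 0 i = 0) fun _ _ h => h) fun s₁ hf₁ hs₁ => ?_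
  · rcases Nat.lt_succ_iff_lt_or_eq.1 hij with hij | rfl
    · simpa [applyAll, Instr.apply, hi, hij.ne] using hI i hij
    · simp [applyAll, Instr.apply, hi]
  have c₁ := h.frame hf₁ (by decide)
  refine Runs.seq (Runs.forP N (fun j s' => #(supp N (s'.rarr 0)) ≤ k ∧
      ∃ A, min j #S ≤ #A ∧ Located N x S (s'.rarr 0) A) c₁.hN h.leN (by decide) ?_
      (fun j hj s₂ hf₂ hi hI => ?_) (fun _ _ h => h)) fun s₂ hf₂ hs₂ => ?_
  · simp only [State.setN_rarr]
    have h0 : supp N (s₁.rarr 0) = supp N 0 := supp_congr hs₁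
    have h1 := Located.init N x S
    refine ⟨by rw [h0]; simp [supp], ∅, by simp, h1.sub, h1.le, fun b hb hb' => ?_⟩
    refine le_trans (le_of_eq (nrm_congr fun i hi => ?_)) (h1.err b hb hb')
    simp [hs₁ i hi]
  · have c₂ := c₁.frame hf₂ (by decide)
    obtain ⟨hk0, A, hA, hL⟩ := hI
    refine Runs.seq (iterateP_spec G c₂ hk0) fun s₃ hf₃ hs₃ => ?_
    refine Runs.mono (peelP_spec G (c₂.frame hf₃ (by decide)) hs₃.1) fun s₄ hf₄ hs₄ => ?_
    simp only [State.setN_rarr]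
    obtain ⟨A', hA', hL'⟩ := hL.round G.graph G.hd G.hN G.expands G.sub G.card G.hy hs₃.2 hs₄.1
      hs₄.2.1 hs₄.2.2
    refine ⟨hs₄.1, A', ?_, hL'⟩
    omega
  · obtain ⟨hk0, A, hA, hL⟩ := hs₂
    refine Runs.mono (iterateP_spec G (c₁.frame hf₂ (by decide)) hk0) fun s₃ hf₃ hs₃ => ?_
    refine hL.final (by have := G.hN; omega) G.sub ?_ hs₃.2
    have := (card_le_card G.sub).trans (card_range N).le
    omega

end

/-! ### Binary digits -/

theorem sum_bits_lt (b : ℕ → ℕ) (hb : ∀ i, b i ≤ 1) (n : ℕ) :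
    ∑ i ∈ range n, b i * 2 ^ i < 2 ^ n := by
  induction n with
  | zero => simp
  | succ n ih =>
    rw [sum_range_succ, pow_succ]
    have : b n * 2 ^ n ≤ 1 * 2 ^ n := Nat.mul_le_mul_right _ (hb n)
    omega

theorem testBit_sum_bits (b : ℕ → ℕ) (hb : ∀ i, b i ≤ 1) {n j : ℕ} (hj : j < n) :
    (∑ i ∈ range n, b i * 2 ^ i).testBit j = decide (b j = 1) := by
  induction n with
  | zero => omega
  | succ n ih =>
    rw [sum_range_succ, add_comm, mul_comm, Nat.testBit_two_pow_mul_add _ (sum_bits_lt b hb n)]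
    split_ifs with h
    · exact ih h
    · have : j = n := by omega
      subst this
      have h1 := hb j
      rw [Nat.sub_self]
      interval_cases b j <;> simp

/-- The number whose binary digits are the entries of `v`. -/
def index {n : ℕ} (v : F2 n) : ℕ :=
  ∑ i ∈ range n, (if h : i < n then (v ⟨i, h⟩).val else 0) * 2 ^ i

theorem index_lt {n : ℕ} (v : F2 n) : index v < 2 ^ n := by
  refine sum_bits_lt _ (fun i => ?_) n
  split_ifs with h
  · exact Nat.lt_succ_iff.1 (ZMod.val_lt _)
  · omega

theorem position_sum_bits (b : ℕ → ℕ) (hb : ∀ i, b i ≤ 1) (n : ℕ) :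
    position n (∑ i ∈ range n, b i * 2 ^ i) = fun i : Fin n => (b i : ZMod 2) := by
  funext i
  rw [position, testBit_sum_bits b hb i.2]
  have := hb i
  interval_cases b i <;> simp

theorem position_index {n : ℕ} (v : F2 n) : position n (index v) = v := by
  rw [index, position_sum_bits]
  · funext i; simp
  · intro i; split_ifs with h
    · exact Nat.lt_succ_iff.1 (ZMod.val_lt _)
    · omega

theorem position_inj {n p q : ℕ} (hp : p < 2 ^ n) (hq : q < 2 ^ n)
    (h : position n p = position n q) : p = q := by
  refine Nat.eq_of_testBit_eq fun i => ?_
  rcases lt_or_ge i n with hi | hi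
  · have := congrFun h ⟨i, hi⟩
    simp only [position] at this
    cases hpi : p.testBit i <;> cases hqi : q.testBit i <;> simp_all
  · rw [Nat.testBit_lt_two_pow (hp.trans_le (Nat.pow_le_pow_right (by norm_num) hi)),
      Nat.testBit_lt_two_pow (hq.trans_le (Nat.pow_le_pow_right (by norm_num) hi))]

theorem index_position {n q : ℕ} (hq : q < 2 ^ n) : index (position n q) = q :=
  position_inj (index_lt _) hq (position_index _)

theorem index_injective {n : ℕ} : Function.Injective (index : F2 n → ℕ) := fun v w h => by
  rw [← position_index v, h, position_index]

theorem sum_position {n : ℕ} (f : F2 n → ℝ) : ∑ q ∈ range (2 ^ n), f (position n q) = ∑ v, f v :=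
  sum_nbij' (position n) index (fun _ _ => mem_univ _) (fun v _ => mem_range.2 (index_lt v))
    (fun _ hq => index_position (mem_range.1 hq)) (fun v _ => position_index v) fun _ _ => rfl

theorem position_two_pow {n i : ℕ} (hi : i < n) :
    position n (2 ^ i) = Pi.single (⟨i, hi⟩ : Fin n) 1 := by
  funext j
  rw [position, Nat.testBit_two_pow, Pi.single_apply]
  simp [Fin.ext_iff, eq_comm]

/-- The parity of the number of common binary digits among the `r` lowest ones. -/
def bitDot (r a b : ℕ) : ℕ :=
  (∑ i ∈ range r, if a.testBit i ∧ b.testBit i then 1 else 0) % 2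

theorem bitDot_le (r a b : ℕ) : bitDot r a b ≤ 1 := by
  rw [bitDot]; omega

theorem val_dotProduct_position (r a b : ℕ) :
    (position r a ⬝ᵥ position r b).val = bitDot r a b := by
  rw [bitDot, ← ZMod.val_natCast]
  congr 1
  rw [dotProduct, Nat.cast_sum, ← Fin.sum_univ_eq_sum_range
    (fun i => ((if a.testBit i ∧ b.testBit i then 1 else 0 : ℕ) : ZMod 2))]
  refine sum_congr rfl fun i _ => ?_
  simp only [position]
  cases a.testBit i <;> cases b.testBit i <;> simp

/-! ### Bucket sums from the Hadamard transform -/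

theorem neg_one_pow_val_add (u v : ZMod 2) :
    (-1 : ℝ) ^ (u + v).val = (-1) ^ u.val * (-1) ^ v.val := by
  rw [ZMod.val_add, ← neg_one_pow_eq_pow_mod_two, pow_add]

/-- Orthogonality of characters: if `c i = 1`, translating `a` by the `i`-th basis vector flips
every sign. -/
theorem sum_neg_one_pow_dotProduct {r : ℕ} (c : F2 r) :
    ∑ a : F2 r, (-1 : ℝ) ^ (a ⬝ᵥ c).val = if c = 0 then 2 ^ r else 0 := by
  split_ifs with hc
  · subst hc; simp
  · obtain ⟨i, hi⟩ := Function.ne_iff.1 hc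
    have hi1 : c i = 1 := (by decide : ∀ u : ZMod 2, u ≠ 0 → u = 1) _ hi
    have h1 : ∑ a : F2 r, (-1 : ℝ) ^ (a ⬝ᵥ c).val =
        ∑ a : F2 r, (-1 : ℝ) ^ ((a + Pi.single i 1) ⬝ᵥ c).val :=
      (Equiv.sum_comp (Equiv.addRight (Pi.single i (1 : ZMod 2))) fun a : F2 r =>
        (-1 : ℝ) ^ (a ⬝ᵥ c).val).symm
    have h2 : ∀ a : F2 r, (-1 : ℝ) ^ ((a + Pi.single i 1) ⬝ᵥ c).val = -(-1) ^ (a ⬝ᵥ c).val := by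
      intro a
      rw [add_dotProduct, neg_one_pow_val_add, single_dotProduct, hi1, one_mul, ZMod.val_one]
      ring
    rw [sum_congr rfl fun a _ => h2 a, sum_neg_distrib] at h1
    linarith

/-- The transpose of a linear map, applied to `a`. -/
def transposeApply {n r : ℕ} (φ : F2 n → F2 r) (a : F2 r) : F2 n :=
  fun i => a ⬝ᵥ φ (Pi.single i 1)

theorem transposeApply_dotProduct {n r : ℕ} {φ : F2 n → F2 r} (hφ : IsLinearMap (ZMod 2) φ)
    (a : F2 r) (j : F2 n) : transposeApply φ a ⬝ᵥ j = a ⬝ᵥ φ j := by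
  have h1 : φ j = ∑ i, j i • φ (Pi.single i 1) := by
    have h2 : j = ∑ i, j i • (Pi.single i 1 : F2 n) := by
      conv_lhs => rw [← Finset.univ_sum_single j]
      exact sum_congr rfl fun i _ => by rw [← Pi.single_smul, smul_eq_mul, mul_one]
    have h3 := congrArg (hφ.mk' φ) h2
    rw [map_sum] at h3
    rw [show φ j = hφ.mk' φ j from rfl, h3]
    exact sum_congr rfl fun i _ => by rw [map_smul]; rfl
  rw [h1, dotProduct_sum, dotProduct]
  refine sum_congr rfl fun i _ => ?_
  rw [dotProduct_smul, transposeApply, smul_eq_mul, mul_comm]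

/-- The indicator of `φ j = b` is the average over `a` of the characters of `b + φ j`. The character
`j ↦ (-1)^⟨a, φ j⟩` belongs to the transpose of `φ` applied to `a`, so its sum against `x` is a
value of the transform up to the factor `√N`. -/
theorem sum_fiber_eq_sum_DHT {n r : ℕ} {φ : F2 n → F2 r} (hφ : IsLinearMap (ZMod 2) φ)
    (x : F2 n → ℝ) (b : F2 r) :
    ∑ j, (if φ j = b then x j else 0) = Real.sqrt (2 ^ n) / 2 ^ r *
      ∑ a : F2 r, (-1 : ℝ) ^ (a ⬝ᵥ b).val * DHT x (transposeApply φ a) := by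
  have hN : Real.sqrt ((2 : ℝ) ^ n) ≠ 0 := (Real.sqrt_pos.2 (by positivity)).ne'
  have h1 : ∀ a : F2 r, (-1 : ℝ) ^ (a ⬝ᵥ b).val * DHT x (transposeApply φ a) =
      1 / Real.sqrt (2 ^ n) * ∑ j, (-1 : ℝ) ^ (a ⬝ᵥ (b + φ j)).val * x j := by
    intro a
    rw [DHT, mul_left_comm, mul_sum]
    congr 1
    refine sum_congr rfl fun j _ => ?_
    rw [transposeApply_dotProduct hφ, dotProduct_add, neg_one_pow_val_add, mul_assoc]
  rw [sum_congr rfl fun a _ => h1 a, ← mul_sum, sum_comm]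
  have h2 : ∀ j, ∑ a : F2 r, (-1 : ℝ) ^ (a ⬝ᵥ (b + φ j)).val * x j =
      2 ^ r * if φ j = b then x j else 0 := by
    intro j
    rw [← sum_mul, sum_neg_one_pow_dotProduct]
    -- In characteristic `2` the sum `b + φ j` is also the difference.
    have h3 : b + φ j = 0 ↔ φ j = b := by
      rw [add_eq_zero_iff_eq_neg, ZModModule.neg_eq_self, eq_comm]
    by_cases h : φ j = b
    · rw [if_pos (h3.2 h), if_pos h]
    · rw [if_neg (mt h3.1 h), if_neg h]; simp
  rw [sum_congr rfl fun j _ => h2 j, ← mul_sum]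
  field_simp

/-! ### The graph of a condenser -/

theorem mul_add_div_of_lt {t N j : ℕ} (hj : j < N) : (t * N + j) / N = t := by
  rw [mul_comm, Nat.mul_add_div (by omega), Nat.div_eq_of_lt hj, add_zero]

theorem mul_add_mod_of_lt' {t N j : ℕ} (hj : j < N) : (t * N + j) % N = j := by
  rw [mul_comm, Nat.mul_add_mod, Nat.mod_eq_of_lt hj]

theorem mul_add_lt_mul {t D N j : ℕ} (ht : t < D) (hj : j < N) : t * N + j < D * N := by
  calc t * N + j < (t + 1) * N := by rw [add_mul, one_mul]; omega
    _ ≤ D * N := Nat.mul_le_mul_right _ ht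

/-- The array `tab` tabulates `h`: its entry `t N + j` is the index of `h j t`. -/
def Tabulates {n D r : ℕ} (h : F2 n → Fin D → F2 r) (tab : ℕ → ℕ) : Prop :=
  ∀ t : Fin D, ∀ j < 2 ^ n, tab (t * 2 ^ n + j) = index (h (position n j) t)

section

variable {n D r : ℕ} {h : F2 n → Fin D → F2 r} {tab src bkt : ℕ → ℕ}

theorem Tabulates.lt (ht : Tabulates h tab) {e : ℕ} (he : e < D * 2 ^ n) : tab e < 2 ^ r := by
  have h1 := ht ⟨e / 2 ^ n, Nat.div_lt_of_lt_mul (by rwa [mul_comm])⟩ (e % 2 ^ n)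
    (Nat.mod_lt _ (by positivity))
  rw [Nat.div_add_mod'] at h1
  rw [h1]; exact index_lt _

/-- Edge `t N + j` joins `j` to the bucket of seed `t` and value `h(j, t)`. The seed is part of the
name of the bucket, so the `D` edges at `j` end in different buckets. -/
theorem Tabulates.graph (ht : Tabulates h tab) (hsrc : ∀ e < D * 2 ^ n, src e = e % 2 ^ n)
    (hbkt : ∀ e < D * 2 ^ n, bkt e = e / 2 ^ n * 2 ^ r + tab e) :
    Graph (2 ^ n) (D * 2 ^ n) (D * 2 ^ r) D src bkt where
  src_lt e he := by rw [hsrc e he]; exact Nat.mod_lt _ (by positivity)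
  bkt_lt e he := by
    rw [hbkt e he]
    exact mul_add_lt_mul (Nat.div_lt_of_lt_mul (by rwa [mul_comm])) (ht.lt he)
  deg i hi := by
    conv_rhs => rw [← card_range D]
    refine card_nbij' (· / 2 ^ n) (fun t => t * 2 ^ n + i) (fun e he => ?_) (fun t htD => ?_)
      (fun e he => ?_) fun t _ => mul_add_div_of_lt hi
    · obtain ⟨he1, -⟩ := mem_filter.1 (mem_coe.1 he)
      exact mem_coe.2 (mem_range.2 (Nat.div_lt_of_lt_mul (by rw [mul_comm]; exact mem_range.1 he1)))
    · have h1 := mul_add_lt_mul (mem_range.1 (mem_coe.1 htD)) hi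
      exact mem_coe.2 (mem_filter.2 ⟨mem_range.2 h1, by rw [hsrc _ h1]; exact mul_add_mod_of_lt' hi⟩)
    · obtain ⟨he1, he2⟩ := mem_filter.1 (mem_coe.1 he)
      rw [← he2, hsrc e (mem_range.1 he1)]; exact Nat.div_add_mod' _ _
  inj e he e' he' h1 h2 := by
    rw [hsrc e he, hsrc e' he'] at h1
    rw [hbkt e he, hbkt e' he'] at h2
    have h3 : e / 2 ^ n = e' / 2 ^ n := by
      have := congrArg (· / 2 ^ r) h2
      simpa only [mul_add_div_of_lt (ht.lt he), mul_add_div_of_lt (ht.lt he')] using this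
    rw [← Nat.div_add_mod' e (2 ^ n), ← Nat.div_add_mod' e' (2 ^ n), h1, h3]

/-- Numbering the pairs of a seed and a value by `t 2^r + index v` is injective, so the
neighbourhood of a set of positions is as large as its image under the condenser. -/
theorem Tabulates.expands [NeZero D] {k : ℕ} (ht : Tabulates h tab)
    (hh : IsLosslessCondenser (Real.logb 2 k) (1 / 10000000) h) (hk : 2 ≤ k)
    (hsrc : ∀ e < D * 2 ^ n, src e = e % 2 ^ n)
    (hbkt : ∀ e < D * 2 ^ n, bkt e = e / 2 ^ n * 2 ^ r + tab e) :
    Expands (2 ^ n) (D * 2 ^ n) D src bkt (130 * k) := by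
  classical
  intro A hA hAk
  have hinj : Set.InjOn (position n) A := fun p hp q hq hpq =>
    position_inj (mem_range.1 (hA hp)) (mem_range.1 (hA hq)) hpq
  have h1 := hh.expand hk (A.image (position n)) (by rwa [card_image_of_injOn hinj])
  rw [card_image_of_injOn hinj, ← mul_assoc] at h1
  refine h1.trans ?_
  have hcode : Function.Injective fun p : Fin D × F2 r => (p.1 : ℕ) * 2 ^ r + index p.2 := by
    rintro ⟨t, v⟩ ⟨t', v'⟩ hp
    simp only at hp
    have h2 := congrArg (· / 2 ^ r) hp
    have h3 := congrArg (· % 2 ^ r) hp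
    simp only [mul_add_div_of_lt (index_lt _), mul_add_mod_of_lt' (index_lt _)] at h2 h3
    rw [Prod.mk.injEq]
    exact ⟨Fin.ext h2, index_injective h3⟩
  rw [← card_image_of_injective _ hcode]
  exact_mod_cast card_le_card fun b hb => by
    obtain ⟨p, hp, rfl⟩ := mem_image.1 hb
    obtain ⟨⟨t, v⟩, hq, rfl⟩ := mem_image.1 hp
    obtain ⟨q, hqA, rfl⟩ := mem_image.1 (mem_product.1 hq).2
    have hqN := mem_range.1 (hA hqA)
    have he := mul_add_lt_mul t.2 hqN
    refine mem_image.2 ⟨t * 2 ^ n + q, mem_filter.2 ⟨mem_range.2 he, ?_⟩, ?_⟩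
    · rwa [hsrc _ he, mul_add_mod_of_lt' hqN]
    · rw [hbkt _ he, mul_add_div_of_lt hqN, ht t q hqN]

theorem Tabulates.bucketSum_eq (ht : Tabulates h tab) (hlin : IsLinearCondenser h)
    (hsrc : ∀ e < D * 2 ^ n, src e = e % 2 ^ n)
    (hbkt : ∀ e < D * 2 ^ n, bkt e = e / 2 ^ n * 2 ^ r + tab e) (x : F2 n → ℝ) (t : Fin D) {b : ℕ}
    (hb : b < 2 ^ r) :
    bucketSum (D * 2 ^ n) src bkt (fun q => x (position n q)) (t * 2 ^ r + b) =
      Real.sqrt (2 ^ n) / 2 ^ r * ∑ a ∈ range (2 ^ r),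
        (-1 : ℝ) ^ bitDot r a b * DHT x (transposeApply (fun v => h v t) (position r a)) := by
  have h1 := sum_fiber_eq_sum_DHT (hlin t) x (position r b)
  rw [← sum_position, ← sum_position] at h1
  simp only [val_dotProduct_position] at h1
  rw [← h1, bucketSum, ← sum_filter]
  refine sum_nbij' (· % 2 ^ n) (fun j => t * 2 ^ n + j) (fun e he => ?_) (fun j hj => ?_)
    (fun e he => ?_) (fun j hj => ?_) fun e he => ?_
  · obtain ⟨he1, he2⟩ := mem_filter.1 he
    have he1' := mem_range.1 he1
    have hmod : e % 2 ^ n < 2 ^ n := Nat.mod_lt _ (by positivity)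
    rw [hbkt e he1'] at he2
    have h2 := congrArg (· / 2 ^ r) he2
    have h3 := congrArg (· % 2 ^ r) he2
    simp only [mul_add_div_of_lt (ht.lt he1'), mul_add_mod_of_lt' (ht.lt he1'),
      mul_add_div_of_lt hb, mul_add_mod_of_lt' hb] at h2 h3
    refine mem_filter.2 ⟨mem_range.2 hmod, ?_⟩
    have h4 := ht t (e % 2 ^ n) hmod
    rw [← h2, Nat.div_add_mod', h3] at h4
    rw [h4, position_index]
  · obtain ⟨hj1, hj2⟩ := mem_filter.1 hj
    have hj1' := mem_range.1 hj1
    have he := mul_add_lt_mul t.2 hj1'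
    refine mem_filter.2 ⟨mem_range.2 he, ?_⟩
    rw [hbkt _ he, mul_add_div_of_lt hj1', ht t j hj1', hj2, index_position hb]
  · obtain ⟨he1, he2⟩ := mem_filter.1 he
    have he1' := mem_range.1 he1
    rw [hbkt e he1'] at he2
    have h2 := congrArg (· / 2 ^ r) he2
    simp only [mul_add_div_of_lt (ht.lt he1'), mul_add_div_of_lt hb] at h2
    rw [← h2]; exact Nat.div_add_mod' _ _
  · exact mul_add_mod_of_lt' (mem_range.1 (mem_filter.1 hj).1)
  · rw [hsrc e (mem_range.1 (mem_filter.1 he).1)]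

end

/-! ### The measurement programs

Integer registers `0` to `3` hold `n`, `k`, `D` and `r`, register `6` holds `N = 2 ^ n`, register
`14` holds `2 ^ r`, and integer array `0` tabulates the condenser. -/

/-- Multiply the contents of registers `a` and `b`, by repeated addition, into register `d`. -/
def mulP (d b a : ℕ) : Prog := .seq (.instr (.nconst d 0)) (forP 20 b (.instr (.nadd d d a)))

/-- Compute the number of edges, the number of buckets and the lengths of the main loops. -/
def paramsP : Prog :=
  .seq (mulP 7 2 6) (.seq (mulP 8 2 14) (block [.nadd 9 1 1, .nadd 9 9 9, .nadd 9 9 9, .nadd 9 9 9,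
    .nadd 9 9 9, .nadd 9 9 9, .nadd 9 9 9, .nadd 10 6 6, .nadd 10 10 10, .nadd 10 10 10,
    .nadd 10 10 10]))

/-- Write the edges of the graph. -/
def edgesP : Prog :=
  .seq (block [.nconst 21 0, .nconst 22 0]) (forP 23 2 (.seq
    (forP 24 6 (block [.nload 25 0 21, .nadd 25 25 22, .nstore 2 21 25, .nstore 1 21 24,
      .nconst 26 1, .nadd 21 21 26]))
    (.instr (.nadd 22 22 14))))

/-- The parity of the number of common digits of the contents of registers `24` and `31`. -/
def dotP : Prog :=
  .seq (block [.nconst 33 0, .nadd 34 24 33, .nadd 35 31 33, .nconst 32 0, .nconst 39 1])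
  (forP 36 3 (.seq (block [.nhalf 37 34, .nadd 38 37 37, .nsub 38 34 38, .nadd 34 37 33,
      .nhalf 37 35, .nadd 40 37 37, .nsub 40 35 40, .nadd 35 37 33])
    (.ite (.nlt 33 38) (.ite (.nlt 33 40) (.instr (.nsub 32 39 32)) .skip) .skip)))

/-- Compute the position of a query. -/
def queryPosP : Prog :=
  .seq (block [.nconst 27 0, .nconst 28 1]) (forP 29 0 (.seq (block [.nadd 30 21 28, .nload 31 0 30])
    (.seq dotP (.seq (.ite (.nlt 33 32) (.instr (.nadd 27 27 28)) .skip)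
      (.instr (.nadd 28 28 28))))))

/-- Query the transform. -/
def queriesP : Prog :=
  .seq (block [.nconst 21 0, .nconst 22 0]) (forP 23 2 (.seq
    (forP 24 14 (.seq queryPosP (block [.query 1 27, .rstore 6 22 1, .nconst 26 1, .nadd 22 22 26])))
    (.instr (.nadd 21 21 6))))

/-- Compute `√(2 ^ n) / 2 ^ r`. -/
def scaleP : Prog :=
  .seq (.instr (.rconst 8 1)) (.seq (forP 20 0 (.instr (.radd 8 8 8)))
  (.seq (block [.rsqrt 8 8, .rconst 9 1]) (.seq (forP 20 3 (.instr (.radd 9 9 9)))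
    (.instr (.rdiv 8 8 9)))))

/-- Compute the bucket values. -/
def bucketP : Prog :=
  .seq (.instr (.nconst 22 0)) (forP 23 2 (.seq
    (forP 31 14 (.seq (.instr (.rconst 1 0)) (.seq
      (forP 24 14 (.seq dotP (.seq (block [.nadd 41 22 24, .rload 2 6 41])
        (.ite (.nlt 33 32) (.instr (.rsub 1 1 2)) (.instr (.radd 1 1 2))))))
      (block [.rmul 1 1 8, .nadd 41 22 31, .rstore 1 41 1]))))
    (.instr (.nadd 22 22 14))))

/-- Build the graph, query the transform and compute the bucket values. -/
def measureP : Prog := .seq paramsP (.seq edgesP (.seq queriesP (.seq scaleP bucketP)))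

/-- The position of query number `c`. -/
def queryPos (n r : ℕ) (tab : ℕ → ℕ) (c : ℕ) : ℕ :=
  ∑ i ∈ range n, bitDot r (c % 2 ^ r) (tab (c / 2 ^ r * 2 ^ n + 2 ^ i)) * 2 ^ i

/-- The memory holds the parameters and the table of the condenser. -/
structure TabCtx (V n k D r : ℕ) (tab : ℕ → ℕ) (s : State) : Prop where
  hn : s.nreg 0 = n
  hk : s.nreg 1 = k
  hD : s.nreg 2 = D
  hr : s.nreg 3 = r
  hN : s.nreg 6 = 2 ^ n
  hR : s.nreg 14 = 2 ^ r
  htab : s.narr 0 = tab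
  lek : k ≤ 2 ^ n
  ler : r ≤ n
  leB : D * 2 ^ r ≤ 2 ^ n
  leV : 128 * (2 ^ n * 2 ^ n) ≤ V

/-- The program does not write the parameters and the table. -/
def keepsTab (p : Prog) : Bool :=
  !p.any (·.wN 0) && !p.any (·.wN 1) && !p.any (·.wN 2) && !p.any (·.wN 3) && !p.any (·.wN 6) &&
    !p.any (·.wN 14) && !p.any (·.wNA 0)

/-! ### Correctness of the measurement -/

section

variable {O : ℕ → ℝ} {V n k D r : ℕ} {tab : ℕ → ℕ} {s : State}

theorem TabCtx.frame {p : Prog} {s' : State} (h : TabCtx V n k D r tab s) (hf : Frame p s s')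
    (hp : keepsTab p = true) : TabCtx V n k D r tab s' := by
  simp only [keepsTab, Bool.and_eq_true, Bool.not_eq_true'] at hp
  obtain ⟨⟨⟨⟨⟨⟨h0, h1⟩, h2⟩, h3⟩, h6⟩, h14⟩, ha⟩ := hp
  exact ⟨(hf.n 0 h0).trans h.hn, (hf.n 1 h1).trans h.hk, (hf.n 2 h2).trans h.hD,
    (hf.n 3 h3).trans h.hr, (hf.n 6 h6).trans h.hN, (hf.n 14 h14).trans h.hR,
    (hf.na 0 ha).trans h.htab, h.lek, h.ler, h.leB, h.leV⟩

/-- All loop counts are covered by `128 N²`. The number of edges `D N` is at most `N²` because there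
are at most `N` buckets, whence `D ≤ N`. -/
theorem TabCtx.bounds (h : TabCtx V n k D r tab s) : n ≤ V ∧ r ≤ V ∧ D ≤ V ∧ 2 ^ r ≤ V ∧
    2 ^ n ≤ V ∧ D * 2 ^ n ≤ V ∧ D * 2 ^ r ≤ V ∧ 128 * k ≤ V ∧ 16 * 2 ^ n ≤ V := by
  have h1 : 1 ≤ 2 ^ n := Nat.one_le_two_pow
  have h2 : 1 ≤ 2 ^ r := Nat.one_le_two_pow
  have h3 : n < 2 ^ n := Nat.lt_two_pow_self
  have h4 : 2 ^ r ≤ 2 ^ n := Nat.pow_le_pow_right (by norm_num) h.ler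
  have h5 : 2 ^ n ≤ 2 ^ n * 2 ^ n := Nat.le_mul_of_pos_left _ h1
  have h6 : D ≤ 2 ^ n := (Nat.le_mul_of_pos_right _ h2).trans h.leB
  have h7 : D * 2 ^ n ≤ 2 ^ n * 2 ^ n := Nat.mul_le_mul_right _ h6
  have := h.leV
  have := h.ler
  have := h.lek
  have := h.leB
  refine ⟨?_, ?_, ?_, ?_, ?_, ?_, ?_, ?_, ?_⟩ <;> omega

theorem mulP_spec {d b a m m' : ℕ} (hb : s.nreg b = m) (hm : m ≤ V) (ha : s.nreg a = m')
    (hda : a ≠ d) (hbd : b ≠ d) (ha20 : a ≠ 20) (ha4 : a ≠ 4) (hd20 : d ≠ 20) (hd4 : d ≠ 4)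
    (hok : loopOK 20 b (.instr (.nadd d d a)) = true) :
    Runs O V (mulP d b a) s fun s' => s'.nreg d = m * m' := by
  refine Runs.instr_seq ?_
  rintro _ - rfl
  have hfa : (forP 20 b (.instr (.nadd d d a))).any (·.wN a) = false := by
    simp [forP, Prog.any, Instr.wN, hda.symm, ha20.symm, ha4.symm]
  refine Runs.forP m (fun j s' => s'.nreg d = j * m') (by simp [Instr.apply, hbd, hb]) hm hok
    (by simp [Instr.apply, hd20]) (fun j hj s₁ hf hi hI => Runs.instr ?_) fun _ _ h => h
  have h1 : s₁.nreg a = m' := by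
    rw [hf.n a hfa]; simp [Instr.apply, hda, ha]
  simp [Instr.apply, hd20, hd4, hI, h1, add_mul]

theorem paramsP_spec (h : TabCtx V n k D r tab s) : Runs O V paramsP s fun s' =>
    s'.nreg 7 = D * 2 ^ n ∧ s'.nreg 8 = D * 2 ^ r ∧ s'.nreg 9 = 128 * k ∧
      s'.nreg 10 = 16 * 2 ^ n := by
  have hb := h.bounds
  refine Runs.seq (mulP_spec h.hD hb.2.2.1 h.hN (by decide) (by decide) (by decide) (by decide)
    (by decide) (by decide) (by decide)) fun s₁ hf₁ hs₁ => ?_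
  have c₁ := h.frame hf₁ (by decide)
  refine Runs.seq (mulP_spec c₁.hD hb.2.2.1 c₁.hR (by decide) (by decide) (by decide) (by decide)
    (by decide) (by decide) (by decide)) fun s₂ hf₂ hs₂ => Runs.block ?_
  have c₂ := c₁.frame hf₂ (by decide)
  have h7 : s₂.nreg 7 = D * 2 ^ n := (hf₂.n 7 (by decide)).trans hs₁
  simp only [applyAll, Instr.apply, State.setN_nreg, Nat.reduceEqDiff, if_true, if_false, h7, hs₂,
    c₂.hk, c₂.hN]
  refine ⟨trivial, trivial, by omega, by omega⟩

theorem edgesP_spec (h : TabCtx V n k D r tab s) : Runs O V edgesP s fun s' =>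
    ∀ e < D * 2 ^ n, s'.narr 1 e = e % 2 ^ n ∧ s'.narr 2 e = e / 2 ^ n * 2 ^ r + tab e := by
  have hb := h.bounds
  refine Runs.block_seq ?_
  rintro s₁ hf₁ hs₁
  have c₁ := h.frame hf₁ (by decide)
  refine Runs.forP D (fun t s' => s'.nreg 21 = t * 2 ^ n ∧ s'.nreg 22 = t * 2 ^ r ∧
      ∀ e < t * 2 ^ n, s'.narr 1 e = e % 2 ^ n ∧ s'.narr 2 e = e / 2 ^ n * 2 ^ r + tab e)
    c₁.hD hb.2.2.1 (by decide) ?_ (fun t ht s₂ hf₂ hi hI => ?_) fun _ _ h => h.2.2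
  · rw [hs₁]; simp [applyAll, Instr.apply]
  have c₂ := c₁.frame hf₂ (by decide)
  refine Runs.seq (Runs.forP (2 ^ n) (fun j s' => s'.nreg 21 = t * 2 ^ n + j ∧
      ∀ e < t * 2 ^ n + j, s'.narr 1 e = e % 2 ^ n ∧ s'.narr 2 e = e / 2 ^ n * 2 ^ r + tab e)
    c₂.hN hb.2.2.2.2.1 (by decide) ?_ (fun j hj s₃ hf₃ hi₃ hI₃ => Runs.block ?_) fun _ _ h => h)
    fun s₃ hf₃ hs₃ => Runs.instr ?_
  · simpa using ⟨hI.1, hI.2.2⟩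
  · have c₃ := c₂.frame hf₃ (by decide)
    have h22 : s₃.nreg 22 = t * 2 ^ r := (hf₃.n 22 (by decide)).trans hI.2.1
    refine ⟨?_, fun e he => ?_⟩
    · simp [applyAll, Instr.apply, hI₃.1]; ring
    · rcases (by omega : e < t * 2 ^ n + j ∨ e = t * 2 ^ n + j) with he' | rfl
      · have := hI₃.2 e he'
        simpa [applyAll, Instr.apply, hI₃.1, he'.ne] using this
      · simpa [applyAll, Instr.apply, hI₃.1, h22, hi₃, c₃.htab, mul_add_div_of_lt hj,
          mul_add_mod_of_lt' hj] using add_comm _ _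
  · have c₃ := c₂.frame hf₃ (by decide)
    have h22 : s₃.nreg 22 = t * 2 ^ r := (hf₃.n 22 (by decide)).trans hI.2.1
    have e1 : (t + 1) * 2 ^ n = t * 2 ^ n + 2 ^ n := by ring
    have e2 : (t + 1) * 2 ^ r = t * 2 ^ r + 2 ^ r := by ring
    rw [e1, e2]
    simpa [Instr.apply, h22, c₃.hR, hs₃.1] using hs₃.2

theorem dotP_spec {a b : ℕ} (hr : s.nreg 3 = r) (hrV : r ≤ V) (ha : s.nreg 24 = a)
    (hb : s.nreg 31 = b) :
    Runs O V dotP s fun s' => s'.nreg 32 = bitDot r a b ∧ s'.nreg 33 = 0 := by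
  refine Runs.block_seq fun s₁ hf₁ hs₁ => ?_
  refine Runs.forP r (fun j s' => s'.nreg 32 = bitDot j a b ∧ s'.nreg 33 = 0 ∧ s'.nreg 39 = 1 ∧
      s'.nreg 34 = a / 2 ^ j ∧ s'.nreg 35 = b / 2 ^ j) ((hf₁.n 3 (by decide)).trans hr) hrV (by decide) ?_
      (fun j hj s₂ hf₂ hi hI => ?_) fun _ _ h => ⟨h.1, h.2.1⟩
  · rw [hs₁]; simp [applyAll, Instr.apply, ha, hb, bitDot]
  obtain ⟨h32, h33, h39, h34, h35⟩ := hI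
  refine Runs.block_seq ?_
  rintro _ - rfl
  -- The machine has no remainder operation; the lowest digit is `x` minus twice its half.
  have half : ∀ x : ℕ, x - (x / 2 + x / 2) = x % 2 := fun x => by omega
  have hd : ∀ x, x / 2 ^ (j + 1) = x / 2 ^ j / 2 := fun x => by
    rw [pow_succ, Nat.div_div_eq_div_mul]
  have hsucc : bitDot (j + 1) a b =
      (bitDot j a b + if a / 2 ^ j % 2 = 1 ∧ b / 2 ^ j % 2 = 1 then 1 else 0) % 2 := by
    rw [bitDot, sum_range_succ, bitDot]
    simp only [Nat.testBit_eq_decide_div_mod_eq, decide_eq_true_eq]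
    omega
  have hle := bitDot_le j a b
  refine Runs.ite (fun g1 => Runs.ite (fun g2 => Runs.instr ?_) fun g2 => Runs.skip ?_)
    fun g1 => Runs.skip ?_
  all_goals
    simp only [Test.Holds, applyAll, Instr.apply, State.setN_nreg, h32, h33, h34, h35, h39,
      Nat.reduceEqDiff, if_true, if_false, half, hd, add_zero, and_self, and_true, hsucc] at *
    split_ifs <;> omega

/-- Digit `i` of the position is the pairing of `a` with `h(eᵢ, t)`. The basis vector `eᵢ` has index
`2^i`, so its value is found in cell `t N + 2^i` of the table. -/
theorem queryPosP_spec (h : TabCtx V n k D r tab s) {t a : ℕ} (ha : a < 2 ^ r)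
    (h24 : s.nreg 24 = a) (h21 : s.nreg 21 = t * 2 ^ n) :
    Runs O V queryPosP s fun s' => s'.nreg 27 = queryPos n r tab (t * 2 ^ r + a) := by
  have hb := h.bounds
  refine Runs.block_seq fun s₁ hf₁ hs₁ => ?_
  have c₁ := h.frame hf₁ (by decide)
  refine Runs.forP n (fun i s' => s'.nreg 27 =
      ∑ i ∈ range i, bitDot r a (tab (t * 2 ^ n + 2 ^ i)) * 2 ^ i ∧ s'.nreg 28 = 2 ^ i)
      c₁.hn hb.1 (by decide) ?_ (fun i hi s₂ hf₂ hi₂ hI => ?_) fun s₂ hf₂ hs₂ => ?_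
  · rw [hs₁]; simp [applyAll, Instr.apply]
  · have c₂ := c₁.frame hf₂ (by decide)
    have h24' : s₂.nreg 24 = a :=
      (hf₂.n 24 (by decide)).trans ((hf₁.n 24 (by decide)).trans h24)
    have h21' : s₂.nreg 21 = t * 2 ^ n :=
      (hf₂.n 21 (by decide)).trans ((hf₁.n 21 (by decide)).trans h21)
    refine Runs.block_seq fun s₃ hf₃ hs₃ => ?_
    have c₃ := c₂.frame hf₃ (by decide)
    refine Runs.seq (dotP_spec c₃.hr hb.2.1 ((hf₃.n 24 (by decide)).trans h24')
      (b := tab (t * 2 ^ n + 2 ^ i)) ?_) fun s₄ hf₄ hs₄ => ?_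
    · rw [hs₃]; simp [applyAll, Instr.apply, h21', hI.2, c₂.htab]
    have h27 : s₄.nreg 27 = s₂.nreg 27 := (hf₄.n 27 (by decide)).trans (hf₃.n 27 (by decide))
    have h28 : s₄.nreg 28 = s₂.nreg 28 := (hf₄.n 28 (by decide)).trans (hf₃.n 28 (by decide))
    have hle := bitDot_le r a (tab (t * 2 ^ n + 2 ^ i))
    refine Runs.seq (Runs.ite (Q := fun s' => s'.nreg 27 =
      ∑ i ∈ range (i + 1), bitDot r a (tab (t * 2 ^ n + 2 ^ i)) * 2 ^ i ∧ s'.nreg 28 = 2 ^ i)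
      (fun g => Runs.instr ?_) fun g => Runs.skip ?_) fun s₅ hf₅ hs₅ => Runs.instr ?_
    · simp only [Test.Holds, hs₄] at g
      rw [sum_range_succ, (by omega : bitDot r a (tab (t * 2 ^ n + 2 ^ i)) = 1)]
      simp [Instr.apply, h27, h28, hI]
    · simp only [Test.Holds, hs₄] at g
      rw [sum_range_succ, (by omega : bitDot r a (tab (t * 2 ^ n + 2 ^ i)) = 0)]
      simp [h27, h28, hI]
    · simp [Instr.apply, hs₅]; ring
  · rw [hs₂.1, queryPos, mul_add_div_of_lt ha, mul_add_mod_of_lt' ha]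

theorem queriesP_spec (h : TabCtx V n k D r tab s) : Runs O V queriesP s fun s' =>
    s'.queries = s.queries ++ (List.range (D * 2 ^ r)).map (queryPos n r tab) ∧
      ∀ c < D * 2 ^ r, s'.rarr 6 c = O (queryPos n r tab c) := by
  have hb := h.bounds
  refine Runs.block_seq fun s₁ hf₁ hs₁ => ?_
  have c₁ := h.frame hf₁ (by decide)
  refine Runs.forP D (fun t s' => s'.nreg 21 = t * 2 ^ n ∧ s'.nreg 22 = t * 2 ^ r ∧
      s'.queries = s.queries ++ (List.range (t * 2 ^ r)).map (queryPos n r tab) ∧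
      ∀ c < t * 2 ^ r, s'.rarr 6 c = O (queryPos n r tab c))
    c₁.hD hb.2.2.1 (by decide) ?_ (fun t ht s₂ hf₂ hi hI => ?_) fun _ _ h => h.2.2
  · rw [hs₁]; simp [applyAll, Instr.apply]
  have c₂ := c₁.frame hf₂ (by decide)
  refine Runs.seq (Runs.forP (2 ^ r) (fun a s' => s'.nreg 22 = t * 2 ^ r + a ∧
      s'.queries = s.queries ++ (List.range (t * 2 ^ r + a)).map (queryPos n r tab) ∧
      ∀ c < t * 2 ^ r + a, s'.rarr 6 c = O (queryPos n r tab c))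
    c₂.hR hb.2.2.2.1 (by decide) ?_ (fun a ha s₃ hf₃ hi₃ hI₃ => ?_) fun _ _ h => h)
    fun s₃ hf₃ hs₃ => Runs.instr ?_
  · simpa using hI.2
  · have c₃ := c₂.frame hf₃ (by decide)
    have h21 : s₃.nreg 21 = t * 2 ^ n := (hf₃.n 21 (by decide)).trans hI.1
    refine Runs.seq (queryPosP_spec c₃ ha hi₃ h21) fun s₄ hf₄ hs₄ => Runs.block ?_
    have h22 : s₄.nreg 22 = t * 2 ^ r + a := (hf₄.n 22 (by decide)).trans hI₃.1
    have hq : s₄.queries = s₃.queries := hf₄.q (by decide)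
    have h6 : s₄.rarr 6 = s₃.rarr 6 := hf₄.ra 6 (by decide)
    refine ⟨?_, ?_, fun c hc => ?_⟩
    · simp [applyAll, Instr.apply, h22]; ring
    · rw [← add_assoc, List.range_succ, List.map_append, ← List.append_assoc, ← hI₃.2.1]
      simp [applyAll, Instr.apply, hs₄, hq]
    · rcases (by omega : c < t * 2 ^ r + a ∨ c = t * 2 ^ r + a) with hc' | rfl
      · have := hI₃.2.2 c hc'
        simpa [applyAll, Instr.apply, h22, hc'.ne, h6] using this
      · simp [applyAll, Instr.apply, h22, hs₄]
  · have c₃ := c₂.frame hf₃ (by decide)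
    have h21 : s₃.nreg 21 = t * 2 ^ n := (hf₃.n 21 (by decide)).trans hI.1
    have e1 : (t + 1) * 2 ^ n = t * 2 ^ n + 2 ^ n := by ring
    have e2 : (t + 1) * 2 ^ r = t * 2 ^ r + 2 ^ r := by ring
    rw [e1, e2]
    simpa [Instr.apply, h21, c₃.hN] using hs₃

theorem scaleP_spec (h : TabCtx V n k D r tab s) :
    Runs O V scaleP s fun s' => s'.rreg 8 = Real.sqrt (2 ^ n) / 2 ^ r := by
  have hb := h.bounds
  refine Runs.instr_seq fun s₁ hf₁ hs₁ => ?_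
  have c₁ := h.frame hf₁ (by decide)
  refine Runs.seq (Runs.forP n (fun j s' => s'.rreg 8 = 2 ^ j) c₁.hn hb.1 (by decide)
    (by rw [hs₁]; simp [Instr.apply]) (fun j hj s₂ hf₂ hi hI => Runs.instr ?_) fun _ _ h => h)
    fun s₂ hf₂ hs₂ => Runs.block_seq fun s₃ hf₃ hs₃ => ?_
  · simp [Instr.apply, hI]; ring
  have c₃ := (c₁.frame hf₂ (by decide)).frame hf₃ (by decide)
  refine Runs.seq (Runs.forP r (fun j s' => s'.rreg 9 = 2 ^ j) c₃.hr hb.2.1 (by decide)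
    (by rw [hs₃]; simp [applyAll, Instr.apply]) (fun j hj s₂ hf₂ hi hI => Runs.instr ?_)
    fun _ _ h => h) fun s₄ hf₄ hs₄ => Runs.instr ?_
  · simp [Instr.apply, hI]; ring
  · have h8 : s₄.rreg 8 = Real.sqrt (2 ^ n) := by
      rw [hf₄.r 8 (by decide), hs₃]; simp [applyAll, Instr.apply, hs₂]
    simp [Instr.apply, h8, hs₄]

theorem bucketP_spec (h : TabCtx V n k D r tab s) : Runs O V bucketP s fun s' =>
    ∀ t < D, ∀ b < 2 ^ r, s'.rarr 1 (t * 2 ^ r + b) = s.rreg 8 *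
      ∑ a ∈ range (2 ^ r), (-1 : ℝ) ^ bitDot r a b * s.rarr 6 (t * 2 ^ r + a) := by
  have hb := h.bounds
  refine Runs.instr_seq fun s₁ hf₁ hs₁ => ?_
  have c₁ := h.frame hf₁ (by decide)
  -- This is the inversion formula for fibre sums, with the scale factor read from register `8`.
  let val : ℕ → ℕ → ℝ := fun t b => s.rreg 8 *
      ∑ a ∈ range (2 ^ r), (-1 : ℝ) ^ bitDot r a b * s.rarr 6 (t * 2 ^ r + a)
  refine Runs.forP D (fun t s' => s'.nreg 22 = t * 2 ^ r ∧
      ∀ t' < t, ∀ b < 2 ^ r, s'.rarr 1 (t' * 2 ^ r + b) = val t' b)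
    c₁.hD hb.2.2.1 (by decide) ?_ (fun t ht s₂ hf₂ hi hI => ?_) fun _ _ h => h.2
  · rw [hs₁]; simp [Instr.apply]
  have c₂ := c₁.frame hf₂ (by decide)
  refine Runs.seq (Runs.forP (2 ^ r) (fun b s' =>
      (∀ t' < t, ∀ b < 2 ^ r, s'.rarr 1 (t' * 2 ^ r + b) = val t' b) ∧
      ∀ b' < b, s'.rarr 1 (t * 2 ^ r + b') = val t b')
    c₂.hR hb.2.2.2.1 (by decide) ?_ (fun b hbR s₃ hf₃ hi₃ hI₃ => ?_) fun _ _ h => h)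
    fun s₃ hf₃ hs₃ => Runs.instr ?_
  · simpa using hI.2
  · refine Runs.instr_seq fun s₄ hf₄ hs₄ => ?_
    have c₄ := (c₂.frame hf₃ (by decide)).frame hf₄ (by decide)
    have r6 : s₄.rarr 6 = s.rarr 6 := (hf₄.ra 6 (by decide)).trans ((hf₃.ra 6 (by decide)).trans
      ((hf₂.ra 6 (by decide)).trans (hf₁.ra 6 (by decide))))
    have h22 : s₄.nreg 22 = t * 2 ^ r :=
      (hf₄.n 22 (by decide)).trans ((hf₃.n 22 (by decide)).trans hI.1)
    have h31 : s₄.nreg 31 = b := (hf₄.n 31 (by decide)).trans hi₃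
    have h8 : s₄.rreg 8 = s.rreg 8 := (hf₄.r 8 (by decide)).trans ((hf₃.r 8 (by decide)).trans
      ((hf₂.r 8 (by decide)).trans (hf₁.r 8 (by decide))))
    refine Runs.seq (Runs.forP (2 ^ r) (fun a s' => s'.rreg 1 =
        ∑ a ∈ range a, (-1 : ℝ) ^ bitDot r a b * s.rarr 6 (t * 2 ^ r + a))
      c₄.hR hb.2.2.2.1 (by decide) (by rw [hs₄]; simp [Instr.apply])
      (fun a ha s₅ hf₅ hi₅ hI₅ => ?_) fun _ _ h => h) fun s₅ hf₅ hs₅ => Runs.block ?_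
    · have c₅ := c₄.frame hf₅ (by decide)
      refine Runs.seq (dotP_spec c₅.hr hb.2.1 hi₅ ((hf₅.n 31 (by decide)).trans h31))
        fun s₆ hf₆ hs₆ => Runs.block_seq ?_
      rintro _ - rfl
      have k22 : s₆.nreg 22 = t * 2 ^ r :=
        (hf₆.n 22 (by decide)).trans ((hf₅.n 22 (by decide)).trans h22)
      have k24 : s₆.nreg 24 = a := (hf₆.n 24 (by decide)).trans hi₅
      have k6 : s₆.rarr 6 = s.rarr 6 :=
        (hf₆.ra 6 (by decide)).trans ((hf₅.ra 6 (by decide)).trans r6)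
      have k1 : s₆.rreg 1 = s₅.rreg 1 := hf₆.r 1 (by decide)
      have hle := bitDot_le r a b
      rw [sum_range_succ, ← hI₅, ← k1]
      refine Runs.ite (fun g => Runs.instr ?_) fun g => Runs.instr ?_
      · simp [Test.Holds, applyAll, Instr.apply, hs₆] at g
        rw [(by omega : bitDot r a b = 1)]
        simp [applyAll, Instr.apply, k22, k24, k6]; ring
      · simp [Test.Holds, applyAll, Instr.apply, hs₆] at g
        rw [g]
        simp [applyAll, Instr.apply, k22, k24, k6]
    · have k22 : s₅.nreg 22 = t * 2 ^ r := (hf₅.n 22 (by decide)).trans h22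
      have k31 : s₅.nreg 31 = b := (hf₅.n 31 (by decide)).trans h31
      have k8 : s₅.rreg 8 = s.rreg 8 := (hf₅.r 8 (by decide)).trans h8
      have k1 : s₅.rarr 1 = s₃.rarr 1 := (hf₅.ra 1 (by decide)).trans (hf₄.ra 1 (by decide))
      refine ⟨fun t' ht' b' hb' => ?_, fun b' hb' => ?_⟩
      · have hne : t' * 2 ^ r + b' ≠ t * 2 ^ r + b := fun he => by
          have := congrArg (· / 2 ^ r) he
          simp only [mul_add_div_of_lt hb', mul_add_div_of_lt hbR] at this
          omega
        simpa [applyAll, Instr.apply, k22, k31, hne, k1] using hI₃.1 t' ht' b' hb'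
      · rcases Nat.lt_succ_iff_lt_or_eq.1 hb' with hb' | rfl
        · simpa [applyAll, Instr.apply, k22, k31, hb'.ne, k1] using hI₃.2 b' hb'
        · simp [applyAll, Instr.apply, k22, k31, k8, hs₅, val, mul_comm]
  · have c₃ := c₂.frame hf₃ (by decide)
    have h22 : s₃.nreg 22 = t * 2 ^ r := (hf₃.n 22 (by decide)).trans hI.1
    refine ⟨by simp [Instr.apply, h22, c₃.hR]; ring, fun t' ht' b hb' => ?_⟩
    simp only [Instr.apply, State.setN_rarr]
    rcases Nat.lt_succ_iff_lt_or_eq.1 ht' with ht' | rfl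
    · exact hs₃.1 t' ht' b hb'
    · exact hs₃.2 b hb'

theorem measureP_spec (h : TabCtx V n k D r tab s) : Runs O V measureP s fun s' =>
    Ctx V (2 ^ n) (D * 2 ^ n) (D * 2 ^ r) k (s'.narr 1) (s'.narr 2) (s'.rarr 1) s' ∧
    s'.queries = s.queries ++ (List.range (D * 2 ^ r)).map (queryPos n r tab) ∧
    (∀ e < D * 2 ^ n, s'.narr 1 e = e % 2 ^ n ∧ s'.narr 2 e = e / 2 ^ n * 2 ^ r + tab e) ∧
    ∀ t < D, ∀ b < 2 ^ r, s'.rarr 1 (t * 2 ^ r + b) = Real.sqrt (2 ^ n) / 2 ^ r *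
      ∑ a ∈ range (2 ^ r), (-1 : ℝ) ^ bitDot r a b * O (queryPos n r tab (t * 2 ^ r + a)) := by
  have hb := h.bounds
  refine Runs.seq (paramsP_spec h) fun s₁ hf₁ hs₁ => ?_
  have c₁ := h.frame hf₁ (by decide)
  refine Runs.seq (edgesP_spec c₁) fun s₂ hf₂ hs₂ => ?_
  have c₂ := c₁.frame hf₂ (by decide)
  refine Runs.seq (queriesP_spec c₂) fun s₃ hf₃ hs₃ => ?_
  have c₃ := c₂.frame hf₃ (by decide)
  refine Runs.seq (scaleP_spec c₃) fun s₄ hf₄ hs₄ => ?_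
  have c₄ := c₃.frame hf₄ (by decide)
  refine Runs.mono (bucketP_spec c₄) fun s₅ hf₅ hs₅ => ?_
  have c₅ := c₄.frame hf₅ (by decide)
  have q : s₅.queries = s₃.queries := (hf₅.q (by decide)).trans (hf₄.q (by decide))
  have q' : s₂.queries = s.queries := (hf₂.q (by decide)).trans (hf₁.q (by decide))
  have a1 : s₅.narr 1 = s₂.narr 1 := (hf₅.na 1 (by decide)).trans
    ((hf₄.na 1 (by decide)).trans (hf₃.na 1 (by decide)))
  have a2 : s₅.narr 2 = s₂.narr 2 := (hf₅.na 2 (by decide)).trans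
    ((hf₄.na 2 (by decide)).trans (hf₃.na 2 (by decide)))
  have keep : ∀ i ∈ [7, 8, 9, 10], s₅.nreg i = s₁.nreg i := by
    intro i hi
    fin_cases hi <;>
      exact (hf₅.n _ (by decide)).trans ((hf₄.n _ (by decide)).trans
        ((hf₃.n _ (by decide)).trans (hf₂.n _ (by decide))))
  refine ⟨⟨c₅.hk, c₅.hN, ?_, ?_, ?_, ?_, rfl, rfl, rfl, hb.2.2.2.2.1, hb.2.2.2.2.2.1,
    hb.2.2.2.2.2.2.1, hb.2.2.2.2.2.2.2.1, hb.2.2.2.2.2.2.2.2⟩, ?_, ?_, ?_⟩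
  · rw [keep 7 (by simp)]; exact hs₁.1
  · rw [keep 8 (by simp)]; exact hs₁.2.1
  · rw [keep 9 (by simp)]; exact hs₁.2.2.1
  · rw [keep 10 (by simp)]; exact hs₁.2.2.2
  · rw [q, hs₃.1, q']
  · rw [a1, a2]; exact hs₂
  · intro t ht b hb'
    rw [hs₅ t ht b hb', hs₄]
    congr 1
    refine sum_congr rfl fun a ha => ?_
    rw [hf₄.ra 6 (by decide), hs₃.2 _ (mul_add_lt_mul ht (mem_range.1 ha))]

end

/-! ### Simulation of a multi-stack Turing machine

Stack `κ` is kept in an integer array, bottom first, and its height in an integer register. Register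
`42` holds the code of the label and the internal state. -/

theorem Prog.any_mono {f g : Instr → Bool} (hfg : ∀ i, f i = true → g i = true) {p : Prog}
    (hp : p.any g = false) : p.any f = false := by
  induction p with
  | skip => rfl
  | instr i =>
    rw [Prog.any] at hp ⊢
    cases h : f i
    · rfl
    · rw [hfg i h] at hp; exact hp
  | seq p q ihp ihq =>
    simp only [Prog.any, Bool.or_eq_false_iff] at hp ⊢; exact ⟨ihp hp.1, ihq hp.2⟩
  | ite b p q ihp ihq =>
    simp only [Prog.any, Bool.or_eq_false_iff] at hp ⊢; exact ⟨ihp hp.1, ihq hp.2⟩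
  | _ b p ih => exact ih hp

theorem any_block {f : Instr → Bool} {l : List Instr} : (block l).any f = l.any f := by
  induction l with
  | nil => rfl
  | cons i l ih => simp [block, Prog.any, ih]

/-- The place of `x` in the list `l`. -/
noncomputable def code {α : Type*} (l : List α) (x : α) : ℕ := by
  classical exact l.idxOf x

theorem code_lt {α : Type*} {l : List α} {x : α} (h : x ∈ l) : code l x < l.length := by
  classical exact List.idxOf_lt_length_iff.2 h

theorem getElem_code {α : Type*} {l : List α} {x : α} (h : x ∈ l) : l[code l x]'(code_lt h) = x := by
  classical exact List.getElem_idxOf (code_lt h)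

/-- Run the program that belongs to the entry of `l` whose place, counted from `i`, is in
register `a`. -/
def switch {α : Type*} (a : ℕ) (F : α → Prog) : ℕ → List α → Prog
  | _, [] => .skip
  | i, x :: l => .seq (.instr (.nconst 44 (i + 1))) (.ite (.nlt a 44) (F x) (switch a F (i + 1) l))

theorem any_switch {α : Type*} {a : ℕ} {F : α → Prog} {f : Instr → Bool}
    (hF : ∀ x, (F x).any f = false) (hf : ∀ c, f (.nconst 44 c) = false) (i : ℕ) (l : List α) :
    (switch a F i l).any f = false := by
  induction l generalizing i with
  | nil => rfl
  | cons x l ih => simp [switch, Prog.any, hF, hf, ih]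

section

variable {O : ℕ → ℝ} {V : ℕ} {s : State} {Q : State → Prop}

/-- Each comparison overwrites register `44`, so the induction runs over all contents of that
register, and the branch must be correct for each of them. -/
theorem Runs.switch_add {α : Type*} {a : ℕ} {F : α → Prog} {l : List α} {i m : ℕ} (ha : a ≠ 44)
    (hm : m < l.length) (hs : s.nreg a = i + m)
    (h : ∀ v, Runs O V (F l[m]) (s.setN 44 v) Q) : Runs O V (switch a F i l) s Q := by
  suffices H : ∀ v, Runs O V (SparseHadamard.switch a F i l) (s.setN 44 v) Q by
    have := H (s.nreg 44)
    rwa [State.setN, Function.update_eq_self] at this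
  intro v
  induction l generalizing i m v with
  | nil => simp at hm
  | cons x l ih =>
    refine Runs.instr_seq ?_
    rintro _ - rfl
    have h44 : ((s.setN 44 v).setN 44 (i + 1)) = s.setN 44 (i + 1) := by simp [State.setN]
    rw [Instr.apply, h44]
    refine Runs.ite (fun g => ?_) fun g => ?_
    · simp only [Test.Holds, State.setN_nreg, ha, if_false, if_true, hs] at g
      obtain rfl : m = 0 := by omega
      exact h _
    · simp only [Test.Holds, State.setN_nreg, ha, if_false, if_true, hs] at g
      obtain ⟨m, rfl⟩ : ∃ m', m = m' + 1 := ⟨m - 1, by omega⟩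
      exact ih (by simpa using hm) (by omega) (by simpa using h) _

theorem Runs.switch {α : Type*} {a : ℕ} {F : α → Prog} {l : List α} {x : α} (ha : a ≠ 44)
    (hx : x ∈ l) (hs : s.nreg a = code l x) (h : ∀ v, Runs O V (F x) (s.setN 44 v) Q) :
    Runs O V (SparseHadamard.switch a F 0 l) s Q :=
  Runs.switch_add ha (code_lt hx) (by rw [hs, zero_add]) (by rwa [getElem_code hx])

end

/-- The array starts with the list `L`. -/
def Begins (a : ℕ → ℕ) (L : List ℕ) : Prop := ∀ i (h : i < L.length), a i = L[i]

theorem Begins.append {a : ℕ → ℕ} {L : List ℕ} (h : Begins a L) (c : ℕ) :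
    Begins (Function.update a L.length c) (L ++ [c]) := by
  intro i hi
  rw [List.length_append, List.length_singleton] at hi
  rcases Nat.lt_succ_iff_lt_or_eq.1 hi with hi | rfl
  · rw [Function.update_of_ne hi.ne, List.getElem_append_left hi, h i hi]
  · simp

theorem Begins.of_append {a : ℕ → ℕ} {L L' : List ℕ} (h : Begins a (L ++ L')) : Begins a L :=
  fun i hi => by rw [h i (by simp; omega), List.getElem_append_left hi]

theorem Begins.last {a : ℕ → ℕ} {L : List ℕ} {c : ℕ} (h : Begins a (L ++ [c])) :
    a L.length = c := by
  rw [h L.length (by simp)]; simp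

/-- Codes for the symbols and the control states of a machine, and numbers for its stacks. -/
structure Coding {K : Type} (Γ : K → Type) (Λ σ : Type) where
  num : K → ℕ
  inj : Function.Injective num
  cnt : ℕ
  num_lt : ∀ κ, num κ < cnt
  sym : ∀ κ, List (Γ κ)
  ctl : List (Option Λ × σ)
  mem : ∀ p, p ∈ ctl

section

open Turing.TM2

variable {K : Type} {Γ : K → Type} {Λ σ : Type}

/-- All symbols that the statement pushes are in the given sets. -/
def Pushes (A : ∀ κ, Set (Γ κ)) : Stmt Γ Λ σ → Prop
  | .push κ f q => (∀ v, f v ∈ A κ) ∧ Pushes A q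
  | .peek _ _ q => Pushes A q
  | .pop _ _ q => Pushes A q
  | .load _ q => Pushes A q
  | .branch _ q₁ q₂ => Pushes A q₁ ∧ Pushes A q₂
  | .goto _ => True
  | .halt => True

theorem Pushes.mono {A B : ∀ κ, Set (Γ κ)} (hAB : ∀ κ, A κ ⊆ B κ) {q : Stmt Γ Λ σ}
    (h : Pushes A q) : Pushes B q := by
  induction q with
  | push κ f q ih => exact ⟨fun v => hAB _ (h.1 v), ih h.2⟩
  | peek κ f q ih => exact ih h
  | pop κ f q ih => exact ih h
  | load f q ih => exact ih h
  | branch f q₁ q₂ ih₁ ih₂ => exact ⟨ih₁ h.1, ih₂ h.2⟩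
  | goto f => trivial
  | halt => trivial

/-- Apart from the input stack, the stack alphabets of the machine need not be finite. A statement
is finite and there are finitely many internal states, so it can push only finitely many symbols,
and these can be coded. -/
theorem exists_pushes [Finite σ] (q : Stmt Γ Λ σ) :
    ∃ A : ∀ κ, Set (Γ κ), (∀ κ, (A κ).Finite) ∧ Pushes A q := by
  classical
  induction q with
  | push κ f q ih =>
    obtain ⟨A, hA, hq⟩ := ih
    refine ⟨fun κ' => A κ' ∪ {x | ∃ h : κ = κ', ∃ v, x = h ▸ f v}, fun κ' => (hA κ').union ?_,
      fun v => Or.inr ⟨rfl, v, rfl⟩, hq.mono fun _ => Set.subset_union_left⟩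
    by_cases h : κ = κ'
    · subst h
      refine (Set.finite_range f).subset ?_
      rintro _ ⟨-, v, rfl⟩
      exact ⟨v, rfl⟩
    · exact Set.finite_empty.subset fun x ⟨h', _⟩ => h h'
  | peek κ f q ih => exact ih
  | pop κ f q ih => exact ih
  | load f q ih => exact ih
  | branch f q₁ q₂ ih₁ ih₂ =>
    obtain ⟨A₁, h₁, hq₁⟩ := ih₁
    obtain ⟨A₂, h₂, hq₂⟩ := ih₂
    exact ⟨fun κ => A₁ κ ∪ A₂ κ, fun κ => (h₁ κ).union (h₂ κ),
      hq₁.mono fun _ => Set.subset_union_left, hq₂.mono fun _ => Set.subset_union_right⟩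
  | goto f => exact ⟨fun _ => ∅, fun _ => Set.finite_empty, trivial⟩
  | halt => exact ⟨fun _ => ∅, fun _ => Set.finite_empty, trivial⟩

namespace Coding

variable (c : Coding Γ Λ σ)

/-- The array that holds a stack. -/
def arr (κ : K) : ℕ := 10 + c.num κ

/-- The register that holds the height of a stack. -/
def len (κ : K) : ℕ := 50 + c.num κ

/-- Push the symbol with code `x`. -/
def pushP (κ : K) (x : ℕ) : List Instr :=
  [.nconst 43 x, .nstore (c.arr κ) (c.len κ) 43, .nconst 44 1, .nadd (c.len κ) (c.len κ) 44]

/-- Read the top of a stack, remove it if `b = 0`, and continue according to its value. -/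
noncomputable def readP (κ : K) (b : ℕ) (F : Option (Γ κ) → Prog) : Prog :=
  .seq (block [.nconst 44 0]) (.ite (.nlt 44 (c.len κ))
    (.seq (block [.nconst 44 1, .nsub (c.len κ) (c.len κ) 44, .nload 43 (c.arr κ) (c.len κ),
      .nconst 44 b, .nadd (c.len κ) (c.len κ) 44]) (switch 43 (fun x => F (some x)) 0 (c.sym κ)))
    (F none))

/-- The program that performs a statement with internal state `v`. -/
noncomputable def compile : Stmt Γ Λ σ → σ → Prog
  | .push κ f q, v => .seq (block (c.pushP κ (code (c.sym κ) (f v)))) (compile q v)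
  | .peek κ f q, v => c.readP κ 1 fun o => compile q (f v o)
  | .pop κ f q, v => c.readP κ 0 fun o => compile q (f v o)
  | .load f q, v => compile q (f v)
  | .branch f q₁ q₂, v => cond (f v) (compile q₁ v) (compile q₂ v)
  | .goto f, v => .instr (.nconst 42 (code c.ctl (some (f v), v)))
  | .halt, v => .instr (.nconst 42 (code c.ctl (none, v)))

/-- One step of the machine with program `M`. -/
noncomputable def stepP (M : Λ → Stmt Γ Λ σ) : Prog :=
  switch 42 (fun p => p.1.elim .skip fun l => c.compile (M l) p.2) 0 c.ctl

/-- The memory holds the stacks `S`. -/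
def Stacks (S : ∀ κ, List (Γ κ)) (s : State) : Prop :=
  ∀ κ, s.nreg (c.len κ) = (S κ).length ∧ (∀ x ∈ S κ, x ∈ c.sym κ) ∧
    Begins (s.narr (c.arr κ)) ((S κ).map (code (c.sym κ))).reverse

/-- The memory holds a configuration. -/
def Holds (C : Cfg Γ Λ σ) (s : State) : Prop :=
  s.nreg 42 = code c.ctl (C.l, C.var) ∧ c.Stacks C.stk s

variable {c}

theorem Stacks.setN {S : ∀ κ, List (Γ κ)} {s : State} (h : c.Stacks S s) {d v : ℕ} (hd : d < 50) :
    c.Stacks S (s.setN d v) := fun κ => by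
  have h1 : c.len κ ≠ d := by simp only [len]; omega
  simpa [h1] using h κ

theorem Holds.setN {C : Cfg Γ Λ σ} {s : State} (h : c.Holds C s) {d v : ℕ} (hd : d < 42) :
    c.Holds C (s.setN d v) :=
  ⟨by rw [State.setN_nreg, if_neg (by omega)]; exact h.1, h.2.setN (by omega)⟩

/-- The instructions that occur in the simulation of one step. -/
def simI : Instr → Prop
  | .nconst d _ | .nadd d _ _ | .nsub d _ _ | .nload d _ _ => 42 ≤ d
  | .nstore a _ _ => 10 ≤ a
  | _ => False

variable {f : Instr → Bool} (hf : ∀ i, simI i → f i = false)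

include hf in
theorem any_pushP (κ : K) (x : ℕ) : (block (c.pushP κ x)).any f = false := by
  have h : ∀ i ∈ c.pushP κ x, f i = false := fun i hi => hf i (by
    simp only [pushP, List.mem_cons, List.not_mem_nil, or_false] at hi
    rcases hi with rfl | rfl | rfl | rfl <;> simp only [simI, len, arr] <;> omega)
  rw [any_block, List.any_eq_false]
  simpa using h

include hf in
theorem any_readP {κ : K} {b : ℕ} {F : Option (Γ κ) → Prog} (hF : ∀ o, (F o).any f = false) :
    (c.readP κ b F).any f = false := by
  have h1 : 42 ≤ c.len κ := by simp only [len]; omega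
  have h2 : ∀ c, f (.nconst 44 c) = false := fun c => hf _ (by simp [simI])
  have h3 : ∀ d ≥ 42, ∀ a b, f (.nadd d a b) = false := fun d hd a b => hf _ hd
  have h4 : ∀ d ≥ 42, ∀ a b, f (.nsub d a b) = false := fun d hd a b => hf _ hd
  have h5 : ∀ a b, f (.nload 43 a b) = false := fun a b => hf _ (by simp [simI])
  simp [readP, Prog.any, any_block, hF, any_switch (fun x => hF (some x)) h2, h1, h2, h3, h4, h5]

include hf in
theorem any_compile (q : Stmt Γ Λ σ) (v : σ) : (c.compile q v).any f = false := by
  induction q generalizing v with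
  | push κ g q ih => simp [compile, Prog.any, ih, any_pushP hf]
  | peek κ g q ih => exact any_readP hf fun o => ih _
  | pop κ g q ih => exact any_readP hf fun o => ih _
  | load g q ih => exact ih _
  | branch g q₁ q₂ ih₁ ih₂ => rw [compile]; cases g v <;> simp [ih₁, ih₂]
  | goto g => exact hf _ (by simp [simI])
  | halt => exact hf _ (by simp [simI])

include hf in
theorem any_stepP (M : Λ → Stmt Γ Λ σ) : (c.stepP M).any f = false := by
  refine any_switch (fun p => ?_) (fun _ => hf _ (by simp [simI])) _ _
  obtain ⟨_ | l, v⟩ := p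
  · rfl
  · exact any_compile hf _ _

variable {O : ℕ → ℝ} {V : ℕ} {s : State} {S : ∀ κ, List (Γ κ)} {Q : State → Prop}

theorem stacks_push [DecidableEq K] (h : c.Stacks S s) (κ : K) {x : Γ κ} (hx : x ∈ c.sym κ) :
    c.Stacks (Function.update S κ (x :: S κ)) (applyAll O (c.pushP κ (code (c.sym κ) x)) s) := by
  intro κ'
  have hl : ∀ κ, c.len κ ≠ 43 ∧ c.len κ ≠ 44 := fun κ => by simp only [len]; omega
  obtain rfl | hne := eq_or_ne κ' κ
  · obtain ⟨h1, h2, h3⟩ := h κ'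
    have h4 := h3.append (code (c.sym κ') x)
    simp only [List.length_reverse, List.length_map] at h4
    refine ⟨by simp [pushP, applyAll, Instr.apply, hl, h1], by simpa using ⟨hx, h2⟩, ?_⟩
    simpa [pushP, applyAll, Instr.apply, hl, h1] using h4
  · have h1 : c.len κ' ≠ c.len κ := fun e => hne (c.inj (by simpa [len] using e))
    have h2 : c.arr κ' ≠ c.arr κ := fun e => hne (c.inj (by simpa [arr] using e))
    simpa [pushP, applyAll, Instr.apply, hl, h1, h2, hne] using h κ'

/-- The case `b = 1` is a peek, `b = 0` a pop. Popping only lowers the height: `Begins` says nothing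
about the cells above it. -/
theorem runs_readP [DecidableEq K] (h : c.Stacks S s) (κ : K) {b : ℕ} (hb : b = 0 ∨ b = 1)
    {F : Option (Γ κ) → Prog}
    (hF : ∀ s', c.Stacks (if b = 0 then Function.update S κ (S κ).tail else S) s' →
      Runs O V (F (S κ).head?) s' Q) : Runs O V (c.readP κ b F) s Q := by
  have hl : ∀ κ, c.len κ ≠ 43 ∧ c.len κ ≠ 44 := fun κ => by simp only [len]; omega
  have hl' : ∀ κ, 43 ≠ c.len κ ∧ 44 ≠ c.len κ := fun κ => ⟨(hl κ).1.symm, (hl κ).2.symm⟩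
  refine Runs.block_seq ?_
  rintro _ - rfl
  obtain ⟨h1, h2, h3⟩ := h κ
  refine Runs.ite (fun g => ?_) fun g => ?_
  · simp only [Test.Holds, applyAll, Instr.apply, State.setN_nreg, hl, if_true, if_false, h1] at g
    obtain ⟨x, T, hT⟩ := List.exists_cons_of_length_pos g
    rw [hT] at h1 h2 h3
    rw [List.map_cons, List.reverse_cons] at h3
    have h4 := h3.last
    simp only [List.length_reverse, List.length_map] at h4
    refine Runs.block_seq fun s₁ hf₁ hs₁ => Runs.switch (by decide) (h2 x (by simp)) ?_ fun v => ?_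
    · rw [hs₁]; simp [applyAll, Instr.apply, hl, hl', h1, h4]
    rw [hT] at hF
    refine hF _ fun κ' => ?_
    obtain rfl | hne := eq_or_ne κ' κ
    · refine ⟨?_, ?_, ?_⟩
      · rw [hs₁]
        rcases hb with rfl | rfl <;> simp [applyAll, Instr.apply, hl, h1, hT]
      · rcases hb with rfl | rfl <;> simp_all
      · rw [hs₁]
        rcases hb with rfl | rfl
        · simpa [applyAll, Instr.apply] using h3.of_append
        · simpa [applyAll, Instr.apply, hT] using h3
    · have h1 : c.len κ' ≠ c.len κ := fun e => hne (c.inj (by simpa [len] using e))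
      rw [hs₁]
      have e : (if b = 0 then Function.update S κ (x :: T).tail else S) κ' = S κ' := by
        split_ifs <;> simp [hne]
      rw [e]
      simpa [applyAll, Instr.apply, hl, h1] using h κ'
  · simp only [Test.Holds, applyAll, Instr.apply, State.setN_nreg, hl, if_true, if_false, h1] at g
    have hT : S κ = [] := List.eq_nil_of_length_eq_zero (by omega)
    rw [hT] at hF
    refine hF _ ?_
    have e : (if b = 0 then Function.update S κ ([] : List (Γ κ)).tail else S) = S := by
      split_ifs
      · rw [List.tail_nil, ← hT, Function.update_eq_self]
      · rfl
    rw [e]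
    exact h.setN (by norm_num)

theorem runs_compile [DecidableEq K] {q : Stmt Γ Λ σ} (hq : Pushes (fun κ => {x | x ∈ c.sym κ}) q)
    (v : σ) (h : c.Stacks S s) :
    Runs O V (c.compile q v) s (c.Holds (stepAux q v S)) := by
  induction q generalizing v S s with
  | push κ f q ih =>
    refine Runs.block_seq ?_
    rintro _ - rfl
    exact ih hq.2 v (stacks_push h κ (hq.1 v))
  | peek κ f q ih => exact runs_readP h κ (.inr rfl) fun s' hs' => ih hq _ (by simpa using hs')
  | pop κ f q ih => exact runs_readP h κ (.inl rfl) fun s' hs' => ih hq _ (by simpa using hs')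
  | load f q ih => exact ih hq _ h
  | branch f q₁ q₂ ih₁ ih₂ =>
    rw [compile, stepAux]
    cases f v
    · exact ih₂ hq.2 v h
    · exact ih₁ hq.1 v h
  | goto f =>
    exact Runs.instr ⟨by simp [Instr.apply], h.setN (by norm_num)⟩
  | halt =>
    exact Runs.instr ⟨by simp [Instr.apply], h.setN (by norm_num)⟩

theorem runs_stepP [DecidableEq K] {M : Λ → Stmt Γ Λ σ}
    (hM : ∀ l, Pushes (fun κ => {x | x ∈ c.sym κ}) (M l)) {C : Cfg Γ Λ σ} (h : c.Holds C s) :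
    Runs O V (c.stepP M) s (c.Holds ((step M C).getD C)) := by
  have hs : ∀ v, c.Stacks C.stk (s.setN 44 v) := fun v => h.2.setN (by norm_num)
  refine Runs.switch (by decide) (c.mem (C.l, C.var)) h.1 fun v => ?_
  obtain ⟨_ | l, w, S⟩ := C
  -- A machine that has halted is left alone, in agreement with the default value of `getD`.
  · exact Runs.skip ⟨by simpa using h.1, hs v⟩
  · exact runs_compile (hM l) w (hs v)

/-- Perform as many steps as register `16` says. -/
noncomputable def runP (c : Coding Γ Λ σ) (M : Λ → Stmt Γ Λ σ) : Prog := forP 20 16 (c.stepP M)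

theorem runs_runP [DecidableEq K] {M : Λ → Stmt Γ Λ σ}
    (hM : ∀ l, Pushes (fun κ => {x | x ∈ c.sym κ}) (M l)) {C : Cfg Γ Λ σ} (h : c.Holds C s)
    {W : ℕ} (hW : s.nreg 16 = W) (hV : W ≤ V) :
    Runs O V (c.runP M) s (c.Holds ((fun C => (step M C).getD C)^[W] C)) := by
  have ok : ∀ r, r < 42 → (c.stepP M).any (·.wN r) = false := fun r hr =>
    any_stepP (fun i hi => by
      cases i <;> simp only [simI, Instr.wN, beq_eq_false_iff_ne] at hi ⊢ <;> omega) M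
  refine Runs.forP W (fun j => c.Holds ((fun C => (step M C).getD C)^[j] C)) hW hV
    (by simp [loopOK, ok]) (h.setN (by norm_num))
    (fun j hj s₁ hf hi hI => Runs.mono (runs_stepP hM hI) fun s₂ _ hs₂ => ?_) fun _ _ h => h
  rw [Function.iterate_succ_apply']
  exact (hs₂.setN (by norm_num)).setN (by norm_num)

end Coding

/-- A halted configuration is a fixed point of the totalised step. The simulation can therefore
always run for the whole time bound, without a test for halting. -/
theorem iterate_getD_of_evalsTo {α : Type*} {f : α → Option α} {a b : α} {m : ℕ}
    (h : StateTransition.EvalsToInTime f a (some b) m) (hb : f b = none) :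
    (fun x => (f x).getD x)^[m] a = b := by
  obtain ⟨⟨i, hi⟩, him⟩ := h
  simp only at him
  have hnone : ∀ j, (flip bind f)^[j] none = none := fun j => by
    induction j with
    | zero => rfl
    | succ j ih => rw [Function.iterate_succ_apply]; exact ih
  have h1 : ∀ j a, (flip bind f)^[j] (some a) = some b → (fun x => (f x).getD x)^[j] a = b := by
    intro j
    induction j with
    | zero => intro a h; simpa using h
    | succ j ih =>
      intro a h
      rw [Function.iterate_succ_apply] at h ⊢
      have e : flip bind f (some a) = f a := rfl
      rw [e] at h
      cases hfa : f a with
      | none => rw [hfa, hnone] at h; cases h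
      | some a' => rw [hfa] at h; exact ih a' h
  have h2 : Function.IsFixedPt (fun x => (f x).getD x) b := by simp [Function.IsFixedPt, hb]
  obtain ⟨d, rfl⟩ := Nat.exists_eq_add_of_le' him
  rw [Function.iterate_add_apply, h1 i a hi]
  exact h2.iterate d

end

/-! ### Tabulating a function that a multi-stack Turing machine computes

Integer registers: `0` holds `n`, `1` holds `k`, `23` holds `t`, `24` holds the index of the vector.
Integer array `4` and register `25` hold the input of the machine. -/

/-- Append `x` to integer array `4`. -/
def appendP (x : ℕ) : Prog := block [.nconst 29 x, .nstore 4 25 29, .nconst 29 1, .nadd 25 25 29]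

/-- Append the lowest binary digit of the content of register `30`, and halve the register. -/
def digitP (c : Option Bool → ℕ) : Prog :=
  .seq (block [.nhalf 26 30, .nadd 27 26 26, .nsub 27 30 27, .nconst 28 0, .nadd 30 26 28])
    (.ite (.nlt 28 27) (appendP (c (some true))) (appendP (c (some false))))

/-- Append the binary digits of the content of register `30`. -/
def bitsP (c : Option Bool → ℕ) : Prog :=
  forP 31 32 (.seq (.instr (.nconst 28 0)) (.ite (.nlt 28 30) (digitP c) .skip))

/-- Write the input of the machine. -/
def inputP (c : Option Bool → ℕ) : Prog :=
  .seq (block [.nconst 25 0, .nconst 28 0, .nadd 30 1 28, .nconst 29 1, .nadd 32 0 29])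
  (.seq (bitsP c) (.seq (appendP (c none))
  (.seq (block [.nconst 28 0, .nadd 30 24 28]) (.seq (forP 31 0 (digitP c))
  (.seq (appendP (c none)) (.seq (block [.nconst 28 0, .nadd 30 23 28]) (bitsP c)))))))

/-- Copy the input in reverse order to integer array `a`, counting with register `l`. -/
def reverseP (a l : ℕ) : Prog :=
  .seq (block [.nconst 28 0, .nadd 32 25 28]) (forP 31 32 (block [.nsub 33 25 31, .nconst 29 1,
    .nsub 33 33 29, .nload 43 4 33, .nstore a l 43, .nadd l l 29]))

/-- The memory holds the input `L`. -/
def Input (L : List ℕ) (s : State) : Prop := s.nreg 25 = L.length ∧ Begins (s.narr 4) L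

section

variable {O : ℕ → ℝ} {V n k t j : ℕ} {s : State} {c : Option Bool → ℕ} {L : List ℕ}

theorem Input.setN (h : Input L s) {d v : ℕ} (hd : d ≠ 25) : Input L (s.setN d v) :=
  ⟨by rw [State.setN_nreg, if_neg hd.symm]; exact h.1, h.2⟩

theorem appendP_spec (h : Input L s) (x : ℕ) : Runs O V (appendP x) s (Input (L ++ [x])) := by
  refine Runs.block ⟨?_, ?_⟩
  · simp [applyAll, Instr.apply, h.1]
  · simpa [applyAll, Instr.apply, h.1] using h.2.append x

theorem digitP_spec (h : Input L s) {m : ℕ} (hm : s.nreg 30 = m) :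
    Runs O V (digitP c) s fun s' => Input (L ++ [c (some (m.testBit 0))]) s' ∧
      s'.nreg 30 = m / 2 := by
  refine Runs.block_seq fun s₁ hf₁ hs₁ => ?_
  have h1 : Input L s₁ := ⟨(hf₁.n 25 (by decide)).trans h.1, by
    rw [hf₁.na 4 (by decide)]; exact h.2⟩
  have h30 : s₁.nreg 30 = m / 2 := by rw [hs₁]; simp [applyAll, Instr.apply, hm]
  have h27 : s₁.nreg 27 = m - (m / 2 + m / 2) := by rw [hs₁]; simp [applyAll, Instr.apply, hm]
  have h28 : s₁.nreg 28 = 0 := by rw [hs₁]; simp [applyAll, Instr.apply]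
  refine Runs.ite (fun g => ?_) fun g => ?_ <;>
    simp only [Test.Holds, h27, h28] at g <;>
    refine Runs.mono (appendP_spec h1 _) fun s₂ hf₂ hs₂ =>
      ⟨?_, (hf₂.n 30 (by rfl)).trans h30⟩
  · rw [Nat.testBit_zero, decide_eq_true (by omega)]; exact hs₂
  · rw [Nat.testBit_zero, decide_eq_false (by omega)]; exact hs₂

/-- `Nat.bits` has no leading zeros, so digits are written only while the remaining number is
positive; the fixed number `l` of passes merely has to be large enough. -/
theorem bitsP_spec (h : Input L s) {m l : ℕ} (hm : s.nreg 30 = m) (hl : s.nreg 32 = l)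
    (hml : m < 2 ^ l) (hV : l ≤ V) :
    Runs O V (bitsP c) s (Input (L ++ m.bits.map fun b => c (some b))) := by
  refine Runs.forP l (fun i s' => s'.nreg 30 = m / 2 ^ i ∧ ∃ L', Input L' s' ∧
    L' ++ (m / 2 ^ i).bits.map (fun b => c (some b)) = L ++ m.bits.map fun b => c (some b)) hl hV
    (by rfl) ⟨by simpa using hm, L, h.setN (by norm_num), by simp⟩
    (fun i hi s₁ hf₁ hi₁ hI => ?_) fun s₁ _ hs₁ => ?_
  · obtain ⟨h30, L', hL', e⟩ := hI
    have hd : m / 2 ^ (i + 1) = m / 2 ^ i / 2 := by rw [pow_succ, Nat.div_div_eq_div_mul]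
    refine Runs.instr_seq ?_
    rintro _ - rfl
    refine Runs.ite (fun g => ?_) fun g => Runs.skip ?_
    · simp only [Test.Holds, Instr.apply, State.setN_nreg, Nat.reduceEqDiff, if_true, if_false,
        h30] at g
      refine Runs.mono (digitP_spec (hL'.setN (by norm_num)) (m := m / 2 ^ i)
        (by simpa [Instr.apply] using h30)) fun s₂ _ hs₂ => ⟨by simp [hs₂.2, hd], _,
        (hs₂.1.setN (by norm_num)).setN (by norm_num), ?_⟩
      rw [← e, hd, List.append_assoc, List.singleton_append, Nat.testBit_zero]
      congr 1
      conv_rhs => rw [← Nat.bit_bodd_div2 (m / 2 ^ i)]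
      rw [Nat.bits_append_bit, List.map_cons, Nat.div2_val]
      · congr 3
        rw [Nat.bodd_eq_one_and_ne_zero]
        rcases Nat.mod_two_eq_zero_or_one (m / 2 ^ i) with h | h <;> simp [h]
      · intro h0
        rw [Nat.div2_val] at h0
        have : m / 2 ^ i = 1 := by omega
        rw [this]; rfl
    · simp only [Test.Holds, Instr.apply, State.setN_nreg, Nat.reduceEqDiff, if_true, if_false,
        h30] at g
      have h0 : m / 2 ^ i = 0 := by omega
      rw [h0] at h30 e
      rw [hd, h0]
      exact ⟨by simpa [Instr.apply] using h30, L',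
        ((hL'.setN (by norm_num)).setN (by norm_num)).setN (by norm_num), e⟩
  · obtain ⟨-, L', hL', e⟩ := hs₁
    rw [Nat.div_eq_of_lt hml, Nat.zero_bits, List.map_nil, List.append_nil] at e
    rwa [← e]

theorem fixedP_spec (h : Input L s) {m : ℕ} (hm : s.nreg 30 = m) (hn : s.nreg 0 = n)
    (hV : n ≤ V) : Runs O V (forP 31 0 (digitP c)) s
      (Input (L ++ (List.range n).map fun i => c (some (m.testBit i)))) := by
  refine Runs.forP n (fun i s' => s'.nreg 30 = m / 2 ^ i ∧
    Input (L ++ (List.range i).map fun i => c (some (m.testBit i))) s') hn hV (by rfl)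
    ⟨by simpa using hm, by simpa using h.setN (by norm_num)⟩ (fun i hi s₁ hf₁ hi₁ hI => ?_)
    fun _ _ h => h.2
  refine Runs.mono (digitP_spec hI.2 hI.1) fun s₂ _ hs₂ => ⟨?_, ?_⟩
  · simp [hs₂.2, pow_succ, Nat.div_div_eq_div_mul]
  · have h1 := hs₂.1
    rw [Nat.testBit_div_two_pow, zero_add, List.append_assoc] at h1
    rw [List.range_succ, List.map_append]
    exact (h1.setN (by norm_num)).setN (by norm_num)

theorem inputP_spec (hn : s.nreg 0 = n) (hk : s.nreg 1 = k) (ht : s.nreg 23 = t)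
    (hj : s.nreg 24 = j) (hkn : k ≤ 2 ^ n) (htn : t < 2 ^ n) (hV : n + 1 ≤ V) :
    Runs O V (inputP c) s (Input ((k.bits.map some ++ none ::
      ((List.range n).map (fun i => some (j.testBit i)) ++ none :: t.bits.map some)).map c)) := by
  have h2 : 2 ^ (n + 1) = 2 * 2 ^ n := by ring
  have h2' : 0 < 2 ^ n := by positivity
  refine Runs.block_seq fun s₁ hf₁ hs₁ => ?_
  have i₁ : Input [] s₁ := ⟨by rw [hs₁]; simp [applyAll, Instr.apply], fun i hi => by simp at hi⟩
  -- `k` may equal `2^n`, so `n + 1` digits are needed.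
  have l₁ : s₁.nreg 32 = n + 1 := by rw [hs₁]; simp [applyAll, Instr.apply, hn]
  refine Runs.seq (bitsP_spec i₁ (m := k) (by rw [hs₁]; simp [applyAll, Instr.apply, hk]) l₁
    (by omega) hV) fun s₂ hf₂ i₂ => ?_
  refine Runs.seq (appendP_spec i₂ _) fun s₃ hf₃ i₃ => ?_
  refine Runs.block_seq fun s₄ hf₄ hs₄ => ?_
  have n₄ : ∀ i ∈ [0, 23, 24], s₄.nreg i = s.nreg i := by
    intro i hi
    fin_cases hi <;> exact (hf₄.n _ (by rfl)).trans ((hf₃.n _ (by rfl)).trans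
      ((hf₂.n _ (by rfl)).trans (hf₁.n _ (by rfl))))
  have l₄ : s₄.nreg 32 = n + 1 := (hf₄.n 32 (by rfl)).trans ((hf₃.n _ (by rfl)).trans
    ((hf₂.n _ (by rfl)).trans l₁))
  have i₄ := (i₃.setN (d := 28) (v := 0) (by norm_num)).setN (d := 30) (v := j) (by norm_num)
  have e₄ : s₄ = (s₃.setN 28 0).setN 30 j := by
    have := n₄ 24 (by simp)
    rw [hs₄] at this ⊢
    simp only [applyAll, Instr.apply, State.setN_nreg, Nat.reduceEqDiff, if_true, if_false,
      add_zero, hj] at this ⊢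
    rw [this]
  rw [← e₄] at i₄
  refine Runs.seq (fixedP_spec i₄ (m := j) (by rw [e₄]; simp) ((n₄ 0 (by simp)).trans hn) (by omega))
    fun s₅ hf₅ i₅ => ?_
  refine Runs.seq (appendP_spec i₅ _) fun s₆ hf₆ i₆ => ?_
  refine Runs.block_seq fun s₇ hf₇ hs₇ => ?_
  have l₇ : s₇.nreg 32 = n + 1 := (hf₇.n 32 (by rfl)).trans ((hf₆.n _ (by rfl)).trans
    ((hf₅.n _ (by rfl)).trans l₄))
  have t₆ : s₆.nreg 23 = t := (hf₆.n _ (by rfl)).trans ((hf₅.n _ (by rfl)).trans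
    ((n₄ 23 (by simp)).trans ht))
  have e₇ : s₇ = (s₆.setN 28 0).setN 30 t := by
    rw [hs₇]; simp [applyAll, Instr.apply, t₆]
  have i₇ := (i₆.setN (d := 28) (v := 0) (by norm_num)).setN (d := 30) (v := t) (by norm_num)
  rw [← e₇] at i₇
  refine Runs.mono (bitsP_spec i₇ (m := t) (by rw [e₇]; simp) l₇ (by omega) hV)
    fun s₈ _ i₈ => ?_
  simpa [Function.comp_def] using i₈

/-- The input list has the top of the stack first, whereas the array holds a stack with its bottom
first. -/
theorem reverseP_spec (h : Input L s) {a l : ℕ} (ha : a ≠ 4) (hl : 50 ≤ l) (h0 : s.nreg l = 0)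
    (hV : L.length ≤ V) : Runs O V (reverseP a l) s fun s' => s'.nreg l = L.length ∧
      Begins (s'.narr a) L.reverse := by
  have hl' : ∀ i < 50, l ≠ i := fun i hi => by omega
  refine Runs.block_seq ?_
  rintro _ - rfl
  refine Runs.forP L.length (fun i s' => s'.nreg l = i ∧ Begins (s'.narr a) (L.reverse.take i))
    (by simp [applyAll, Instr.apply, h.1]) hV ?_ ?_ (fun i hi s₁ hf hi₁ hI => Runs.block ?_)
    fun _ _ h => by rwa [List.take_of_length_le (by simp)] at h
  · simp [loopOK, any_block, Instr.wN]; omega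
  · simp [applyAll, Instr.apply, hl', h0, Begins]
  have e25 : s₁.nreg 25 = L.length := by
    rw [hf.n 25 (by simp [forP, Prog.any, any_block, Instr.wN]; omega)]
    simp [applyAll, Instr.apply, h.1]
  have e4 : s₁.narr 4 = s.narr 4 := by
    rw [hf.na 4 (by simp [forP, Prog.any, any_block, Instr.wNA]; omega)]
    simp [applyAll, Instr.apply]
  have hp : L.length - i - 1 < L.length := by omega
  have hr : i < L.reverse.length := by simpa using hi
  have hc : L[L.length - i - 1] = L.reverse[i] := by
    rw [List.getElem_reverse]; congr 1; omega
  refine ⟨by simp [applyAll, Instr.apply, hl', hI.1], ?_⟩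
  have h1 := hI.2.append L.reverse[i]
  rw [List.length_take, min_eq_left hr.le, ← List.take_succ_eq_append_getElem hr] at h1
  simpa [applyAll, Instr.apply, hl', hI.1, e25, e4, hi₁, h.2 _ hp, hc] using h1

end

/-- The instruction writes a register or an array that the tabulation needs, or queries. -/
def Instr.outer (i : Instr) : Bool :=
  [0, 1, 2, 3, 6, 14, 16, 21, 23, 24].any i.wN || i.wNA 0 || i.asks

namespace Coding

open Turing.TM2

variable {K : Type} {Γ : K → Type} {Λ σ : Type} (c : Coding Γ Λ σ)

/-- Empty all stacks. -/
def clearP : Prog := block ((List.range c.cnt).map fun i => .nconst (50 + i) 0)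

/-- Write the initial configuration. -/
noncomputable def initP (κ : K) (g : Option Bool → Γ κ) (p : Option Λ × σ) : Prog :=
  .seq c.clearP (.seq (inputP fun o => code (c.sym κ) (g o))
    (.seq (reverseP (c.arr κ) (c.len κ)) (.instr (.nconst 42 (code c.ctl p)))))

/-- Read the number whose binary digits are on stack `κ`, lowest digit on top, into register
`34`. -/
noncomputable def decodeP (κ : K) (g : Γ κ → Bool) : Prog :=
  .seq (block [.nconst 34 0, .nconst 35 1, .nconst 28 0, .nadd 32 (c.len κ) 28])
  (forP 31 3 (.seq (block [.nconst 29 1, .nsub 32 32 29, .nload 43 (c.arr κ) 32])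
    (.seq (switch 43 (fun x => cond (g x) (.instr (.nadd 34 34 35)) .skip) 0 (c.sym κ))
      (.instr (.nadd 35 35 35)))))

variable {c} {O : ℕ → ℝ} {V n k t j r : ℕ} {s : State}

theorem outer_of_simI {i : Instr} (h : simI i) : i.outer = false := by
  cases i <;> simp only [simI] at h <;>
    simp [Instr.outer, Instr.wN, Instr.wNA, Instr.asks] <;> omega

theorem any_outer_initP (κ : K) (g : Option Bool → Γ κ) (p : Option Λ × σ) :
    (c.initP κ g p).any Instr.outer = false := by
  have h1 : c.clearP.any Instr.outer = false := by
    rw [clearP, any_block, List.any_eq_false]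
    simp only [List.mem_map, List.mem_range, forall_exists_index, and_imp]
    rintro _ i - rfl
    rw [outer_of_simI (by simp only [simI]; omega)]; exact Bool.false_ne_true
  have h2 : (reverseP (c.arr κ) (c.len κ)).any Instr.outer = false := by
    have h3 : (Instr.nstore (c.arr κ) (c.len κ) 43).outer = false :=
      outer_of_simI (by simp only [simI, arr]; omega)
    have h4 : (Instr.nadd (c.len κ) (c.len κ) 29).outer = false :=
      outer_of_simI (by simp only [simI, len]; omega)
    simp only [reverseP, forP, Prog.any, any_block, List.any_cons, h3, h4]
    rfl
  have h3 : (inputP fun o => code (c.sym κ) (g o)).any Instr.outer = false := by rfl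
  simp only [initP, Prog.any, h1, h2, h3]
  rfl

theorem any_outer_runP (M : Λ → Stmt Γ Λ σ) : (c.runP M).any Instr.outer = false := by
  simp only [runP, forP, Prog.any, any_stepP (fun i hi => outer_of_simI hi) M]
  rfl

theorem any_outer_decodeP (κ : K) (g : Γ κ → Bool) : (c.decodeP κ g).any Instr.outer = false := by
  have h1 : (switch 43 (fun x => cond (g x) (.instr (.nadd 34 34 35)) .skip) 0
      (c.sym κ)).any Instr.outer = false :=
    any_switch (fun x => by cases g x <;> rfl) (fun _ => outer_of_simI (by simp [simI])) _ _
  simp only [decodeP, forP, Prog.any, h1]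
  rfl

/-- Earlier runs leave stacks behind. Resetting the heights is enough, since the contents of the
arrays above the heights are irrelevant. -/
theorem runs_initP {κ : K} {g : Option Bool → Γ κ} {C : Cfg Γ Λ σ}
    (hg : ∀ o, g o ∈ c.sym κ) (hS : ∀ κ', κ' ≠ κ → C.stk κ' = [])
    (hn : s.nreg 0 = n) (hk : s.nreg 1 = k) (ht : s.nreg 23 = t)
    (hj : s.nreg 24 = j) (hkn : k ≤ 2 ^ n) (htn : t < 2 ^ n) (hV : 3 * n + 5 ≤ V)
    (hC : C.stk κ = (k.bits.map some ++ none ::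
      ((List.range n).map (fun i => some (j.testBit i)) ++ none :: t.bits.map some)).map g) :
    Runs O V (c.initP κ g (C.l, C.var)) s (c.Holds C) := by
  have hclear : ∀ (m : ℕ) (s : State), Runs O V
      (block ((List.range m).map fun i => .nconst (50 + i) 0)) s fun s' =>
        ∀ i < m, s'.nreg (50 + i) = 0 := by
    intro m s
    refine Runs.block fun i hi => ?_
    have h1 : ∀ (l : List ℕ) (s : State), (i ∈ l ∨ s.nreg (50 + i) = 0) →
        (applyAll O (l.map fun i => Instr.nconst (50 + i) 0) s).nreg (50 + i) = 0 := by
      intro l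
      induction l with
      | nil => intro s h; simpa [applyAll] using h
      | cons a l ih =>
        intro s h
        refine ih _ ?_
        rcases h with h | h
        · rcases List.mem_cons.1 h with rfl | h
          · exact .inr (by simp [Instr.apply])
          · exact .inl h
        · exact .inr (by simp [Instr.apply, h])
    exact h1 _ _ (.inl (List.mem_range.2 hi))
  refine Runs.seq (hclear _ s) fun s₁ hf₁ hs₁ => ?_
  have ok₁ : ∀ i < 42, c.clearP.any (·.wN i) = false := fun i hi => by
    rw [clearP, any_block, List.any_eq_false]
    simp only [List.mem_map, List.mem_range, forall_exists_index, and_imp]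
    rintro _ a - rfl
    simp only [Instr.wN, beq_iff_eq]; omega
  have hlen : ∀ m, m ≤ 2 ^ n → m.bits.length ≤ n + 1 := fun m hm => by
    rw [Nat.size_eq_bits_len, Nat.size_le, pow_succ]
    have : 0 < 2 ^ n := by positivity
    omega
  refine Runs.seq (inputP_spec ((hf₁.n 0 (ok₁ _ (by norm_num))).trans hn)
    ((hf₁.n 1 (ok₁ _ (by norm_num))).trans hk) ((hf₁.n 23 (ok₁ _ (by norm_num))).trans ht)
    ((hf₁.n 24 (ok₁ _ (by norm_num))).trans hj) hkn htn (by omega)) fun s₂ hf₂ hs₂ => ?_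
  have l₂ : ∀ κ', s₂.nreg (c.len κ') = 0 := fun κ' => by
    rw [hf₂.n _ ?_, len, hs₁ _ (c.num_lt κ')]
    simp [inputP, bitsP, digitP, appendP, forP, Prog.any, any_block, Instr.wN, len]
    omega
  refine Runs.seq (reverseP_spec hs₂ (a := c.arr κ) (by simp only [arr]; omega)
    (by simp only [len]; omega) (l₂ κ) ?_) fun s₃ hf₃ hs₃ => Runs.instr ⟨by simp [Instr.apply],
    Stacks.setN (fun κ' => ?_) (by norm_num)⟩
  · have h1 := hlen k hkn
    have h2 := hlen t htn.le
    simp only [List.map_map, List.map_append, List.map_cons, List.length_append, List.length_map,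
      List.length_cons, List.length_range]
    omega
  · obtain rfl | hne := eq_or_ne κ' κ
    · rw [hC]
      refine ⟨by simpa using hs₃.1, ?_, by simpa [Function.comp_def] using hs₃.2⟩
      intro x hx
      obtain ⟨o, -, rfl⟩ := List.mem_map.1 hx
      exact hg o
    · rw [hS κ' hne]
      refine ⟨?_, by simp, fun i hi => by simp at hi⟩
      have h1 : c.len κ' ≠ c.len κ := fun e => hne (c.inj (by simpa [len] using e))
      rw [hf₃.n _ ?_, l₂]
      · rfl
      · simp only [reverseP, forP, Prog.any, any_block, List.any_cons, List.any_nil, Instr.wN]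
        simp [h1.symm]
        simp [len]; omega

theorem runs_decodeP {C : Cfg Γ Λ σ} (h : c.Holds C s) {κ : K} {g : Γ κ → Bool} {v : F2 r}
    (hv : (C.stk κ).map g = bitList v) (hr : s.nreg 3 = r) (hV : r ≤ V) :
    Runs O V (c.decodeP κ g) s fun s' => s'.nreg 34 = index v := by
  have hl : ∀ i < 50, c.len κ ≠ i := fun i hi => by simp only [len]; omega
  obtain ⟨h1, h2, h3⟩ := h.2 κ
  have hlen : (C.stk κ).length = r := by
    rw [← List.length_map (f := g), hv, bitList, List.length_ofFn]
  refine Runs.block_seq ?_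
  rintro _ - rfl
  refine Runs.forP r (fun j s' => s'.nreg 34 = ∑ i ∈ range j,
    (if h : i < r then (v ⟨i, h⟩).val else 0) * 2 ^ i ∧ s'.nreg 35 = 2 ^ j ∧ s'.nreg 32 = r - j)
    (by simp [applyAll, Instr.apply, hr]) hV ?_ ?_ (fun j hj s₁ hf hi hI => ?_) fun _ _ h => h.1
  · have h4 : ∀ i, i = 3 ∨ i = 31 → (switch 43 (fun x => cond (g x) (.instr (.nadd 34 34 35)) .skip) 0
      (c.sym κ)).any (·.wN i) = false := fun i hi =>
      any_switch (fun x => by rcases hi with rfl | rfl <;> cases g x <;> rfl)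
        (fun _ => by rcases hi with rfl | rfl <;> rfl) _ _
    simp only [loopOK, Prog.any, h4 3 (.inl rfl), h4 31 (.inr rfl)]
    rfl
  · simp [applyAll, Instr.apply, h1, hlen, hl]
  have e1 : s₁.narr = s.narr := by
    funext a
    refine hf.na a ?_
    have h4 : (switch 43 (fun x => cond (g x) (.instr (.nadd 34 34 35)) .skip) 0
      (c.sym κ)).any (·.wNA a) = false :=
      any_switch (fun x => by cases g x <;> rfl) (fun _ => rfl) _ _
    simp only [forP, Prog.any, h4]
    rfl
  have hjl : j < (C.stk κ).length := by omega
  have e2 : s.narr (c.arr κ) (r - j - 1) = code (c.sym κ) (C.stk κ)[j] := by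
    rw [h3 (r - j - 1) (by simp; omega), List.getElem_reverse, List.getElem_map]
    congr 2
    simp only [List.length_map]; omega
  -- The `j`-th symbol from the top is digit `j`, so the digits are met in the order in which
  -- register `35` runs through the powers of `2`.
  have e3 : g (C.stk κ)[j] = decide (v ⟨j, hj⟩ = 1) := by
    have h4 : ((C.stk κ).map g)[j]'(by simpa using hjl) = (bitList v)[j]'(by simpa [bitList]) := by
      simp only [hv]
    simpa [bitList] using h4
  have e4 : (v ⟨j, hj⟩).val = if g (C.stk κ)[j] then 1 else 0 := by
    rw [e3]
    exact (by decide : ∀ u : ZMod 2, u.val = if decide (u = 1) then 1 else 0) _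
  refine Runs.block_seq fun s₂ hf₂ hs₂ => ?_
  have e5 : s₂.nreg 43 = code (c.sym κ) (C.stk κ)[j] := by
    rw [hs₂]; simp [applyAll, Instr.apply, hI.2.2, e1, e2]
  have e6 : s₂.nreg 34 = s₁.nreg 34 := hf₂.n _ (by rfl)
  have e7 : s₂.nreg 35 = s₁.nreg 35 := hf₂.n _ (by rfl)
  have e8 : s₂.nreg 32 = r - (j + 1) := by
    rw [hs₂]; simp [applyAll, Instr.apply, hI.2.2]; omega
  refine Runs.seq (Runs.switch (by decide) (h2 _ (List.getElem_mem hjl)) e5 (Q := fun s' =>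
    s'.nreg 34 = ∑ i ∈ range (j + 1), (if h : i < r then (v ⟨i, h⟩).val else 0) * 2 ^ i ∧
      s'.nreg 35 = 2 ^ j ∧ s'.nreg 32 = r - (j + 1)) fun w => ?_) fun s₃ _ hs₃ => Runs.instr ?_
  · rw [sum_range_succ, dif_pos hj, e4]
    cases hgx : g (C.stk κ)[j]
    · exact Runs.skip (by simp [e6, e7, e8, hI.1, hI.2.1])
    · exact Runs.instr (by simp [Instr.apply, e6, e7, e8, hI.1, hI.2.1])
  · simp [Instr.apply, hs₃.1, hs₃.2.1, hs₃.2.2, pow_succ, mul_two]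

/-- Tabulate, in integer array `0`, the function that the machine computes. -/
noncomputable def tableP (c : Coding Γ Λ σ) (M : Λ → Stmt Γ Λ σ) (p : Option Λ × σ) (κ₀ κ₁ : K)
    (g₀ : Option Bool → Γ κ₀) (g₁ : Γ κ₁ → Bool) : Prog :=
  .seq (.instr (.nconst 21 0)) (forP 23 2 (forP 24 6
    (.seq (.seq (c.initP κ₀ g₀ p) (.seq (c.runP M) (c.decodeP κ₁ g₁)))
      (block [.nstore 0 21 34, .nconst 29 1, .nadd 21 21 29]))))

/-- The instruction writes a parameter, or queries. -/
def _root_.SparseHadamard.Instr.param (i : Instr) : Bool :=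
  [0, 1, 2, 3, 6, 14, 16].any i.wN || i.asks

theorem any_param_tableP (c : Coding Γ Λ σ) (M : Λ → Stmt Γ Λ σ) (p : Option Λ × σ) (κ₀ κ₁ : K)
    (g₀ : Option Bool → Γ κ₀) (g₁ : Γ κ₁ → Bool) :
    (c.tableP M p κ₀ κ₁ g₀ g₁).any Instr.param = false := by
  have h : ∀ {p : Prog}, p.any Instr.outer = false → p.any Instr.param = false := fun h =>
    Prog.any_mono (fun i hi => by
      simp only [Instr.param, Instr.outer, List.any_cons, Bool.or_eq_true] at hi ⊢; tauto) h
  simp only [tableP, forP, Prog.any, h (any_outer_initP κ₀ g₀ p), h (any_outer_runP M),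
    h (any_outer_decodeP κ₁ g₁)]
  rfl

theorem runs_tableP [DecidableEq K] {M : Λ → Stmt Γ Λ σ} {p : Option Λ × σ} {κ₀ κ₁ : K}
    {g₀ : Option Bool → Γ κ₀} {g₁ : Γ κ₁ → Bool} {D W : ℕ} {C : ℕ → ℕ → Cfg Γ Λ σ}
    {w : ℕ → ℕ → F2 r} (hM : ∀ l, Pushes (fun κ => {x | x ∈ c.sym κ}) (M l))
    (hg : ∀ o, g₀ o ∈ c.sym κ₀) (hS : ∀ t j κ', κ' ≠ κ₀ → (C t j).stk κ' = [])
    (hp : ∀ t j, ((C t j).l, (C t j).var) = p)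
    (hC : ∀ t j, (C t j).stk κ₀ = (k.bits.map some ++ none ::
      ((List.range n).map (fun i => some (j.testBit i)) ++ none :: t.bits.map some)).map g₀)
    (hw : ∀ t < D, ∀ j < 2 ^ n,
      (((fun C => (step M C).getD C)^[W] (C t j)).stk κ₁).map g₁ = bitList (w t j))
    (hn : s.nreg 0 = n) (hk : s.nreg 1 = k) (hD : s.nreg 2 = D) (hr : s.nreg 3 = r)
    (hN : s.nreg 6 = 2 ^ n) (hW : s.nreg 16 = W) (hkn : k ≤ 2 ^ n) (hDn : D ≤ 2 ^ n)
    (hV : 3 * n + 5 ≤ V) (hV' : 2 ^ n ≤ V) (hrV : r ≤ V) (hWV : W ≤ V) :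
    Runs O V (c.tableP M p κ₀ κ₁ g₀ g₁) s fun s' =>
      ∀ t < D, ∀ j < 2 ^ n, s'.narr 0 (t * 2 ^ n + j) = index (w t j) := by
  let B := Prog.seq (c.initP κ₀ g₀ p) (.seq (c.runP M) (c.decodeP κ₁ g₁))
  have hB : B.any Instr.outer = false := by
    simp [B, Prog.any, any_outer_initP, any_outer_runP, any_outer_decodeP]
  have hBn : ∀ i ∈ [0, 1, 2, 3, 6, 14, 16, 21, 23, 24], B.any (·.wN i) = false := fun i hi =>
    Prog.any_mono (fun a ha => by
      rw [Instr.outer, List.any_eq_true.2 ⟨i, hi, ha⟩]; rfl) hB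
  have hBa : B.any (·.wNA 0) = false :=
    Prog.any_mono (fun a ha => by rw [Instr.outer, ha, Bool.or_true, Bool.true_or]) hB
  let I := Prog.seq B (block [.nstore 0 21 34, .nconst 29 1, .nadd 21 21 29])
  have hI : ∀ i ∈ [0, 1, 2, 3, 6, 14, 16, 23, 24], I.any (·.wN i) = false := fun i hi => by
    have h1 := hBn i (by simp only [List.mem_cons] at hi ⊢; tauto)
    simp only [I, Prog.any, h1, any_block]
    fin_cases hi <;> rfl
  have hL : ∀ i ∈ [0, 1, 2, 3, 6, 14, 16, 23], (forP 24 6 I).any (·.wN i) = false := fun i hi => by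
    have h1 := hI i (by simp only [List.mem_cons] at hi ⊢; tauto)
    simp only [forP, Prog.any, h1]
    fin_cases hi <;> rfl
  have hL' : ∀ i ∈ [0, 1, 2, 3, 6, 14, 16], (forP 23 2 (forP 24 6 I)).any (·.wN i) = false :=
    fun i hi => by
    have h1 := hL i (by simp only [List.mem_cons] at hi ⊢; tauto)
    rw [forP, Prog.any, Prog.any, Prog.any, Prog.any, h1]
    fin_cases hi <;> rfl
  refine Runs.instr_seq ?_
  rintro _ - rfl
  refine Runs.forP (p := forP 24 6 I) D (fun t s' => s'.nreg 21 = t * 2 ^ n ∧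
    ∀ t' < t, ∀ j < 2 ^ n, s'.narr 0 (t' * 2 ^ n + j) = index (w t' j))
    (by simpa [Instr.apply] using hD) (hDn.trans hV') ?_ (by simp [Instr.apply])
    (fun t ht s₁ hf₁ hi₁ hI₁ => ?_) fun _ _ h => h.2
  · simp only [loopOK, hL 23 (by simp), hL 2 (by simp)]
    rfl
  have n₁ : ∀ i ∈ [0, 1, 2, 3, 6, 14, 16], s₁.nreg i = s.nreg i := fun i hi => by
    rw [hf₁.n i (hL' i hi)]
    fin_cases hi <;> simp [Instr.apply]
  refine Runs.mono (Runs.forP (p := I) (Q := fun s' => s'.nreg 21 = t * 2 ^ n + 2 ^ n ∧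
      (∀ t' < t, ∀ j < 2 ^ n, s'.narr 0 (t' * 2 ^ n + j) = index (w t' j)) ∧
      ∀ j' < 2 ^ n, s'.narr 0 (t * 2 ^ n + j') = index (w t j')) (2 ^ n) (fun j s' =>
      s'.nreg 21 = t * 2 ^ n + j ∧
      (∀ t' < t, ∀ j < 2 ^ n, s'.narr 0 (t' * 2 ^ n + j) = index (w t' j)) ∧
      ∀ j' < j, s'.narr 0 (t * 2 ^ n + j') = index (w t j'))
    ((n₁ 6 (by simp)).trans hN) hV' ?_ ?_ (fun j hj s₂ hf₂ hi₂ hI₂ => ?_) fun _ _ h => h)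
    fun s₂ _ hs₂ => ?_
  · simp only [loopOK, hI 24 (by simp), hI 6 (by simp)]
    rfl
  · simpa using hI₁
  · have n₂ : ∀ i ∈ [0, 1, 2, 3, 6, 14, 16, 23], s₂.nreg i = s₁.nreg i := fun i hi =>
      hf₂.n i (hL i hi)
    have r16 : s₂.nreg 16 = W := (n₂ 16 (by simp)).trans ((n₁ 16 (by simp)).trans hW)
    have r3 : s₂.nreg 3 = r := (n₂ 3 (by simp)).trans ((n₁ 3 (by simp)).trans hr)
    refine Runs.seq (Q' := fun s' => s'.nreg 34 = index (w t j)) ?_ fun s₃ hf₃ hs₃ => ?_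
    · refine Runs.seq (hp t j ▸ runs_initP hg (hS t j)
        ((n₂ 0 (by simp)).trans ((n₁ 0 (by simp)).trans hn))
        ((n₂ 1 (by simp)).trans ((n₁ 1 (by simp)).trans hk))
        ((n₂ 23 (by simp)).trans hi₁) hi₂ hkn (ht.trans_le hDn) hV (hC t j))
        fun s₃ hf₃ hs₃ => ?_
      have k₃ : ∀ i ∈ [0, 1, 2, 3, 6, 14, 16, 21, 23, 24], s₃.nreg i = s₂.nreg i := fun i hi =>
        hf₃.n i (Prog.any_mono (fun a ha => by
          rw [Instr.outer, List.any_eq_true.2 ⟨i, hi, ha⟩]; rfl) (any_outer_initP κ₀ g₀ p))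
      refine Runs.seq (runs_runP hM hs₃ ((k₃ 16 (by simp)).trans r16) hWV) fun s₄ hf₄ hs₄ => ?_
      have k₄ : s₄.nreg 3 = s₃.nreg 3 :=
        hf₄.n 3 (Prog.any_mono (fun a ha => by
          rw [Instr.outer, List.any_eq_true.2 ⟨3, by simp, ha⟩]; rfl) (any_outer_runP M))
      exact runs_decodeP hs₄ (hw t ht j hj) (k₄.trans ((k₃ 3 (by simp)).trans r3)) hrV
    · have h21 : s₃.nreg 21 = t * 2 ^ n + j := (hf₃.n 21 (hBn 21 (by simp))).trans hI₂.1
      have ha : s₃.narr 0 = s₂.narr 0 := hf₃.na 0 hBa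
      refine Runs.block ⟨?_, fun t' ht' j' hj' => ?_, fun j' hj' => ?_⟩
      · simp [applyAll, Instr.apply, h21]; ring
      · have hne : t' * 2 ^ n + j' ≠ t * 2 ^ n + j := fun he => by
          have := congrArg (· / 2 ^ n) he
          simp only [mul_add_div_of_lt hj', mul_add_div_of_lt hj] at this
          omega
        simpa [applyAll, Instr.apply, h21, hne, ha] using hI₂.2.1 t' ht' j' hj'
      · rcases Nat.lt_succ_iff_lt_or_eq.1 hj' with hj' | rfl
        · simpa [applyAll, Instr.apply, h21, hj'.ne, ha] using hI₂.2.2 j' hj'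
        · simp [applyAll, Instr.apply, h21, hs₃]
  · refine ⟨by simp [hs₂.1]; ring, fun t' ht' j' hj' => ?_⟩
    rcases Nat.lt_succ_iff_lt_or_eq.1 ht' with ht' | rfl
    · exact hs₂.2.1 t' ht' j' hj'
    · exact hs₂.2.2 j' hj'

end Coding

theorem map_some_bitList_position (n j : ℕ) :
    (bitList (position n j)).map some = (List.range n).map fun i => some (j.testBit i) := by
  refine List.ext_getElem (by simp [bitList]) fun i h1 h2 => ?_
  simp only [bitList, position, List.getElem_map, List.getElem_ofFn, List.getElem_range]
  by_cases hb : j.testBit i = true <;> simp [hb]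

/-- The simulation needs a time bound that the machine itself can compute. Since `n < N`, the sum of
the coefficients times a power of `N` bounds the polynomial. -/
theorem exists_polynomial_bound (p : Polynomial ℕ) :
    ∃ C a : ℕ, ∀ n, p.eval n ≤ C * (2 ^ n) ^ a := by
  refine ⟨∑ i ∈ range (p.natDegree + 1), p.coeff i, p.natDegree, fun n => ?_⟩
  rw [Polynomial.eval_eq_sum_range, sum_mul]
  refine sum_le_sum fun i hi => Nat.mul_le_mul_left _ ?_
  exact (Nat.pow_le_pow_left Nat.lt_two_pow_self.le i).trans
    (Nat.pow_le_pow_right (by positivity) (Nat.lt_succ_iff.1 (mem_range.1 hi)))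

/-- A real RAM can tabulate an explicit family of functions. -/
theorem IsExplicit.exists_table {P : Set (ℕ × ℕ)} {D r : ℕ → ℕ → ℕ}
    {h : ∀ n k : ℕ, F2 n → Fin (D n k) → F2 (r n k)} (hP : IsExplicit P D r h) :
    ∃ (F : Prog) (C a : ℕ), F.any Instr.param = false ∧
      ∀ n k : ℕ, (n, k) ∈ P → ∀ (O : ℕ → ℝ) (V : ℕ) (s : State), s.nreg 0 = n → s.nreg 1 = k →
        s.nreg 2 = D n k → s.nreg 3 = r n k → s.nreg 6 = 2 ^ n → s.nreg 16 = C * (2 ^ n) ^ a →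
        k ≤ 2 ^ n → D n k ≤ 2 ^ n → r n k ≤ n → 3 * n + 5 ≤ V → 2 ^ n ≤ V →
        C * (2 ^ n) ^ a ≤ V → Runs O V F s fun s' => Tabulates (h n k) (s'.narr 0) := by
  classical
  obtain ⟨M, p, hM⟩ := hP
  obtain ⟨C, a, hCa⟩ := exists_polynomial_bound p
  have := M.tm.kFin
  have := M.tm.ΛFin
  have := M.tm.σFin
  have := M.tm.Γk₀Fin
  choose A hA hA' using fun l => exists_pushes (M.tm.m l)
  -- The symbols that can ever occur on a stack are those pushed by some label and, on the input
  -- stack, those of the input.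
  have hfin : ∀ κ, ((⋃ l, A l κ) ∪ {x | κ = M.tm.k₀}).Finite := fun κ => by
    refine (Set.finite_iUnion fun l => hA l κ).union ?_
    by_cases hκ : κ = M.tm.k₀
    · subst hκ; exact Set.toFinite _
    · exact Set.finite_empty.subset fun x hx => hκ hx
  let e := Fintype.equivFin M.tm.K
  let c : Coding M.tm.Γ M.tm.Λ M.tm.σ :=
    { num := fun κ => e κ
      inj := fun κ κ' hκ => e.injective (Fin.ext hκ)
      cnt := Fintype.card M.tm.K
      num_lt := fun κ => (e κ).2
      sym := fun κ => (hfin κ).toFinset.toList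
      ctl := Finset.univ.toList
      mem := fun q => by simp }
  let g₀ : Option Bool → M.tm.Γ M.tm.k₀ := M.inputAlphabet.symm
  refine ⟨c.tableP M.tm.m (some M.tm.main, M.tm.initialState) M.tm.k₀ M.tm.k₁ g₀
    M.outputAlphabet, C, a, Coding.any_param_tableP _ _ _ _ _ _ _, ?_⟩
  intro n k hnk O V s h0 h1 h2 h3 h6 h16 hkn hDn hrn hV hV' hWV
  -- The value `0` for seeds beyond the range is never used; it only makes `w` total.
  let w : ℕ → ℕ → F2 (r n k) := fun t j =>
    if ht : t < D n k then h n k (position n j) ⟨t, ht⟩ else 0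
  let C₀ : ℕ → ℕ → M.tm.Cfg := fun t j => Turing.initList M.tm ((k.bits.map some ++ none ::
      ((List.range n).map (fun i => some (j.testBit i)) ++ none :: t.bits.map some)).map g₀)
  refine Runs.mono (Coding.runs_tableP (c := c) (C := C₀) (w := w) ?_ ?_ ?_ (fun t j => rfl) ?_ ?_
    h0 h1 h2 h3 h6 h16 hkn hDn hV hV' ?_ hWV) fun s' _ hs' t j hj => ?_
  · intro l
    refine (hA' l).mono fun κ x hx => ?_
    simp only [c, Set.mem_ofPred_eq, Finset.mem_toList, Set.Finite.mem_toFinset]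
    exact .inl (Set.mem_iUnion.2 ⟨l, hx⟩)
  · intro o
    simp [c]
  · intro t j κ hκ
    simp [C₀, Turing.initList, hκ]
  · intro t j
    simp [C₀, Turing.initList]
  · intro t ht j hj
    obtain ⟨hrun⟩ := hM n k hnk (position n j) ⟨t, ht⟩
    have hle : p.eval n ≤ C * (2 ^ n) ^ a := hCa n
    have e1 := iterate_getD_of_evalsTo (m := C * (2 ^ n) ^ a)
      ⟨hrun.toEvalsTo, hrun.steps_le_m.trans hle⟩ (by rfl)
    have e2 : (condenserInput k (position n j) (⟨t, ht⟩ : Fin (D n k))).map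
        M.inputAlphabet.symm = (k.bits.map some ++ none ::
      ((List.range n).map (fun i => some (j.testBit i)) ++ none :: t.bits.map some)).map g₀ := by
      rw [condenserInput, map_some_bitList_position]
    rw [e2] at e1
    have e3 : w t j = h n k (position n j) ⟨t, ht⟩ := dif_pos ht
    rw [e3]
    refine (congrArg (fun C : M.tm.Cfg => (C.stk M.tm.k₁).map M.outputAlphabet) e1).trans ?_
    simp [Turing.haltList]
  · exact hrn.trans (by omega)
  · rw [hs' t t.2 j hj]
    simp [w]

/-! ### Choosing the condenser

If the given condenser has at least `N` buckets, it is replaced by the identity. -/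

/-- Compute `2 ^ n` and `2 ^ min n r`. -/
def sizeP : Prog :=
  .seq (.instr (.nconst 6 1)) (.seq (forP 20 0 (.instr (.nadd 6 6 6)))
  (.seq (block [.nconst 14 1, .nconst 15 0, .nconst 18 1])
    (forP 20 0 (.ite (.nlt 15 3) (block [.nadd 14 14 14, .nadd 15 15 18]) .skip))))

/-- Compute `C * N ^ a`. -/
def powP (C : ℕ) : ℕ → Prog
  | 0 => .instr (.nconst 16 C)
  | a + 1 => .seq (powP C a) (.seq (mulP 17 16 6) (block [.nconst 28 0, .nadd 16 17 28]))

/-- Tabulate the identity. -/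
def identityP : Prog :=
  .seq (block [.nconst 2 1, .nconst 28 0, .nadd 3 0 28, .nadd 14 6 28])
    (forP 20 6 (.instr (.nstore 0 20 20)))

/-- Choose between the condenser that `F` tabulates and the identity. -/
def chooseP (F : Prog) : Prog :=
  .ite (.nlt 3 0) (.ite (.nlt 2 6) (.seq (mulP 17 2 14) (.ite (.nlt 17 6) F identityP)) identityP)
    identityP

/-- Tabulate a condenser. -/
def fillP (F : Prog) (C a : ℕ) : Prog := .seq sizeP (.seq (powP C a) (chooseP F))

section

variable {O : ℕ → ℝ} {V n r D k : ℕ} {s : State}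

/-- The parameter `r` is not bounded in terms of `n`, and computing `2^r` could take too long; the
doubling therefore stops after `n` passes. -/
theorem sizeP_spec (hn : s.nreg 0 = n) (hr : s.nreg 3 = r) (hV : n ≤ V) :
    Runs O V sizeP s fun s' => s'.nreg 6 = 2 ^ n ∧ s'.nreg 14 = 2 ^ min n r := by
  refine Runs.instr_seq ?_
  rintro _ - rfl
  refine Runs.seq (Runs.forP n (fun j s' => s'.nreg 6 = 2 ^ j) (by simpa [Instr.apply] using hn) hV
    (by decide) (by simp [Instr.apply]) (fun j hj s₁ hf hi hI => Runs.instr ?_) fun _ _ h => h)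
    fun s₁ hf₁ hs₁ => ?_
  · simp [Instr.apply, hI, pow_succ, mul_two]
  refine Runs.block_seq fun s₂ hf₂ hs₂ => ?_
  have e6 : s₂.nreg 6 = 2 ^ n := (hf₂.n 6 (by decide)).trans hs₁
  have e0 : s₂.nreg 0 = n := (hf₂.n 0 (by decide)).trans
    ((hf₁.n 0 (by decide)).trans (by simpa [Instr.apply] using hn))
  have e3 : s₂.nreg 3 = r := (hf₂.n 3 (by decide)).trans
    ((hf₁.n 3 (by decide)).trans (by simpa [Instr.apply] using hr))
  refine Runs.forP n (fun j s' => s'.nreg 6 = 2 ^ n ∧ s'.nreg 14 = 2 ^ min j r ∧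
    s'.nreg 15 = min j r ∧ s'.nreg 18 = 1) e0 hV (by decide) ?_
    (fun j hj s₃ hf₃ hi hI => ?_) fun _ _ h => ⟨h.1, h.2.1⟩
  · rw [State.setN_nreg, if_neg (by decide), e6, hs₂]; simp [applyAll, Instr.apply]
  have h3 : s₃.nreg 3 = r := (hf₃.n 3 (by decide)).trans e3
  obtain ⟨h6, h14, h15, h18⟩ := hI
  refine Runs.ite (fun g => Runs.block ?_) fun g => Runs.skip ?_ <;>
    simp only [Test.Holds, h3, h15] at g
  · rw [min_eq_left (by omega : j ≤ r)] at h14 h15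
    rw [min_eq_left (by omega : j + 1 ≤ r)]
    simp [applyAll, Instr.apply, h6, h14, h15, h18, pow_succ, mul_two]
  · rw [min_eq_right (by omega : r ≤ j)] at h14 h15
    rw [min_eq_right (by omega : r ≤ j + 1)]
    simp [h6, h14, h15, h18]

theorem any_powP {f : Instr → Bool} (C a : ℕ) (hC : f (.nconst 16 C) = false)
    (h : (Prog.seq (mulP 17 16 6) (block [.nconst 28 0, .nadd 16 17 28])).any f = false) :
    (powP C a).any f = false := by
  induction a with
  | zero => exact hC
  | succ a ih => rw [powP, Prog.any, ih, h]; rfl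

theorem powP_spec {C : ℕ} (hn : s.nreg 6 = 2 ^ n) (a : ℕ) (hV : C * (2 ^ n) ^ a ≤ V) :
    Runs O V (powP C a) s fun s' => s'.nreg 16 = C * (2 ^ n) ^ a := by
  induction a with
  | zero => exact Runs.instr (by simp [Instr.apply])
  | succ a ih =>
    have h1 : C * (2 ^ n) ^ a ≤ V := (Nat.mul_le_mul_left _
      (Nat.pow_le_pow_right (by positivity) (Nat.le_succ a))).trans hV
    refine Runs.seq (ih h1) fun s₁ hf₁ hs₁ => ?_
    have h6 : s₁.nreg 6 = 2 ^ n :=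
      (hf₁.n 6 (any_powP C a (by rfl) (by rfl))).trans hn
    refine Runs.seq (mulP_spec hs₁ h1 h6 (by decide) (by decide) (by decide) (by decide)
      (by decide) (by decide) (by decide)) fun s₂ _ hs₂ => Runs.block ?_
    simp [applyAll, Instr.apply, hs₂, pow_succ, mul_assoc]

theorem identityP_spec (hn : s.nreg 0 = n) (hk : s.nreg 1 = k) (hN : s.nreg 6 = 2 ^ n)
    (hkn : k ≤ 2 ^ n) (hV : 128 * (2 ^ n * 2 ^ n) ≤ V) :
    Runs O V identityP s fun s' => TabCtx V n k 1 n (s'.narr 0) s' ∧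
      Tabulates (fun (v : F2 n) (_ : Fin 1) => v) (s'.narr 0) := by
  have hNV : 2 ^ n ≤ V := by
    have : 2 ^ n ≤ 2 ^ n * 2 ^ n := Nat.le_mul_of_pos_left _ (by positivity)
    omega
  refine Runs.block_seq fun s₁ hf₁ hs₁ => ?_
  have e6 : s₁.nreg 6 = 2 ^ n := (hf₁.n 6 (by decide)).trans hN
  refine Runs.forP (2 ^ n) (fun j s' => ∀ i < j, s'.narr 0 i = i) e6 hNV (by decide) (by simp)
    (fun j hj s₂ hf₂ hi hI => Runs.instr fun i hij => ?_) fun s₂ hf₂ hs₂ => ⟨⟨?_, ?_, ?_, ?_, ?_, ?_,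
      rfl, hkn, le_rfl, by simp, hV⟩, fun t j hj => ?_⟩
  · rcases Nat.lt_succ_iff_lt_or_eq.1 hij with hij | rfl
    · simpa [Instr.apply, hi, hij.ne] using hI i hij
    · simp [Instr.apply, hi]
  · exact (hf₂.n 0 (by decide)).trans ((hf₁.n 0 (by decide)).trans hn)
  · exact (hf₂.n 1 (by decide)).trans ((hf₁.n 1 (by decide)).trans hk)
  · rw [hf₂.n 2 (by decide), hs₁]; simp [applyAll, Instr.apply]
  · rw [hf₂.n 3 (by decide), hs₁]; simp [applyAll, Instr.apply, hn]
  · exact (hf₂.n 6 (by decide)).trans e6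
  · rw [hf₂.n 14 (by decide), hs₁]; simp [applyAll, Instr.apply, hN]
  · rw [index_position hj, Fin.val_eq_zero, zero_mul, zero_add]
    exact hs₂ j hj

/-- Is the given condenser used? -/
def Small (n D r : ℕ) : Prop := r < n ∧ D * 2 ^ r < 2 ^ n

/-- The tests `r < n` and `D < N` precede the multiplication and the call of `F`, so neither an
oversized `r` nor an oversized `D` costs more than the bound allows. -/
theorem fillP_spec {F : Prog} {C a : ℕ} {h : F2 n → Fin D → F2 r}
    (hF : F.any Instr.param = false) (hkn : k ≤ 2 ^ n) (hV : 128 * (2 ^ n * 2 ^ n) ≤ V)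
    (hV' : C * (2 ^ n) ^ a ≤ V)
    (hspec : Small n D r → ∀ s : State, s.nreg 0 = n → s.nreg 1 = k → s.nreg 2 = D →
      s.nreg 3 = r → s.nreg 6 = 2 ^ n → s.nreg 16 = C * (2 ^ n) ^ a →
      Runs O V F s fun s' => Tabulates h (s'.narr 0)) :
    Runs O V (fillP F C a) (initState n k D r) fun s' => s'.queries = [] ∧
      (Small n D r → TabCtx V n k D r (s'.narr 0) s' ∧ Tabulates h (s'.narr 0)) ∧
      (¬ Small n D r → TabCtx V n k 1 n (s'.narr 0) s' ∧
        Tabulates (fun (v : F2 n) (_ : Fin 1) => v) (s'.narr 0)) := by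
  have hnV : n ≤ V := by
    have h1 : 2 ^ n ≤ 2 ^ n * 2 ^ n := Nat.le_mul_of_pos_left _ (by positivity)
    have h2 : n < 2 ^ n := Nat.lt_two_pow_self
    omega
  have hNV : 2 ^ n ≤ V := by
    have h1 : 2 ^ n ≤ 2 ^ n * 2 ^ n := Nat.le_mul_of_pos_left _ (by positivity)
    omega
  have hFp : ∀ i ∈ [0, 1, 2, 3, 6, 14, 16], F.any (·.wN i) = false := fun i hi =>
    Prog.any_mono (fun a ha => by rw [Instr.param, List.any_eq_true.2 ⟨i, hi, ha⟩]; rfl) hF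
  have hFq : F.any (·.asks) = false :=
    Prog.any_mono (fun a ha => by rw [Instr.param, ha, Bool.or_true]) hF
  have hq : (fillP F C a).any (·.asks) = false := by
    have h1 : (powP C a).any (·.asks) = false := any_powP C a (by rfl) (by rfl)
    simp only [fillP, chooseP, Prog.any, h1, hFq]
    rfl
  refine Runs.mono (Q := fun s' =>
      (Small n D r → TabCtx V n k D r (s'.narr 0) s' ∧ Tabulates h (s'.narr 0)) ∧
      (¬ Small n D r → TabCtx V n k 1 n (s'.narr 0) s' ∧
        Tabulates (fun (v : F2 n) (_ : Fin 1) => v) (s'.narr 0))) ?_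
    fun s' hf hs' => ⟨hf.q hq, hs'⟩
  refine Runs.seq (sizeP_spec (n := n) (r := r) rfl rfl hnV) fun s₁ hf₁ hs₁ => ?_
  refine Runs.seq (powP_spec hs₁.1 a hV') fun s₂ hf₂ hs₂ => ?_
  have keep : ∀ i ∈ [0, 1, 2, 3], s₂.nreg i = (initState n k D r).nreg i := fun i hi => by
    rw [hf₂.n i, hf₁.n i]
    · fin_cases hi <;> rfl
    · refine any_powP C a ?_ ?_ <;> fin_cases hi <;> rfl
  have e0 : s₂.nreg 0 = n := keep 0 (by simp)
  have e1 : s₂.nreg 1 = k := keep 1 (by simp)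
  have e2 : s₂.nreg 2 = D := keep 2 (by simp)
  have e3 : s₂.nreg 3 = r := keep 3 (by simp)
  have e6 : s₂.nreg 6 = 2 ^ n := (hf₂.n 6 (any_powP C a (by rfl) (by rfl))).trans hs₁.1
  have e14 : s₂.nreg 14 = 2 ^ min n r := (hf₂.n 14 (any_powP C a (by rfl) (by rfl))).trans hs₁.2
  have hr1 : 1 ≤ 2 ^ r := Nat.one_le_two_pow
  have no : ∀ s₃ : State, s₃.nreg 0 = n → s₃.nreg 1 = k → s₃.nreg 6 = 2 ^ n → ¬ Small n D r →
      Runs O V identityP s₃ fun s' =>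
      (Small n D r → TabCtx V n k D r (s'.narr 0) s' ∧ Tabulates h (s'.narr 0)) ∧
      (¬ Small n D r → TabCtx V n k 1 n (s'.narr 0) s' ∧
        Tabulates (fun (v : F2 n) (_ : Fin 1) => v) (s'.narr 0)) := fun s₃ h0 h1 h6 hS =>
    Runs.mono (identityP_spec h0 h1 h6 hkn hV) fun s' _ hs' => ⟨fun h => absurd h hS, fun _ => hs'⟩
  refine Runs.ite (fun g => Runs.ite (fun g' => ?_) fun g' => no s₂ e0 e1 e6 fun hS => ?_)
    fun g => no s₂ e0 e1 e6 fun hS => ?_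
  · simp only [Test.Holds, e0, e2, e3, e6] at g g'
    rw [min_eq_right g.le] at e14
    refine Runs.seq (mulP_spec e2 (by omega) e14 (by decide) (by decide) (by decide) (by decide)
      (by decide) (by decide) (by decide)) fun s₃ hf₃ hs₃ => ?_
    have f0 : s₃.nreg 0 = n := (hf₃.n 0 (by decide)).trans e0
    have f1 : s₃.nreg 1 = k := (hf₃.n 1 (by decide)).trans e1
    have f2 : s₃.nreg 2 = D := (hf₃.n 2 (by decide)).trans e2
    have f3 : s₃.nreg 3 = r := (hf₃.n 3 (by decide)).trans e3
    have f6 : s₃.nreg 6 = 2 ^ n := (hf₃.n 6 (by decide)).trans e6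
    have f14 : s₃.nreg 14 = 2 ^ r := (hf₃.n 14 (by decide)).trans e14
    have f16 : s₃.nreg 16 = C * (2 ^ n) ^ a := (hf₃.n 16 (by decide)).trans hs₂
    refine Runs.ite (fun g'' => ?_) fun g'' => no s₃ f0 f1 f6 fun hS => ?_
    · simp only [Test.Holds, hs₃, f6] at g''
      refine Runs.mono (hspec ⟨g, g''⟩ s₃ f0 f1 f2 f3 f6 f16) fun s₄ hf₄ hs₄ =>
        ⟨fun _ => ⟨⟨?_, ?_, ?_, ?_, ?_, ?_, rfl, hkn, g.le, g''.le, hV⟩, hs₄⟩,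
          fun hS => absurd ⟨g, g''⟩ hS⟩
      · exact (hf₄.n 0 (hFp 0 (by simp))).trans f0
      · exact (hf₄.n 1 (hFp 1 (by simp))).trans f1
      · exact (hf₄.n 2 (hFp 2 (by simp))).trans f2
      · exact (hf₄.n 3 (hFp 3 (by simp))).trans f3
      · exact (hf₄.n 6 (hFp 6 (by simp))).trans f6
      · exact (hf₄.n 14 (hFp 14 (by simp))).trans f14
    · simp only [Test.Holds, hs₃, f6] at g''
      exact g'' hS.2
  -- `D ≥ N` already forces `D·2^r ≥ N`.
  · simp only [Test.Holds, e2, e6] at g'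
    have := hS.2
    nlinarith
  · simp only [Test.Holds, e0, e3] at g
    exact g hS.1

end

/-- The output is uniform on a copy of `S`, so its min-entropy is exactly `log #S` and it can serve
as its own reference law, at distance `0`. -/
theorem isLosslessCondenser_identity (n : ℕ) (κ : ℝ) {ε : ℝ} (hε : 0 ≤ ε) :
    IsLosslessCondenser κ ε (fun (v : F2 n) (_ : Fin 1) => v) := by
  classical
  intro S hS _
  refine ⟨seededOutput (fun (v : F2 n) (_ : Fin 1) => v) S hS, ?_, by simpa [statDist] using hε⟩
  have hval : ∀ p : Fin 1 × F2 n, seededOutput (fun (v : F2 n) (_ : Fin 1) => v) S hS p =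
      if p.2 ∈ S then (S.card : ENNReal)⁻¹ else 0 := by
    rintro ⟨t, v⟩
    rw [Subsingleton.elim t 0]
    simp only [seededOutput, PMF.bind_apply, PMF.map_apply, PMF.uniformOfFinset_apply,
      PMF.uniformOfFintype_apply, Prod.mk.injEq]
    rw [tsum_fintype, Finset.sum_eq_single v]
    · rw [tsum_fintype]; simp
    · intro w _ hw
      simp [Ne.symm hw]
    · simp
  have hset : (fun s => -Real.logb 2 (seededOutput (fun (v : F2 n) (_ : Fin 1) => v) S hS s).toReal) ''
      (seededOutput (fun (v : F2 n) (_ : Fin 1) => v) S hS).support = {Real.logb 2 S.card} := by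
    refine Set.Nonempty.subset_singleton_iff (Set.Nonempty.image _ (PMF.support_nonempty _)) |>.1 ?_
    rintro _ ⟨p, hp, rfl⟩
    rw [PMF.mem_support_iff, hval] at hp
    have hpS : p.2 ∈ S := by by_contra h; simp [h] at hp
    simp [hval, hpS, Real.logb_inv]
  rw [minEntropy, hset, csInf_singleton]
  simp

/-! ### The list of queries and the combined program -/

section

variable {n k D r : ℕ} {h : F2 n → Fin D → F2 r} {tab : ℕ → ℕ}

theorem Tabulates.position_queryPos (ht : Tabulates h tab) (t : Fin D) {a : ℕ} (ha : a < 2 ^ r) :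
    position n (queryPos n r tab (t * 2 ^ r + a)) =
      transposeApply (fun v => h v t) (position r a) := by
  rw [queryPos, mul_add_div_of_lt ha, mul_add_mod_of_lt' ha,
    position_sum_bits _ fun i => bitDot_le _ _ _]
  funext i
  have h2 : 2 ^ (i : ℕ) < 2 ^ n := Nat.pow_lt_pow_right (by norm_num) i.2
  rw [ht t _ h2, ← val_dotProduct_position, position_index, position_two_pow i.2, transposeApply]
  simp

/-- The positions of the queries. -/
def queryList (h : F2 n → Fin D → F2 r) : List ℕ :=
  (List.range (D * 2 ^ r)).map fun c => if hc : c / 2 ^ r < D then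
    index (transposeApply (fun v => h v ⟨c / 2 ^ r, hc⟩) (position r (c % 2 ^ r))) else 0

/-- The right side mentions only the condenser. This is the non-adaptivity: one list serves all
vectors. -/
theorem Tabulates.map_queryPos (ht : Tabulates h tab) :
    (List.range (D * 2 ^ r)).map (queryPos n r tab) = queryList h := by
  refine List.map_congr_left fun c hc => ?_
  have h1 : c / 2 ^ r < D := Nat.div_lt_of_lt_mul (by
    rw [mul_comm]; exact List.mem_range.1 hc)
  have h2 : c % 2 ^ r < 2 ^ r := Nat.mod_lt _ (by positivity)
  have h3 := ht.position_queryPos ⟨c / 2 ^ r, h1⟩ h2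
  simp only [Nat.div_add_mod'] at h3
  rw [dif_pos h1, ← h3, index_position]
  exact sum_bits_lt _ (fun i => bitDot_le _ _ _) _

theorem queryList_lt (h : F2 n → Fin D → F2 r) : ∀ q ∈ queryList h, q < 2 ^ n := by
  intro q hq
  obtain ⟨c, -, rfl⟩ := List.mem_map.1 hq
  split_ifs
  · exact index_lt _
  · positivity

theorem length_queryList (h : F2 n → Fin D → F2 r) : (queryList h).length = D * 2 ^ r := by
  simp [queryList]

theorem tail_image_index_le {x y : F2 n → ℝ} {S : Finset (F2 n)} (hS : ∀ i ∉ S, y i = 0) :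
    tail (2 ^ n) (fun q => x (position n q)) (S.image index) ≤ l1norm (x - y) := by
  rw [l1norm, ← sum_position (fun v => |(x - y) v|), tail]
  refine (sum_le_sum fun q hq => ?_).trans
    (sum_le_sum_of_subset_of_nonneg sdiff_subset fun _ _ _ => abs_nonneg _)
  obtain ⟨hq1, hq2⟩ := mem_sdiff.1 hq
  have h1 : position n q ∉ S := fun h1 =>
    hq2 (mem_image.2 ⟨_, h1, index_position (mem_range.1 hq1)⟩)
  simp [hS _ h1]

/-- Measure and recover, after a condenser has been tabulated. -/
theorem runs_recover [NeZero D] {V : ℕ} (hk : 2 ≤ k) (hlin : IsLinearCondenser h)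
    (hloss : IsLosslessCondenser (Real.logb 2 k) (1 / 10000000) h) (x : F2 n → ℝ) {s : State}
    (hs : TabCtx V n k D r tab s) (ht : Tabulates h tab) (hq : s.queries = []) :
    Runs (oracle (DHT x)) V (.seq measureP recoverP) s fun s' => s'.queries = queryList h ∧
      ∃ z : F2 n → ℝ, Outputs s' z ∧
        ∀ y : F2 n → ℝ, IsTopK k x y → l1norm (z - x) ≤ 26 * l1norm (x - y) := by
  classical
  -- The analysis uses a set `S` with the smallest tail among the sets of at most `k` positions. It
  -- is fixed before the run, so a single output serves every version of `H_k(x)`, however ties are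
  -- broken.
  let X : ℕ → ℝ := fun q => x (position n q)
  obtain ⟨S, hS, hmin⟩ := exists_min_image ((range (2 ^ n)).powerset.filter fun S => #S ≤ k)
    (tail (2 ^ n) X) ⟨∅, by simp⟩
  obtain ⟨hS1, hS2⟩ := mem_filter.1 hS
  refine Runs.seq (measureP_spec hs) fun s₁ hf₁ ⟨c₁, q₁, e₁, y₁⟩ => ?_
  have hsrc : ∀ e < D * 2 ^ n, s₁.narr 1 e = e % 2 ^ n := fun e he => (e₁ e he).1
  have hbkt : ∀ e < D * 2 ^ n, s₁.narr 2 e = e / 2 ^ n * 2 ^ r + tab e := fun e he => (e₁ e he).2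
  have G : Setting (2 ^ n) (D * 2 ^ n) (D * 2 ^ r) D k (s₁.narr 1) (s₁.narr 2) (s₁.rarr 1) X S :=
    { graph := ht.graph hsrc hbkt
      hd := NeZero.one_le
      hk := by omega
      hN := hk.trans hs.lek
      expands := ht.expands hloss hk hsrc hbkt
      hy := fun b hb => by
        have hb1 : b / 2 ^ r < D := Nat.div_lt_of_lt_mul (by rwa [mul_comm])
        have hb2 : b % 2 ^ r < 2 ^ r := Nat.mod_lt _ (by positivity)
        have h1 := ht.bucketSum_eq hlin hsrc hbkt x ⟨b / 2 ^ r, hb1⟩ hb2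
        have h2 := y₁ _ hb1 _ hb2
        simp only [Nat.div_add_mod'] at h1 h2
        rw [h1, h2]
        congr 1
        refine sum_congr rfl fun a ha => ?_
        rw [oracle, ht.position_queryPos ⟨b / 2 ^ r, hb1⟩ (mem_range.1 ha)]
      sub := mem_powerset.1 hS1
      card := hS2 }
  refine Runs.mono (recoverP_spec G c₁) fun s₂ hf₂ hs₂ => ⟨?_, fun v => s₂.rarr 0 (index v),
    fun q hq => by simp only [index_position hq], fun y hy => ?_⟩
  · rw [hf₂.q (by decide), q₁, hq, List.nil_append, ht.map_queryPos]
  · obtain ⟨S₀, hcard, -, -, hS₀⟩ := hy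
    have h1 : l1norm ((fun v => s₂.rarr 0 (index v)) - x) = nrm (2 ^ n) (s₂.rarr 0 - X) := by
      rw [l1norm, ← sum_position, nrm]
      refine sum_congr rfl fun q hq => ?_
      simp [X, index_position (mem_range.1 hq)]
    have h2 : tail (2 ^ n) X S ≤ tail (2 ^ n) X (S₀.image index) := hmin _ (mem_filter.2
      ⟨mem_powerset.2 fun q hq => by
        obtain ⟨v, -, rfl⟩ := mem_image.1 hq
        exact mem_range.2 (index_lt v), card_image_le.trans (by omega)⟩)
    rw [h1]
    exact hs₂.trans (mul_le_mul_of_nonneg_left (h2.trans (tail_image_index_le hS₀)) (by norm_num))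

end

end SparseHadamard
-- The main theorem
theorem mainTheorem7 :
    ∃ c : ℝ, 0 < c ∧ ∃ ε : ℝ, 0 < ε ∧
      ∀ (P : Set (ℕ × ℕ)) (D r : ℕ → ℕ → ℕ) [∀ n k, NeZero (D n k)]
        (h : ∀ n k : ℕ, SparseHadamard.F2 n → Fin (D n k) → SparseHadamard.F2 (r n k)),
        (∀ n k : ℕ, (n, k) ∈ P → 2 ≤ k ∧ k ≤ 2 ^ n ∧
          SparseHadamard.IsLinearCondenser (h n k) ∧
          SparseHadamard.IsLosslessCondenser (Real.logb 2 k) ε (h n k)) →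
        SparseHadamard.IsExplicit P D r h →
        ∃ (A : SparseHadamard.Prog) (C a : ℕ), ∀ n k : ℕ, (n, k) ∈ P →
          ∃ L : List ℕ, L.length ≤ D n k * 2 ^ r n k ∧ (∀ q ∈ L, q < 2 ^ n) ∧
            ∀ x : SparseHadamard.F2 n → ℝ,
              ∃ (s : SparseHadamard.State) (T : ℕ) (z : SparseHadamard.F2 n → ℝ),
                SparseHadamard.Exec (SparseHadamard.oracle (SparseHadamard.DHT x)) A
                  (SparseHadamard.initState n k (D n k) (r n k)) s T ∧
                T ≤ C * (2 ^ n) ^ a ∧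
                s.queries = L ∧
                SparseHadamard.Outputs s z ∧
                ∀ y : SparseHadamard.F2 n → ℝ, SparseHadamard.IsTopK k x y →
                  SparseHadamard.l1norm (z - x) ≤ c * SparseHadamard.l1norm (x - y) := by
  -- The constant `26` is that of `Located.final`; the error `10⁻⁷` is what
  -- `IsLosslessCondenser.expand` needs for sets of size `130k`.
  refine ⟨26, by norm_num, 1 / 10000000, by norm_num, ?_⟩
  intro P D r _ h hh hP
  obtain ⟨F, C, a, hF, hspec⟩ := hP.exists_table
  obtain ⟨C', a', hcost⟩ := SparseHadamard.Prog.cost_poly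
    (.seq (SparseHadamard.fillP F C a) (.seq SparseHadamard.measureP SparseHadamard.recoverP))
  refine ⟨.seq (SparseHadamard.fillP F C a)
    (.seq SparseHadamard.measureP SparseHadamard.recoverP), C' * (133 + C) ^ a', (a + 2) * a', fun n k hnk => ?_⟩
  obtain ⟨hk, hkn, hlin, hloss⟩ := hh n k hnk
  -- `V` bounds all loop counts: those of the recovery by `128 N²`, the length `3n + 5` of the
  -- machine input, and the simulated time `C N^a`.
  set V := (133 + C) * (2 ^ n) ^ (a + 2) with hVdef
  have h1 : 1 ≤ 2 ^ n := Nat.one_le_two_pow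
  have h2 : n < 2 ^ n := Nat.lt_two_pow_self
  have h3 : 1 ≤ (2 ^ n) ^ a := Nat.one_le_pow _ _ h1
  have h4 : 2 ^ n ≤ 2 ^ n * 2 ^ n := Nat.le_mul_of_pos_left _ h1
  have hV' : V = 133 * (2 ^ n * 2 ^ n) * (2 ^ n) ^ a + C * (2 ^ n) ^ a * (2 ^ n * 2 ^ n) := by
    rw [hVdef]; ring
  have h5 : 133 * (2 ^ n * 2 ^ n) ≤ 133 * (2 ^ n * 2 ^ n) * (2 ^ n) ^ a :=
    Nat.le_mul_of_pos_right _ h3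
  have h6 : C * (2 ^ n) ^ a ≤ C * (2 ^ n) ^ a * (2 ^ n * 2 ^ n) :=
    Nat.le_mul_of_pos_right _ (h1.trans h4)
  have hV : 128 * (2 ^ n * 2 ^ n) ≤ V := by omega
  have hCV : C * (2 ^ n) ^ a ≤ V := by omega
  have hT : ∀ T, T ≤ SparseHadamard.Prog.cost V (.seq (SparseHadamard.fillP F C a)
      (.seq SparseHadamard.measureP SparseHadamard.recoverP)) →
      T ≤ C' * (133 + C) ^ a' * (2 ^ n) ^ ((a + 2) * a') := fun T hT => by
    refine (hT.trans (hcost V (by omega))).trans_eq ?_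
    rw [hVdef, mul_pow, ← pow_mul, mul_assoc]
  have hfill := fun O : ℕ → ℝ => SparseHadamard.fillP_spec (O := O) (V := V) (h := h n k)
    hF hkn hV hCV fun hS s e0 e1 e2 e3 e6 e16 => hspec n k hnk O V s e0 e1 e2 e3 e6 e16 hkn
      ((Nat.le_mul_of_pos_right _ (by positivity)).trans hS.2.le) hS.1.le (by omega) (by omega) hCV
  by_cases hS : SparseHadamard.Small n (D n k) (r n k)
  · refine ⟨SparseHadamard.queryList (h n k), (SparseHadamard.length_queryList _).le,
      SparseHadamard.queryList_lt _, fun x => ?_⟩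
    obtain ⟨s, T, he, hle, hq, z, hz, hz'⟩ := SparseHadamard.Runs.seq (hfill _) fun s₁ _ hs₁ =>
      SparseHadamard.runs_recover hk hlin hloss x (hs₁.2.1 hS).1 (hs₁.2.1 hS).2 hs₁.1
    exact ⟨s, T, z, he, hT T hle, hq, hz, hz'⟩
  · refine ⟨SparseHadamard.queryList fun (v : SparseHadamard.F2 n) (_ : Fin 1) => v,
      (SparseHadamard.length_queryList _).trans_le ?_, SparseHadamard.queryList_lt _, fun x => ?_⟩
    -- Here the identity is used with `N` queries. They are allowed because the condenser has at
    -- least `N` buckets, either directly or because `r ≥ n`.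
    · have hD : 1 ≤ D n k := NeZero.one_le
      have hr : 1 ≤ 2 ^ r n k := Nat.one_le_two_pow
      rw [one_mul]
      by_cases hrn : r n k < n
      · exact not_lt.1 fun hlt => hS ⟨hrn, hlt⟩
      · exact (Nat.pow_le_pow_right (by norm_num) (not_lt.1 hrn)).trans
          (Nat.le_mul_of_pos_left _ hD)
    · obtain ⟨s, T, he, hle, hq, z, hz, hz'⟩ := SparseHadamard.Runs.seq (hfill _) fun s₁ _ hs₁ =>
        SparseHadamard.runs_recover hk (fun _ => ⟨fun _ _ => rfl, fun _ _ => rfl⟩)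
          (SparseHadamard.isLosslessCondenser_identity n _ (by norm_num)) x (hs₁.2.2 hS).1
          (hs₁.2.2 hS).2 hs₁.1
      exact ⟨s, T, z, he, hT T hle, hq, hz, hz'⟩
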